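/- **Setup.** Let $G=(V,E)$ be a finite undirected connected graph (no loops, no multiple edges) with weights $W_{ij}=W_{ji}>0$ for $\{i,j\}\in E$ and $W_{ij}=0$ otherwise, and let $\vec E=\{(i,j):\{i,j\}\in E\}$. Let $Y=(Y_t)_{t\ge0}$ be the vertex-reinforced jump process on $V$ started in $i_0\in V$, with underlying probability measure $P_{i_0}$: the càdlàg pure jump process with $Y_0=i_0$ which, given its past, jumps from its current vertex $i$ to $j$ at rate $W_{ij}L_j(t)$, where $L_j(t)=1+\int_0^t 1_{\{Y_\tau=j\}}\,d\tau$. Let $D(t)=\sum_{i\in V}(L_i(t)^2-1)$ and $Z_\sigma=Y_{D^{-1}(\sigma)}$. For $\sigma,\sigma'>0$ put $$l_i(\sigma)=\int_0^\sigma 1_{\{Z_\zeta=i\}}d\zeta,\quad l_i'(\sigma,\sigma')=l_i(\sigma+\sigma')-l_i(\sigma),$$ $$k_{ij}(\sigma)=|\{t\le\sigma:Z_{t-}=i,\,Z_t=j\}|,\quad k'_{ij}(\sigma,\sigma')=k_{ij}(\sigma+\sigma')-k_{ij}(\sigma),\qquad (i,j)\in\vec E.$$ The last exit tree $T^{\mathrm{last\,exit}}(a,b)$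 is the set of undirected edges along which $Z$ leaves, for the last time during $[a,b]$, the vertices visited during $[a,b]$ other than $Z_b$. Let $\mathcal L_\sigma=\{l\in(0,\infty)^V:\sum_i l_i=\sigma\}$, equipped with the measure $\prod_{i\in V\setminus\{i_0\}}dl_i$ (Lebesgue measure in the coordinates $l_i$, $i\ne i_0$). For $i,j\in V$ let $\mathcal K_{i,j}$ be the set of $k\in\mathbb Z^{\vec E}$ with $\sum_{w:\{v,w\}\in E}(k_{vw}-k_{wv})=1_{\{v=i\}}-1_{\{v=j\}}$ for all $v\in V$ (Kirchhoff's rule). Fix $\sigma,\sigma'>0$, $i_1,i_1'\in V$, a measurable $A\subseteq\mathcal L_\sigma\times\mathcal L_{\sigma'}$, and spanning trees $\vec T,\vec T'\subseteq\vec E$ of $G$ directed towards $i_1$ and $i_1'$ respectively, with undirected versions $T,T'$. For $k,k'\in\mathbb N_0^{\vec E}$ consider the events $$K_{k,k'}=\{k(\sigma)=k,\ k'(\sigma,\sigma')=k'\},\qquad L(A)=\{(l(\sigma),l'(\sigma,\sigma'))\in A\},$$ $$E_{\vec T,\vec T'}=\{Z_\sigma=i_1,\ Z_{\sigma+\sigma'}=i_1',\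 T^{\mathrm{last\,exit}}(0,\sigma)=T,\ T^{\mathrm{last\,exit}}(\sigma,\sigma+\sigma')=T'\}.$$ **Theorem.** (a) *Joint density.* For all $k\in\mathcal K_{i_0,i_1}$ and $k'\in\mathcal K_{i_1,i_1'}$ with strictly positive entries, $$P_{i_0}\big(K_{k,k'}\cap L(A)\cap E_{\vec T,\vec T'}\big)=\int_A \exp\Big(\sum_{\{i,j\}\in E}W_{ij}\big(1-\sqrt{1+l_i+l_i'}\sqrt{1+l_j+l_j'}\big)\Big)\prod_{i\in V\setminus\{i_1'\}}\frac1{\sqrt{1+l_i+l_i'}}\ \mathscr P(k,l,\vec T)\,\mathscr P(k',l',\vec T')\prod_{i\in V\setminus\{i_0\}}dl_i\,dl_i',$$ where $$\mathscr P(k,l,\vec T)=\prod_{(i,j)\in\vec E}\Big(\frac{W_{ij}l_i}{2}\Big)^{k_{ij}}\frac1{k_{ij}!}\prod_{(i,j)\in\vec T}\frac{k_{ij}}{l_i}.$$ (b) *Oriented random currents.* Conditionally on the local times $l(\sigma),l'(\sigma,\sigma')$ and on the event $E_{\vec T,\vec T'}$, the crossing numbers $k(\sigma)$ and $k'(\sigma,\sigma')$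 are independent oriented random currents. Precisely, for $l\in(0,\infty)^V$ and $i,j\in V$, and $\vec S$ a spanning tree directed towards $j$, let $Q^{i,j}_{l,\vec S}$ be the law of $(m_e+1_{\{e\in\vec S\}})_{e\in\vec E}$ where the $m_{(v,w)}$, $(v,w)\in\vec E$, are independent Poisson variables with parameters $W_{vw}l_v/2$, conditioned on $(m_e+1_{\{e\in\vec S\}})_{e\in\vec E}\in\mathcal K_{i,j}$. Then for all $k,k'\in\mathbb N_0^{\vec E}$, $$P_{i_0}\big(K_{k,k'}\cap L(A)\cap E_{\vec T,\vec T'}\big)=E_{i_0}\Big[1_{L(A)\cap E_{\vec T,\vec T'}}\;Q^{i_0,i_1}_{l(\sigma),\vec T}(\{k\})\;Q^{i_1,i_1'}_{l'(\sigma,\sigma'),\vec T'}(\{k'\})\Big].$$ -/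

import Mathlib

open MeasureTheory ProbabilityTheory Filter Topology
open scoped ENNReal NNReal

noncomputable section

namespace VRJP

variable {V : Type*} [Fintype V] [DecidableEq V]

/-! ### Functionals of a single path. A path is a function `y : ℝ → V`; only its values at
times `t ≥ 0` are ever used. -/

/-- The time `∫₀ᵗ 1_{y_s = i} ds` spent by the path `y` in the vertex `i` up to time `t`. -/
def timeSpent (y : ℝ → V) (i : V) (t : ℝ) : ℝ :=
  ∫ s in (0 : ℝ)..t, if y s = i then (1 : ℝ) else 0

/-- The local time with offset one, `L_i(t) = 1 + ∫₀ᵗ 1_{y_s = i} ds`. -/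
def offsetLocalTime (y : ℝ → V) (i : V) (t : ℝ) : ℝ := 1 + timeSpent y i t

/-- The clock `D(t) = ∑_i (L_i(t)² - 1)`. -/
def clock (y : ℝ → V) (t : ℝ) : ℝ := ∑ i, (offsetLocalTime y i t ^ 2 - 1)

/-- The inverse `D⁻¹(σ)`, `σ ≥ 0`, of the clock, as a first passage time. For a path that is
piecewise constant, `D` is an increasing homeomorphism of `[0, ∞)` and this is its inverse. -/
def clockInv (y : ℝ → V) (σ : ℝ) : ℝ := sInf {t : ℝ | 0 ≤ t ∧ σ ≤ clock y t}

/-- The time-changed path `z_σ = y_{D⁻¹(σ)}`. -/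
def timeChange (y : ℝ → V) (σ : ℝ) : V := y (clockInv y σ)

/-- The path `z` jumps from `i` to `j` at time `t > 0`, i.e. `z_{t-} = i` and `z_t = j`. -/
def JumpsAt (z : ℝ → V) (i j : V) (t : ℝ) : Prop :=
  0 < t ∧ (∀ᶠ s in 𝓝[<] t, z s = i) ∧ z t = j

variable (G : SimpleGraph V)

/-- The number of crossings of the directed edge `e` by the path `z` up to time `σ`. -/
def crossings (z : ℝ → V) (σ : ℝ) (e : G.Dart) : ℕ :=
  Set.ncard {t : ℝ | t ≤ σ ∧ JumpsAt z e.fst e.snd t}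

/-- The directed edges crossed by `z` at the last departures, during `[a, b]`, from the vertices
that are visited in `[a, b]` and differ from the endpoint `z_b`. -/
def lastExitDarts (z : ℝ → V) (a b : ℝ) : Set G.Dart :=
  {e | ∃ t, a < t ∧ t ≤ b ∧ JumpsAt z e.fst e.snd t ∧ ∀ u, t ≤ u → u ≤ b → z u ≠ e.fst}

/-- The undirected version of the last exit tree. -/
def lastExitTree (z : ℝ → V) (a b : ℝ) : Set (Sym2 V) :=
  SimpleGraph.Dart.edge '' lastExitDarts G z a b

/-! ### The vertex-reinforced jump process -/

/-- The rate `W_{ij} L_j(t)` at which a path sitting in `i` at time `t` jumps to `j`. -/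
def jumpRate (W : Sym2 V → ℝ) (y : ℝ → V) (i j : V) (t : ℝ) : ℝ :=
  W s(i, j) * offsetLocalTime y j t

/-- The total rate `∑_j W_{ij} L_j(t)` at which a path sitting in `i` at time `t` jumps. -/
def totalRate (W : Sym2 V → ℝ) (y : ℝ → V) (i : V) (t : ℝ) : ℝ :=
  ∑ j, jumpRate W y i j t

variable {Ω : Type*}

/-- The `n`-th jump time `τ_0 + ⋯ + τ_{n-1}`, for holding times `τ`. -/
def jumpTime (τ : ℕ → Ω → ℝ≥0∞) (n : ℕ) (ω : Ω) : ℝ≥0∞ := ∑ m ∈ Finset.range n, τ m ω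

/-- The event that the `n`-th jump takes place, that the first `n + 1` vertices of the jump chain
`X` are `x 0, …, x n` and that the first `n` holding times belong to `B`. -/
def history (X : ℕ → Ω → V) (τ : ℕ → Ω → ℝ≥0∞) (n : ℕ) (x : ℕ → V)
    (B : Set (Fin n → ℝ≥0∞)) : Set Ω :=
  {ω | jumpTime τ n ω < ∞ ∧ (∀ m ≤ n, X m ω = x m) ∧ (fun m : Fin n => τ m ω) ∈ B}

/-- `Y` is a vertex-reinforced jump process on `V` with weights `W`, started in `i₀`: a càdlàg pure
jump process `Y` with `Y_0 = i₀` that jumps from its current vertex `i` to `j` at rate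
`W_{ij} L_j(t)`. As long as `Y` stays in `i` the numbers `L_j(t)`, `j ≠ i`, are constant, and
`W_{ii} = 0`. So to have these jump rates means: given the history up to the `n`-th jump time `S_n`,
with `R = ∑_j W_{ij} L_j(S_n)` and `i = X_n` the current vertex, the next holding time is
exponential with parameter `R` (it is infinite if `R = 0`), and independently of it the next
vertex is `j` with probability `W_{ij} L_j(S_n) / R`. The vertices `X_n` have no meaning after
the last jump, if there is one. -/
structure IsVRJP [MeasurableSpace Ω] (W : Sym2 V → ℝ) (P : Measure Ω) (i₀ : V)
    (Y : ℝ → Ω → V) : Prop where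
  measurable : ∀ t, 0 ≤ t → ∀ i, MeasurableSet {ω | Y t ω = i}
  start : ∀ᵐ ω ∂P, Y 0 ω = i₀
  jumps : ∃ (X : ℕ → Ω → V) (τ : ℕ → Ω → ℝ≥0∞),
    (∀ n i, MeasurableSet {ω | X n ω = i}) ∧ (∀ n, Measurable (τ n)) ∧
    (∀ᵐ ω ∂P, ∀ t : ℝ, 0 ≤ t → ∃ n, jumpTime τ n ω ≤ ENNReal.ofReal t ∧
      ENNReal.ofReal t < jumpTime τ (n + 1) ω ∧ Y t ω = X n ω) ∧
    ∀ (n : ℕ) (x : ℕ → V) (B : Set (Fin n → ℝ≥0∞)), MeasurableSet B →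
      ∀ (t : ℝ), 0 ≤ t → ∀ j : V,
        P (history X τ n x B ∩
            {ω | ENNReal.ofReal t ≤ τ n ω ∧ τ n ω < ∞ ∧ X (n + 1) ω = j}) =
          ∫⁻ ω in history X τ n x B, ENNReal.ofReal
            (jumpRate W (fun s => Y s ω) (x n) j (jumpTime τ n ω).toReal /
                totalRate W (fun s => Y s ω) (x n) (jumpTime τ n ω).toReal *
              Real.exp (-(totalRate W (fun s => Y s ω) (x n) (jumpTime τ n ω).toReal * t))) ∂P

/-- The time-changed process `Z_σ = Y_{D⁻¹(σ)}`, as the random path `ω ↦ (σ ↦ Z_σ)`. -/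
def Z (Y : ℝ → Ω → V) (ω : Ω) : ℝ → V := timeChange (fun t => Y t ω)

/-- The local times `l(σ)` of `Z`. -/
def l (Y : ℝ → Ω → V) (σ : ℝ) (ω : Ω) : V → ℝ := fun i => timeSpent (Z Y ω) i σ

/-- The local times `l'(σ, σ')` of `Z` during `[σ, σ + σ']`. -/
def l' (Y : ℝ → Ω → V) (σ σ' : ℝ) (ω : Ω) : V → ℝ := fun i => l Y (σ + σ') ω i - l Y σ ω i

/-- The crossing numbers `k(σ)` of `Z`. -/
def k (Y : ℝ → Ω → V) (σ : ℝ) (ω : Ω) : G.Dart → ℤ := fun e => crossings G (Z Y ω) σ e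

/-- The crossing numbers `k'(σ, σ')` of `Z` during `[σ, σ + σ']`. -/
def k' (Y : ℝ → Ω → V) (σ σ' : ℝ) (ω : Ω) : G.Dart → ℤ :=
  fun e => k G Y (σ + σ') ω e - k G Y σ ω e

/-! ### Local time simplices, currents, directed spanning trees, events -/

/-- `𝓛_σ`: strictly positive local times with total mass `σ`. -/
def simplex (V : Type*) [Fintype V] (σ : ℝ) : Set (V → ℝ) :=
  {l | (∀ i, 0 < l i) ∧ ∑ i, l i = σ}

/-- The point of the hyperplane `∑_i l_i = σ` with given coordinates `l_i`, `i ≠ i₀`. -/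
def hyperplanePoint (i₀ : V) (σ : ℝ) (x : {i : V // i ≠ i₀} → ℝ) : V → ℝ :=
  fun i => if h : i ≠ i₀ then x ⟨i, h⟩ else σ - ∑ j, x j

/-- The measure `∏_{i ≠ i₀} dl_i` on the hyperplane `∑_i l_i = σ`. -/
def hyperplaneMeasure (i₀ : V) (σ : ℝ) : Measure (V → ℝ) :=
  (volume : Measure ({i : V // i ≠ i₀} → ℝ)).map (hyperplanePoint i₀ σ)

/-- `𝓚_{i,j}`: integer currents with a unit source in `i` and a unit sink in `j`. -/
def currents [DecidableRel G.Adj] (i j : V) : Set (G.Dart → ℤ) :=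
  {k | ∀ v, ∑ e : G.Dart with e.fst = v, (k e - k e.symm) =
    (if v = i then 1 else 0) - (if v = j then 1 else 0)}

variable {G}

/-- `T` is (the set of directed edges of) a spanning tree of `G` directed towards `r`. -/
structure IsTreeTowards (r : V) (T : Finset G.Dart) : Prop where
  no_exit : ∀ e ∈ T, e.fst ≠ r
  exit : ∀ i, i ≠ r → ∃! e, e ∈ T ∧ e.fst = i
  reach : ∀ i, Relation.ReflTransGen (fun a b => ∃ e ∈ T, e.fst = a ∧ e.snd = b) i r

/-- The event `K_{k,σ,k',σ'}`. -/
def eventK (Y : ℝ → Ω → V) (σ σ' : ℝ) (κ κ' : G.Dart → ℕ) : Set Ω :=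
  {ω | k G Y σ ω = (fun e => (κ e : ℤ)) ∧ k' G Y σ σ' ω = (fun e => (κ' e : ℤ))}

/-- The event `L_{σ,σ'}(A)`. -/
def eventL (Y : ℝ → Ω → V) (σ σ' : ℝ) (A : Set ((V → ℝ) × (V → ℝ))) : Set Ω :=
  {ω | (l Y σ ω, l' Y σ σ' ω) ∈ A}

/-- The event `E_{i₁,T,σ,i₁',T',σ'}`. -/
def eventE (Y : ℝ → Ω → V) (σ σ' : ℝ) (i₁ i₁' : V) (T T' : Finset G.Dart) : Set Ω :=
  {ω | Z Y ω σ = i₁ ∧ Z Y ω (σ + σ') = i₁' ∧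
    lastExitTree G (Z Y ω) 0 σ = SimpleGraph.Dart.edge '' (T : Set G.Dart) ∧
    lastExitTree G (Z Y ω) σ (σ + σ') = SimpleGraph.Dart.edge '' (T' : Set G.Dart)}

/-! ### The density and the current model -/

variable [DecidableRel G.Adj]

/-- The factor `𝒫(k, l, T)`. -/
def pathFactor (W : Sym2 V → ℝ) (κ : G.Dart → ℕ) (l : V → ℝ) (T : Finset G.Dart) : ℝ :=
  (∏ e : G.Dart, (W e.edge * l e.fst / 2) ^ κ e * (1 / ((κ e).factorial : ℝ))) *
    ∏ e ∈ T, (κ e : ℝ) / l e.fst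

variable (G) in
/-- The factor `exp(∑_{{i,j} ∈ E} W_{ij} (1 - √(1+m_i) √(1+m_j))) ∏_{i ≠ r} 1/√(1+m_i)`. -/
def expFactor (W : Sym2 V → ℝ) (r : V) (m : V → ℝ) : ℝ :=
  Real.exp (∑ e ∈ G.edgeFinset, W e * (1 - (e.map fun i => √(1 + m i)).mul)) *
    ∏ i ∈ Finset.univ.erase r, 1 / √(1 + m i)

/-- The crossing numbers obtained from `m` by one additional crossing of each edge of `T`. -/
def addTree (T : Finset G.Dart) (m : G.Dart → ℕ) : G.Dart → ℕ :=
  fun e => m e + if e ∈ T then 1 else 0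

/-- The oriented random current model with source `i`, sink `j`, local times `l` and tree `T`:
take independent Poisson variables `m_e` with parameters `W_e l_{e.fst} / 2`, one for each directed
edge `e`, add one crossing of each edge of `T`, and condition on Kirchhoff's rule for the
sum. -/
def orientedCurrent (W : Sym2 V → ℝ) (i j : V) (l : V → ℝ) (T : Finset G.Dart) :
    Measure (G.Dart → ℕ) :=
  (ProbabilityTheory.cond
      (Measure.pi fun e : G.Dart => poissonMeasure (W e.edge * l e.fst / 2).toNNReal)
      {m | (fun e => (addTree T m e : ℤ)) ∈ currents G i j}).map (addTree T)

end VRJP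

end

/-! In the clock of Z the offset local times are L_i = √(1 + l_i). Hence, if Z sits in i at local
times l, it leaves for j after a holding time s with density `holdDensity`: W_ij √(1+l_j) /
(2√(1+l_i+s)) times an exponential of the exit rate times √(1+l_i+s) − √(1+l_i). The function
`expFactor` is a potential for these densities. By `expFactor_mul_holdDensity`, multiplying by such
a density adds s to l_i, moves the omitted vertex of the product from i to j, and leaves a constant
W_ij/2. As `expFactor` is 1 at l = 0, the density of a whole trajectory is `expFactor` at the final
local times times a product of halved weights. It depends on the trajectory only through its
crossing numbers, its endpoint and its local times (partial exchangeability).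

The hold in progress at time σ + σ' contributes just the exponential that `expFactor` needs
(`expFactor_mul_survivalDensity`). The hold in progress at time σ is cut there, and by translation
invariance its remainder is again distributed as Lebesgue measure on (0, ∞). So the two periods
decouple except for `expFactor` at l + l' (`IsJumpChain.lintegral_piece`).

Two countings remain. The holding times with prescribed local times have volume density ∏_{v ≠ j}
l_v^(n_v − 1)/(n_v − 1)! · l_j^(n_j)/n_j!, where n_v is the number of departures from v and j is the
endpoint (`lintegral_occupation_fill`). The number of walks with given crossing numbers and last
exit tree is given by a formula of BEST type (`card_treeWalks_mul`). In the product the factorials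
of the n_v cancel and 𝒫(k, l, T) is left (`card_treeWalks_mul_density`). Summing over walks gives
the joint density for all k and k', with weight zero when Kirchhoff's rule fails.

For the random currents, 𝒫(k, l, T) is, up to a factor independent of k, the Poisson weight of k
minus one crossing of each tree edge (`poissonWeight_addTree`). Summing the joint density over k and
k' gives the density of the local times alone, and the quotient of the two densities is the product
of the two current laws. -/

set_option linter.unusedSectionVars false

noncomputable section

namespace VRJP

/-! ### Walks as lists of directed edges, last exits, Kirchhoff's rule -/

section Combinatorics

variable {V : Type*} [DecidableEq V] {G : SimpleGraph V}

/-- The list `d` of directed edges is a walk from `i` to `j`. -/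
def IsTrail : V → List G.Dart → V → Prop
  | i, [], j => i = j
  | i, e :: d, j => e.fst = i ∧ IsTrail e.snd d j

/-- The sequence of vertices along a list of directed edges, constant after its end. -/
def vertexSeq : V → List G.Dart → ℕ → V
  | i, [], _ => i
  | i, _ :: _, 0 => i
  | _, e :: d, m + 1 => vertexSeq e.snd d m

/-- `e` is the last edge of the list `d` that leaves its tail. -/
def LastExit (d : List G.Dart) (e : G.Dart) : Prop :=
  ∃ d₁ d₂, d = d₁ ++ e :: d₂ ∧ ∀ f ∈ d₂, f.fst ≠ e.fst

theorem vertexSeq_zero (i : V) (d : List G.Dart) : vertexSeq i d 0 = i := by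
  cases d <;> rfl

theorem IsTrail.append {i j r : V} {d d' : List G.Dart} (h : IsTrail i d j)
    (h' : IsTrail j d' r) : IsTrail i (d ++ d') r := by
  induction d generalizing i with
  | nil => cases h; exact h'
  | cons e d ih => exact ⟨h.1, ih h.2⟩

theorem IsTrail.vertexSeq_length {i j : V} {d : List G.Dart} (h : IsTrail i d j) :
    vertexSeq i d d.length = j := by
  induction d generalizing i with
  | nil => exact h
  | cons e d ih => exact ih h.2

theorem IsTrail.fst_getElem {i j : V} {d : List G.Dart} (h : IsTrail i d j) {m : ℕ}
    (hm : m < d.length) : d[m].fst = vertexSeq i d m := by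
  induction d generalizing i m with
  | nil => simp at hm
  | cons e d ih =>
    cases m with
    | zero => exact h.1
    | succ m => exact ih h.2 (by simpa using hm)

theorem vertexSeq_succ {i : V} {d : List G.Dart} {m : ℕ}
    (hm : m < d.length) : vertexSeq i d (m + 1) = d[m].snd := by
  induction d generalizing i m with
  | nil => simp at hm
  | cons e d ih =>
    cases m with
    | zero => exact vertexSeq_zero _ _
    | succ m => exact ih (by simpa using hm)

theorem vertexSeq_append_left {i : V} {d d' : List G.Dart} {m : ℕ} (hm : m < d.length) :
    vertexSeq i (d ++ d') m = vertexSeq i d m := by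
  induction d generalizing i m with
  | nil => simp at hm
  | cons e d ih =>
    cases m with
    | zero => rfl
    | succ m => exact ih (by simpa using hm)

theorem IsTrail.vertexSeq_append_right {i j : V} {d d' : List G.Dart} (h : IsTrail i d j) (m : ℕ) :
    vertexSeq i (d ++ d') (d.length + m) = vertexSeq j d' m := by
  induction d generalizing i with
  | nil => cases h; simp
  | cons e d ih =>
    rw [List.length_cons, Nat.add_right_comm]
    exact ih h.2

theorem IsTrail.vertexSeq_append_le {i j : V} {d d' : List G.Dart} (h : IsTrail i d j) {m : ℕ}
    (hm : m ≤ d.length) : vertexSeq i (d ++ d') m = vertexSeq i d m := by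
  rcases hm.lt_or_eq with hm | rfl
  · exact vertexSeq_append_left hm
  · rw [h.vertexSeq_length, ← Nat.add_zero d.length, h.vertexSeq_append_right, vertexSeq_zero]

/-- A sequence of successively adjacent vertices comes from a list of directed edges. -/
theorem exists_isTrail_of_adj (n : ℕ) (x : ℕ → V) (h : ∀ m < n, G.Adj (x m) (x (m + 1))) :
    ∃ d : List G.Dart, d.length = n ∧ IsTrail (x 0) d (x n) ∧
      ∀ m ≤ n, vertexSeq (x 0) d m = x m := by
  induction n generalizing x with
  | zero => exact ⟨[], rfl, rfl, fun m hm => by rw [Nat.le_zero.1 hm, vertexSeq_zero]⟩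
  | succ n ih =>
    obtain ⟨d, hd, ht, hs⟩ := ih (fun m => x (m + 1)) fun m hm => h (m + 1) (by omega)
    refine ⟨⟨(x 0, x 1), h 0 (by omega)⟩ :: d, by simp [hd], ⟨rfl, ht⟩, fun m hm => ?_⟩
    cases m with
    | zero => rfl
    | succ m => exact hs m (by omega)

/-- A walk is determined by its sequence of vertices. -/
theorem IsTrail.eq_of_vertexSeq {i j j' : V} {d d' : List G.Dart} (h : IsTrail i d j)
    (h' : IsTrail i d' j') (hl : d.length = d'.length)
    (hs : ∀ m ≤ d.length, vertexSeq i d m = vertexSeq i d' m) : d = d' := by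
  refine List.ext_getElem hl fun m hm hm' => ?_
  refine SimpleGraph.Dart.ext _ _ (Prod.ext ?_ ?_)
  · exact (h.fst_getElem hm).trans ((hs m hm.le).trans (h'.fst_getElem hm').symm)
  · exact (vertexSeq_succ hm).symm.trans ((hs (m + 1) hm).trans (vertexSeq_succ hm'))

theorem lastExit_nil (f : G.Dart) : ¬ LastExit [] f := by
  rintro ⟨d₁, d₂, h, -⟩
  simp at h

theorem lastExit_cons {e f : G.Dart} {d : List G.Dart} :
    LastExit (e :: d) f ↔ LastExit d f ∨ (f = e ∧ ∀ e' ∈ d, e'.fst ≠ e.fst) := by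
  constructor
  · rintro ⟨d₁, d₂, h, h'⟩
    cases d₁ with
    | nil =>
      simp only [List.nil_append, List.cons.injEq] at h
      obtain ⟨rfl, rfl⟩ := h
      exact Or.inr ⟨rfl, h'⟩
    | cons a d₁ =>
      simp only [List.cons_append, List.cons.injEq] at h
      exact Or.inl ⟨d₁, d₂, h.2, h'⟩
  · rintro (⟨d₁, d₂, rfl, h'⟩ | ⟨rfl, h⟩)
    · exact ⟨e :: d₁, d₂, rfl, h'⟩
    · exact ⟨[], d, rfl, h⟩

theorem LastExit.mem {e : G.Dart} {d : List G.Dart} (h : LastExit d e) : e ∈ d := by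
  obtain ⟨d₁, d₂, rfl, -⟩ := h
  simp

theorem exists_lastExit {d : List G.Dart} {v : V} (h : ∃ e ∈ d, e.fst = v) :
    ∃ e, LastExit d e ∧ e.fst = v := by
  induction d with
  | nil => simp at h
  | cons a d ih =>
    by_cases h' : ∃ e ∈ d, e.fst = v
    · obtain ⟨e, he, hv⟩ := ih h'
      exact ⟨e, lastExit_cons.2 (Or.inl he), hv⟩
    · push Not at h'
      obtain ⟨e, he, hv⟩ := h
      rcases List.mem_cons.1 he with rfl | he
      · exact ⟨e, lastExit_cons.2 (Or.inr ⟨rfl, fun f hf => hv ▸ h' f hf⟩), hv⟩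
      · exact absurd hv (h' e he)

theorem LastExit.unique {d : List G.Dart} {e f : G.Dart} (he : LastExit d e) (hf : LastExit d f)
    (h : e.fst = f.fst) : e = f := by
  induction d with
  | nil => exact absurd he (lastExit_nil _)
  | cons a d ih =>
    rcases lastExit_cons.1 he with h₁ | ⟨h₁, h₁'⟩ <;>
      rcases lastExit_cons.1 hf with h₂ | ⟨h₂, h₂'⟩
    · exact ih h₁ h₂
    · exact absurd (h₂ ▸ h) (h₂' _ h₁.mem)
    · exact absurd (h₁ ▸ h.symm) (h₁' _ h₂.mem)
    · rw [h₁, h₂]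

theorem lastExit_iff_getElem {d : List G.Dart} {e : G.Dart} :
    LastExit d e ↔ ∃ m, ∃ hm : m < d.length, d[m] = e ∧
      ∀ r (hr : r < d.length), m < r → d[r].fst ≠ e.fst := by
  constructor
  · rintro ⟨d₁, d₂, rfl, h⟩
    refine ⟨d₁.length, by simp, by simp, fun r hr hlt => ?_⟩
    refine h _ ?_
    rw [List.getElem_append_right hlt.le, List.getElem_cons]
    rw [dif_neg (by omega)]
    exact List.getElem_mem _
  · rintro ⟨m, hm, rfl, h⟩
    refine ⟨d.take m, d.drop (m + 1), ?_, fun f hf => ?_⟩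
    · simp
    · obtain ⟨r, hr, rfl⟩ := List.mem_iff_getElem.1 hf
      rw [List.getElem_drop]
      exact h _ (by simp at hr; omega) (by omega)

variable [Fintype V] [DecidableRel G.Adj]

/-- The number of departures from `v`. -/
def outFlow (κ : G.Dart → ℕ) (v : V) : ℕ := ∑ e : G.Dart with e.fst = v, κ e

/-- The number of arrivals in `v`. -/
def inFlow (κ : G.Dart → ℕ) (v : V) : ℕ := ∑ e : G.Dart with e.snd = v, κ e

/-- Kirchhoff's rule, written without subtraction. -/
def Kirchhoff (κ : G.Dart → ℕ) (i j : V) : Prop :=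
  ∀ v, outFlow κ v + (if v = j then 1 else 0) = inFlow κ v + (if v = i then 1 else 0)

theorem sum_symm_eq_inFlow (κ : G.Dart → ℕ) (v : V) :
    ∑ e : G.Dart with e.fst = v, κ e.symm = inFlow κ v := by
  unfold inFlow
  refine Finset.sum_bij' (fun e _ => e.symm) (fun e _ => e.symm) ?_ ?_ ?_ ?_ ?_ <;> simp

theorem mem_currents_iff {κ : G.Dart → ℕ} {i j : V} :
    (fun e => (κ e : ℤ)) ∈ currents G i j ↔ Kirchhoff κ i j := by
  unfold currents Kirchhoff
  refine forall_congr' fun v => ?_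
  rw [Finset.sum_sub_distrib, ← sum_symm_eq_inFlow, outFlow]
  zify
  constructor <;> intro h <;> linarith

theorem outFlow_add_single (κ : G.Dart → ℕ) (e : G.Dart) (v : V) :
    outFlow (κ + Pi.single e 1) v = outFlow κ v + if e.fst = v then 1 else 0 := by
  simp only [outFlow, Pi.add_apply, Finset.sum_add_distrib, Finset.sum_pi_single',
    Finset.mem_filter, Finset.mem_univ, true_and]

theorem inFlow_add_single (κ : G.Dart → ℕ) (e : G.Dart) (v : V) :
    inFlow (κ + Pi.single e 1) v = inFlow κ v + if e.snd = v then 1 else 0 := by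
  simp only [inFlow, Pi.add_apply, Finset.sum_add_distrib, Finset.sum_pi_single',
    Finset.mem_filter, Finset.mem_univ, true_and]

/-- This drives the inductions over walks: the first edge hands the unit source from its tail to its
head. -/
theorem kirchhoff_add_single {κ : G.Dart → ℕ} {e : G.Dart} {j : V} :
    Kirchhoff (κ + Pi.single e 1) e.fst j ↔ Kirchhoff κ e.snd j := by
  unfold Kirchhoff
  refine forall_congr' fun v => ?_
  rw [outFlow_add_single, inFlow_add_single]
  simp only [eq_comm (a := v)]
  split_ifs <;> omega

/-- The number of crossings of each directed edge by a walk. -/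
def crossCount (d : List G.Dart) : G.Dart → ℕ := fun e => d.count e

theorem crossCount_cons (e : G.Dart) (d : List G.Dart) :
    crossCount (e :: d) = crossCount d + Pi.single e 1 := by
  ext f
  simp only [crossCount, List.count_cons, Pi.add_apply, Pi.single_apply, beq_iff_eq]
  simp only [eq_comm]

theorem crossCount_nil : crossCount ([] : List G.Dart) = 0 := by
  ext f
  simp [crossCount]

theorem IsTrail.kirchhoff {i j : V} {d : List G.Dart} (h : IsTrail i d j) :
    Kirchhoff (crossCount d) i j := by
  induction d generalizing i with
  | nil =>
    cases h
    intro v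
    simp [crossCount_nil, outFlow, inFlow]
  | cons e d ih =>
    rw [crossCount_cons, ← h.1]
    exact kirchhoff_add_single.2 (ih h.2)

theorem outFlow_pos_iff {κ : G.Dart → ℕ} {v : V} :
    0 < outFlow κ v ↔ ∃ e : G.Dart, e.fst = v ∧ 0 < κ e := by
  rw [outFlow, Finset.sum_pos_iff]
  simp

theorem outFlow_crossCount_pos_iff {d : List G.Dart} {v : V} :
    0 < outFlow (crossCount d) v ↔ ∃ e ∈ d, e.fst = v := by
  rw [outFlow_pos_iff]
  simp only [crossCount, List.count_pos_iff]
  exact exists_congr fun e => and_comm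

end Combinatorics

/-! ### Directed spanning trees and their undirected versions -/

section Trees

variable {V : Type*} {G : SimpleGraph V}

theorem IsTreeTowards.eq_of_fst_eq {r : V} {T : Finset G.Dart} (hT : IsTreeTowards r T)
    {e f : G.Dart} (he : e ∈ T) (hf : f ∈ T) (h : e.fst = f.fst) : e = f :=
  (hT.exit f.fst (hT.no_exit f hf)).unique ⟨he, h⟩ ⟨hf, rfl⟩

/-- If T contained both orientations, they would be the only exits from the two endpoints, and
following T from there would oscillate forever instead of reaching r. The induction runs backwards
from r. -/
theorem IsTreeTowards.symm_notMem {r : V} {T : Finset G.Dart} (hT : IsTreeTowards r T)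
    {e : G.Dart} (he : e ∈ T) : e.symm ∉ T := by
  intro he'
  have key : ∀ a, Relation.ReflTransGen (fun a b => ∃ e ∈ T, e.fst = a ∧ e.snd = b) a r →
      a ≠ e.fst ∧ a ≠ e.snd := by
    intro a ha
    induction ha using Relation.ReflTransGen.head_induction_on with
    | refl => exact ⟨fun h => hT.no_exit e he h.symm, fun h => hT.no_exit _ he' h.symm⟩
    | head hab _ ih =>
      obtain ⟨f, hf, rfl, rfl⟩ := hab
      refine ⟨fun h => ih.2 ?_, fun h => ih.1 ?_⟩
      · rw [hT.eq_of_fst_eq hf he h]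
      · rw [hT.eq_of_fst_eq hf he' h]; rfl
  exact (key e.fst (hT.reach _)).1 rfl

/-- A set of directed edges with at most one exit from each vertex and none from the root is
determined by its undirected version if the latter is that of a directed spanning tree. -/
theorem IsTreeTowards.eq_of_image_edge_eq {r : V} {T : Finset G.Dart} (hT : IsTreeTowards r T)
    {S : Set G.Dart} (hr : ∀ e ∈ S, e.fst ≠ r) (hu : ∀ e ∈ S, ∀ f ∈ S, e.fst = f.fst → e = f)
    (h : SimpleGraph.Dart.edge '' S = SimpleGraph.Dart.edge '' (T : Set G.Dart)) :
    S = (T : Set G.Dart) := by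
  have mem_or : ∀ e ∈ T, e ∈ S ∨ e.symm ∈ S := by
    intro e he
    have : e.edge ∈ SimpleGraph.Dart.edge '' S := h ▸ ⟨e, he, rfl⟩
    obtain ⟨f, hf, hfe⟩ := this
    rcases SimpleGraph.dart_edge_eq_iff f e |>.1 hfe with rfl | rfl
    · exact Or.inl hf
    · exact Or.inr hf
  -- Suppose S contains the reverse of e ∈ T. Then S already leaves the head of e through `e.symm`,
  -- so the T-edge f out of that head cannot lie in S and its reverse must. Repeating this leads to
  -- r, which S never leaves.
  have key : ∀ b, Relation.ReflTransGen (fun a b => ∃ e ∈ T, e.fst = a ∧ e.snd = b) b r →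
      ∀ e ∈ T, e.snd = b → e.symm ∉ S := by
    intro b hb
    induction hb using Relation.ReflTransGen.head_induction_on with
    | refl => exact fun e _ heb hes => hr _ hes heb
    | head hab _ ih =>
      obtain ⟨f, hf, rfl, rfl⟩ := hab
      intro e he heb hes
      rcases mem_or f hf with hfS | hfS
      · have := hu _ hes _ hfS heb
        exact hT.symm_notMem he (this ▸ hf)
      · exact ih f hf rfl hfS
  have hTS : ∀ e ∈ T, e ∈ S := fun e he =>
    (mem_or e he).resolve_right (key _ (hT.reach _) e he rfl)
  ext e
  refine ⟨fun he => ?_, hTS e⟩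
  obtain ⟨f, ⟨hf, hfe⟩, -⟩ := hT.exit e.fst (hr e he)
  rw [hu e he f (hTS f hf) hfe.symm]
  exact hf

end Trees

/-! ### Number of walks with given crossing numbers and last exit tree (BEST-type formula) -/

section Counting

variable {V : Type*} [Fintype V] [DecidableEq V] {G : SimpleGraph V} [DecidableRel G.Adj]

/-- The walks of length `n` from `i` to `j` with crossing numbers `κ` whose last exits from
vertices other than `j` belong to `T`. -/
def walks (T : Finset G.Dart) (j : V) : ℕ → V → (G.Dart → ℕ) → Finset (List G.Dart)
  | 0, i, κ => if i = j ∧ κ = 0 then {[]} else ∅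
  | n + 1, i, κ =>
    (Finset.univ.filter fun e : G.Dart =>
      e.fst = i ∧ 0 < κ e ∧ (e.fst ≠ j → outFlow κ i = 1 → e ∈ T)).biUnion fun e =>
        (walks T j n e.snd (κ - Pi.single e 1)).image (List.cons e)

theorem sub_single_add_single {κ : G.Dart → ℕ} {e : G.Dart} (h : 0 < κ e) :
    κ - Pi.single e 1 + Pi.single e 1 = κ := by
  ext f
  by_cases hf : f = e
  · subst hf; simp; omega
  · simp [hf]

/-- Since κ counts the crossings still to be made, `outFlow κ i = 1` means that the step at hand is
the last exit from i. Only then does `walks` test membership in T. -/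
theorem mem_walks {T : Finset G.Dart} {j : V} {n : ℕ} {i : V} {κ : G.Dart → ℕ}
    {d : List G.Dart} : d ∈ walks T j n i κ ↔ d.length = n ∧ IsTrail i d j ∧ crossCount d = κ ∧
      ∀ e, LastExit d e → e.fst ≠ j → e ∈ T := by
  induction n generalizing i κ d with
  | zero =>
    simp only [walks, List.length_eq_zero_iff]
    split_ifs with h
    · obtain ⟨rfl, rfl⟩ := h
      rw [Finset.mem_singleton]
      refine ⟨?_, fun h => h.1⟩
      rintro rfl
      exact ⟨rfl, rfl, crossCount_nil, fun e he => absurd he (lastExit_nil e)⟩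
    · refine ⟨fun h => absurd h (Finset.notMem_empty _), ?_⟩
      rintro ⟨rfl, h1, h2, -⟩
      exact absurd ⟨h1, h2.symm.trans crossCount_nil⟩ h
  | succ n ih =>
    simp only [walks, Finset.mem_biUnion, Finset.mem_filter, Finset.mem_univ, true_and,
      Finset.mem_image]
    constructor
    · rintro ⟨e, ⟨rfl, hpos, hlast⟩, d', hd', rfl⟩
      obtain ⟨hl, ht, hc, hT⟩ := ih.1 hd'
      have hκ : crossCount (e :: d') = κ := by
        rw [crossCount_cons, hc, sub_single_add_single hpos]
      refine ⟨by simp [hl], ⟨rfl, ht⟩, hκ, fun f hf hfj => ?_⟩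
      rcases lastExit_cons.1 hf with hf | ⟨rfl, hf⟩
      · exact hT f hf hfj
      · refine hlast hfj ?_
        rw [← hκ, crossCount_cons, outFlow_add_single, if_pos rfl]
        by_contra hne
        obtain ⟨e', he', h'⟩ := outFlow_crossCount_pos_iff.1
          (Nat.pos_of_ne_zero fun h0 => hne (by rw [h0] : outFlow (crossCount d') f.fst + 1 = 1))
        exact hf e' he' h'
    · rintro ⟨hl, ht, rfl, hT⟩
      cases d with
      | nil => simp at hl
      | cons e d =>
        refine ⟨e, ⟨ht.1, by simp [crossCount], fun hej h1 => ?_⟩, d, ?_, rfl⟩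
        · refine hT e (lastExit_cons.2 (Or.inr ⟨rfl, fun f hf hfe => ?_⟩)) hej
          have hp := outFlow_crossCount_pos_iff.2 ⟨f, hf, hfe⟩
          rw [crossCount_cons, outFlow_add_single, if_pos ht.1, ← ht.1] at h1
          omega
        · refine ih.2 ⟨by simpa using hl, ht.2, ?_, fun f hf => hT f (lastExit_cons.2 (Or.inl hf))⟩
          rw [crossCount_cons, add_tsub_cancel_right]

/-- The flow through the edges of `T` out of `v`. -/
def treeFlow (T : Finset G.Dart) (κ : G.Dart → ℕ) (v : V) : ℕ := ∑ e ∈ T with e.fst = v, κ e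

theorem treeFlow_add_single (T : Finset G.Dart) (κ : G.Dart → ℕ) (e : G.Dart) (v : V) :
    treeFlow T (κ + Pi.single e 1) v = treeFlow T κ v + if e ∈ T ∧ e.fst = v then 1 else 0 := by
  simp only [treeFlow, Pi.add_apply, Finset.sum_add_distrib, Finset.sum_pi_single',
    Finset.mem_filter]

/-- The contribution of the vertex `v`, not the endpoint, to the number of walks. -/
def vertexFactor (T : Finset G.Dart) (κ : G.Dart → ℕ) (v : V) : ℕ :=
  if outFlow κ v = 0 then 1 else treeFlow T κ v * (outFlow κ v - 1).factorial

theorem vertexFactor_sub_single {T : Finset G.Dart} {κ : G.Dart → ℕ} {e : G.Dart} (h : 0 < κ e)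
    {v : V} (hv : e.fst ≠ v) : vertexFactor T (κ - Pi.single e 1) v = vertexFactor T κ v := by
  conv_rhs => rw [← sub_single_add_single h]
  simp only [vertexFactor, outFlow_add_single, treeFlow_add_single, hv, and_false, if_false,
    add_zero]

theorem sum_filter_pos_mul (s : Finset G.Dart) (κ f : G.Dart → ℕ) :
    ∑ e ∈ s with 0 < κ e, κ e * f e = ∑ e ∈ s, κ e * f e := by
  refine Finset.sum_filter_of_ne fun e _ h => ?_
  exact Nat.pos_of_ne_zero fun h0 => h (by rw [h0, zero_mul])

/-- Let t be the tree flow out of i. With c + 2 departures left, Σ κ_e (t − 1_{e ∈ T}) c! = ((c + 2)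
t − t) c! = t (c + 1)!. With one departure left, only tree edges are admitted and the sum is t. -/
theorem sum_mul_vertexFactor {T : Finset G.Dart} {κ : G.Dart → ℕ} {i j : V} (hij : i ≠ j)
    (hpos : 0 < outFlow κ i) :
    ∑ e : G.Dart with e.fst = i ∧ 0 < κ e ∧ (e.fst ≠ j → outFlow κ i = 1 → e ∈ T),
      κ e * vertexFactor T (κ - Pi.single e 1) i = vertexFactor T κ i := by
  have hsub : ∀ e : G.Dart, e.fst = i → 0 < κ e →
      outFlow κ i = outFlow (κ - Pi.single e 1) i + 1 ∧
      treeFlow T κ i = treeFlow T (κ - Pi.single e 1) i + if e ∈ T then 1 else 0 := by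
    intro e he hp
    constructor
    · conv_lhs => rw [← sub_single_add_single hp]
      rw [outFlow_add_single, if_pos he]
    · conv_lhs => rw [← sub_single_add_single hp]
      rw [treeFlow_add_single]
      simp only [he, and_true]
  rcases Nat.lt_or_ge 1 (outFlow κ i) with h2 | h1
  · obtain ⟨c, hc⟩ : ∃ c, outFlow κ i = c + 2 := ⟨outFlow κ i - 2, by omega⟩
    have hS : (Finset.univ.filter fun e : G.Dart =>
        e.fst = i ∧ 0 < κ e ∧ (e.fst ≠ j → outFlow κ i = 1 → e ∈ T)) =
        ((Finset.univ.filter fun e : G.Dart => e.fst = i).filter fun e => 0 < κ e) := by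
      rw [Finset.filter_filter]
      refine Finset.filter_congr fun e _ => ?_
      constructor
      · exact fun h => ⟨h.1, h.2.1⟩
      · exact fun h => ⟨h.1, h.2, fun _ h1 => by omega⟩
    rw [hS]
    -- The term with 1_{e ∈ T} is kept on the left to avoid subtraction in ℕ.
    have hterm : ∀ e ∈ ((Finset.univ.filter fun e : G.Dart => e.fst = i).filter fun e => 0 < κ e),
        κ e * vertexFactor T (κ - Pi.single e 1) i + κ e * ((if e ∈ T then 1 else 0) * c.factorial)
          = κ e * (treeFlow T κ i * c.factorial) := by
      intro e he
      rw [Finset.mem_filter, Finset.mem_filter] at he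
      obtain ⟨ho, ht⟩ := hsub e he.1.2 he.2
      have ho' : outFlow (κ - Pi.single e 1) i = c + 1 := by omega
      rw [vertexFactor, ho', if_neg (by omega), ht, Nat.add_sub_cancel]
      ring
    have hsum := Finset.sum_congr rfl hterm
    rw [Finset.sum_add_distrib, sum_filter_pos_mul _ _ (fun e => (if e ∈ T then 1 else 0) * _),
      sum_filter_pos_mul _ _ (fun _ => treeFlow T κ i * _), ← Finset.sum_mul] at hsum
    have hT : ∑ e : G.Dart with e.fst = i, κ e * ((if e ∈ T then 1 else 0) * c.factorial) =
        treeFlow T κ i * c.factorial := by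
      rw [treeFlow, Finset.sum_mul, Finset.sum_filter, Finset.sum_filter, ← Finset.sum_subset
        (Finset.subset_univ T)]
      · exact Finset.sum_congr rfl fun e he => by simp [he]
      · intro e _ he
        simp [he]
    rw [hT] at hsum
    change _ + _ = outFlow κ i * _ at hsum
    rw [hc] at hsum
    rw [vertexFactor, hc, if_neg (by omega), show c + 2 - 1 = c + 1 by omega, Nat.factorial_succ]
    linarith
  · have h1 : outFlow κ i = 1 := by omega
    have hS : (Finset.univ.filter fun e : G.Dart =>
        e.fst = i ∧ 0 < κ e ∧ (e.fst ≠ j → outFlow κ i = 1 → e ∈ T)) =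
        ((T.filter fun e : G.Dart => e.fst = i).filter fun e => 0 < κ e) := by
      ext e
      simp only [Finset.mem_filter, Finset.mem_univ, true_and]
      constructor
      · rintro ⟨h, h', h''⟩
        exact ⟨⟨h'' (h ▸ hij) h1, h⟩, h'⟩
      · rintro ⟨⟨h, h'⟩, h''⟩
        exact ⟨h', h'', fun _ _ => h⟩
    rw [hS, vertexFactor, if_neg hpos.ne', h1, Nat.sub_self, Nat.factorial_zero, treeFlow,
      Finset.sum_mul]
    refine (Finset.sum_congr rfl fun e he => ?_).trans (sum_filter_pos_mul _ κ fun _ => 1)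
    rw [Finset.mem_filter, Finset.mem_filter] at he
    have := (hsub e he.1.2 he.2).1
    rw [vertexFactor, if_pos (by omega)]

theorem prod_factorial_eq_mul {κ : G.Dart → ℕ} {e : G.Dart} (h : 0 < κ e) :
    ∏ f, (κ f).factorial = κ e * ∏ f, ((κ - Pi.single e 1 : G.Dart → ℕ) f).factorial := by
  have h1 : (κ - Pi.single e 1 : G.Dart → ℕ) e = κ e - 1 := by simp
  have h2 : ∀ f ≠ e, (κ - Pi.single e 1 : G.Dart → ℕ) f = κ f := fun f hf => by simp [hf]
  generalize (κ - Pi.single e 1 : G.Dart → ℕ) = κ' at h1 h2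
  rw [← Finset.mul_prod_erase _ (fun f => (κ f).factorial) (Finset.mem_univ e),
    ← Finset.mul_prod_erase _ (fun f => (κ' f).factorial) (Finset.mem_univ e), ← mul_assoc, h1,
    Nat.mul_factorial_pred h.ne']
  congr 1
  exact Finset.prod_congr rfl fun f hf => by rw [h2 f (Finset.ne_of_mem_erase hf)]

/-- Such a flow circulates away from j and cannot be exhausted by a walk starting in j. If all
factors were nonzero, every vertex with outflow would send flow along its tree edge. Going back from
j along T, Kirchhoff's rule would then make every outflow vanish. -/
theorem exists_vertexFactor_eq_zero {T : Finset G.Dart} {j : V} (hT : IsTreeTowards j T)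
    {κ : G.Dart → ℕ} (hκ : Kirchhoff κ j j) (h0 : outFlow κ j = 0) {v : V} (hv : 0 < outFlow κ v) :
    ∃ v ∈ Finset.univ.erase j, vertexFactor T κ v = 0 := by
  by_contra! hne
  have key : ∀ a, Relation.ReflTransGen (fun a b => ∃ e ∈ T, e.fst = a ∧ e.snd = b) a j →
      outFlow κ a = 0 := by
    intro a ha
    induction ha using Relation.ReflTransGen.head_induction_on with
    | refl => exact h0
    | head hab _ ih =>
      obtain ⟨e, he, rfl, rfl⟩ := hab
      by_contra hpos
      have h1 := hne e.fst (Finset.mem_erase.2 ⟨hT.no_exit e he, Finset.mem_univ _⟩)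
      rw [vertexFactor, if_neg hpos] at h1
      have h2 : treeFlow T κ e.fst ≠ 0 := left_ne_zero_of_mul h1
      obtain ⟨f, hf, hf0⟩ := Finset.exists_ne_zero_of_sum_ne_zero h2
      rw [Finset.mem_filter] at hf
      rw [hT.eq_of_fst_eq hf.1 he hf.2] at hf0
      have h3 := hκ e.snd
      have h4 : κ e ≤ inFlow κ e.snd :=
        Finset.single_le_sum (f := κ) (fun _ _ => Nat.zero_le _) (by simp)
      omega
  exact hv.ne' (key v (hT.reach v))

/-- Induction on the first edge e. The factorials on the left release a factor κ e, and on the right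
only the factor of i changes. For i ≠ j the sum over e is `sum_mul_vertexFactor`; for i = j it turns
(outFlow κ i − 1)! into (outFlow κ i)!. -/
theorem card_walks_mul {T : Finset G.Dart} {j : V} (hT : IsTreeTowards j T) (n : ℕ) (i : V)
    (κ : G.Dart → ℕ) (hκ : Kirchhoff κ i j) (hn : ∑ e, κ e = n) :
    (walks T j n i κ).card * ∏ e, (κ e).factorial =
      (∏ v ∈ Finset.univ.erase j, vertexFactor T κ v) * (outFlow κ j).factorial := by
  induction n generalizing i κ with
  | zero =>
    have h0 : κ = 0 := by
      ext e
      exact (Finset.sum_eq_zero_iff.1 hn) e (Finset.mem_univ e)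
    subst h0
    have hij : i = j := by
      by_contra hij
      have := hκ i
      simp [outFlow, inFlow, hij] at this
    subst hij
    simp [walks, vertexFactor, outFlow]
  | succ n ih =>
    set S := Finset.univ.filter fun e : G.Dart =>
      e.fst = i ∧ 0 < κ e ∧ (e.fst ≠ j → outFlow κ i = 1 → e ∈ T) with hS
    have hcard : (walks T j (n + 1) i κ).card =
        ∑ e ∈ S, (walks T j n e.snd (κ - Pi.single e 1)).card := by
      rw [walks, Finset.card_biUnion]
      · refine Finset.sum_congr rfl fun e _ => Finset.card_image_of_injective _ ?_
        exact List.cons_injective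
      · intro e _ f _ hef
        rw [Function.onFun, Finset.disjoint_left]
        intro d hd hd'
        rw [Finset.mem_image] at hd hd'
        obtain ⟨d₁, -, rfl⟩ := hd
        obtain ⟨d₂, -, h⟩ := hd'
        exact hef (List.cons.inj h).1.symm
    have hstep : (walks T j (n + 1) i κ).card * ∏ e, (κ e).factorial =
        ∑ e ∈ S, κ e * ((∏ v ∈ Finset.univ.erase j, vertexFactor T (κ - Pi.single e 1) v) *
          (outFlow (κ - Pi.single e 1) j).factorial) := by
      rw [hcard, Finset.sum_mul]
      refine Finset.sum_congr rfl fun e he => ?_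
      rw [hS, Finset.mem_filter] at he
      obtain ⟨-, rfl, hp, -⟩ := he
      have hK : Kirchhoff (κ - Pi.single e 1) e.snd j := by
        rw [← kirchhoff_add_single, sub_single_add_single hp]
        exact hκ
      have hsum : ∑ f, (κ - Pi.single e 1 : G.Dart → ℕ) f = n := by
        have := hn
        rw [← sub_single_add_single hp] at this
        simp only [Pi.add_apply, Finset.sum_add_distrib, Finset.sum_pi_single',
          Finset.mem_univ, if_true] at this
        omega
      rw [← ih _ _ hK hsum, prod_factorial_eq_mul hp]
      ring
    rw [hstep]
    have hout : ∀ e ∈ S, ∀ v, v ≠ i → outFlow (κ - Pi.single e 1) v = outFlow κ v := by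
      intro e he v hv
      rw [hS, Finset.mem_filter] at he
      obtain ⟨-, rfl, hp, -⟩ := he
      conv_rhs => rw [← sub_single_add_single hp]
      rw [outFlow_add_single, if_neg hv.symm, add_zero]
    have hfac : ∀ e ∈ S, ∀ v, v ≠ i →
        vertexFactor T (κ - Pi.single e 1) v = vertexFactor T κ v := by
      intro e he v hv
      rw [hS, Finset.mem_filter] at he
      obtain ⟨-, rfl, hp, -⟩ := he
      exact vertexFactor_sub_single hp hv.symm
    by_cases hij : i = j
    · subst hij
      have hterm : ∀ e ∈ S, κ e * ((∏ v ∈ Finset.univ.erase i,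
          vertexFactor T (κ - Pi.single e 1) v) * (outFlow (κ - Pi.single e 1) i).factorial) =
          κ e * ((∏ v ∈ Finset.univ.erase i, vertexFactor T κ v) *
            (outFlow κ i - 1).factorial) := by
        intro e he
        rw [Finset.prod_congr rfl fun v hv => hfac e he v (Finset.ne_of_mem_erase hv)]
        rw [hS, Finset.mem_filter] at he
        obtain ⟨-, he1, hp, -⟩ := he
        have : outFlow κ i = outFlow (κ - Pi.single e 1) i + 1 := by
          conv_lhs => rw [← sub_single_add_single hp]
          rw [outFlow_add_single, if_pos he1]
        rw [this, Nat.add_sub_cancel]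
      rw [Finset.sum_congr rfl hterm]
      have hS' : S = (Finset.univ.filter fun e : G.Dart => e.fst = i).filter fun e => 0 < κ e := by
        rw [hS, Finset.filter_filter]
        refine Finset.filter_congr fun e _ => ?_
        exact ⟨fun h => ⟨h.1, h.2.1⟩, fun h => ⟨h.1, h.2, fun h' => absurd h.1 h'⟩⟩
      rw [hS', sum_filter_pos_mul _ _ fun _ => _, ← Finset.sum_mul]
      change outFlow κ i * _ = _
      -- If no edge leaves i although κ ≠ 0, there is no walk, and the right-hand side vanishes
      -- through the factor of another vertex.
      by_cases h0 : outFlow κ i = 0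
      · obtain ⟨e, -, he⟩ : ∃ e ∈ Finset.univ, κ e ≠ 0 :=
          Finset.exists_ne_zero_of_sum_ne_zero (by omega)
        obtain ⟨v, hv, hv0⟩ := exists_vertexFactor_eq_zero hT hκ h0
          (outFlow_pos_iff.2 ⟨e, rfl, Nat.pos_of_ne_zero he⟩)
        rw [Finset.prod_eq_zero hv hv0, h0]
        simp
      · rw [mul_left_comm, Nat.mul_factorial_pred h0]
    · have hpos : 0 < outFlow κ i := by
        have := hκ i
        rw [if_neg hij, if_pos rfl] at this
        omega
      have hi : i ∈ Finset.univ.erase j := Finset.mem_erase.2 ⟨hij, Finset.mem_univ i⟩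
      rw [← Finset.mul_prod_erase _ _ hi, ← sum_mul_vertexFactor hij hpos, Finset.sum_mul,
        Finset.sum_mul]
      refine Finset.sum_congr rfl fun e he => ?_
      rw [← Finset.mul_prod_erase _ _ hi, hout e he j (Ne.symm hij),
        Finset.prod_congr rfl fun v hv => hfac e he v (Finset.ne_of_mem_erase hv)]
      ring

/-- The walks from `i` to `j` with crossing numbers `κ` and last exit tree `T`. -/
def treeWalks (T : Finset G.Dart) (i j : V) (κ : G.Dart → ℕ) : Finset (List G.Dart) :=
  if ∀ e ∈ T, 0 < κ e then walks T j (∑ e, κ e) i κ else ∅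

theorem sum_crossCount (d : List G.Dart) : ∑ e, crossCount d e = d.length := by
  induction d with
  | nil => simp [crossCount_nil]
  | cons e d ih =>
    rw [crossCount_cons]
    simp only [Pi.add_apply, Finset.sum_add_distrib, Finset.sum_pi_single', ih]
    simp

/-- `walks` only forces last exits to lie in T. Positivity of κ on T ensures that every vertex other
than j is left, so its last exit exists and must be its unique T-edge. -/
theorem mem_treeWalks {T : Finset G.Dart} {i j : V} (hT : IsTreeTowards j T) {κ : G.Dart → ℕ}
    {d : List G.Dart} : d ∈ treeWalks T i j κ ↔ IsTrail i d j ∧ crossCount d = κ ∧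
      {e | e.fst ≠ j ∧ LastExit d e} = (T : Set G.Dart) := by
  unfold treeWalks
  constructor
  · split_ifs with hpos
    · intro hd
      obtain ⟨hl, ht, hc, hle⟩ := mem_walks.1 hd
      refine ⟨ht, hc, Set.Subset.antisymm (fun e he => hle e he.2 he.1) fun e he => ?_⟩
      have h1 := hpos e he
      rw [← hc, crossCount, List.count_pos_iff] at h1
      obtain ⟨f, hf, hfe⟩ := exists_lastExit ⟨e, h1, rfl⟩
      have hej := hT.no_exit e he
      rw [← hT.eq_of_fst_eq (hle f hf (hfe ▸ hej)) he hfe]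
      exact ⟨hfe ▸ hej, hf⟩
    · exact fun h => absurd h (Finset.notMem_empty _)
  · rintro ⟨ht, rfl, hle⟩
    rw [if_pos, mem_walks]
    · refine ⟨(sum_crossCount d).symm, ht, rfl, fun e he hej => ?_⟩
      have : e ∈ {e | e.fst ≠ j ∧ LastExit d e} := ⟨hej, he⟩
      rw [hle] at this
      exact this
    · intro e he
      have : e ∈ {e | e.fst ≠ j ∧ LastExit d e} := by rw [hle]; exact he
      rw [crossCount, List.count_pos_iff]
      exact this.2.mem

theorem outFlow_pos_of_forall_mem {T : Finset G.Dart} {j : V} (hT : IsTreeTowards j T)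
    {κ : G.Dart → ℕ} (hκ : ∀ e ∈ T, 0 < κ e) {v : V} (hv : v ≠ j) : 0 < outFlow κ v := by
  obtain ⟨e, ⟨he, rfl⟩, -⟩ := hT.exit v hv
  exact outFlow_pos_iff.2 ⟨e, rfl, hκ e he⟩

/-- The number of walks with given crossing numbers and given last exit tree. -/
theorem card_treeWalks_mul {T : Finset G.Dart} {i j : V} (hT : IsTreeTowards j T)
    {κ : G.Dart → ℕ} (hκ : Kirchhoff κ i j) :
    (treeWalks T i j κ).card * ∏ e, (κ e).factorial =
      (∏ e ∈ T, κ e) * ((∏ v ∈ Finset.univ.erase j, (outFlow κ v - 1).factorial) *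
        (outFlow κ j).factorial) := by
  unfold treeWalks
  split_ifs with hpos
  · rw [card_walks_mul hT _ i κ hκ rfl, ← mul_assoc]
    congr 1
    have h1 : ∀ v ∈ Finset.univ.erase j, vertexFactor T κ v =
        treeFlow T κ v * (outFlow κ v - 1).factorial := by
      intro v hv
      rw [vertexFactor, if_neg (outFlow_pos_of_forall_mem hT hpos (Finset.ne_of_mem_erase hv)).ne']
    rw [Finset.prod_congr rfl h1, Finset.prod_mul_distrib]
    congr 1
    symm
    -- Tails identify T with the vertices other than j, and the tree flow at v is κ on the single
    -- T-edge out of v.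
    refine Finset.prod_bij (fun e _ => e.fst) (fun e he => by simpa using hT.no_exit e he)
      (fun e he f hf h => hT.eq_of_fst_eq he hf h) (fun v hv => ?_) (fun e he => ?_)
    · obtain ⟨e, ⟨he, hev⟩, -⟩ := hT.exit v (Finset.ne_of_mem_erase hv)
      exact ⟨e, he, hev⟩
    · have : T.filter (fun f => f.fst = e.fst) = {e} := by
        ext f
        simp only [Finset.mem_filter, Finset.mem_singleton]
        exact ⟨fun h => hT.eq_of_fst_eq h.1 he h.2, fun h => by rw [h]; exact ⟨he, rfl⟩⟩
      rw [treeFlow, this, Finset.sum_singleton]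
  · push Not at hpos
    obtain ⟨e, he, h0⟩ := hpos
    rw [Finset.prod_eq_zero he (by omega)]
    simp

end Counting

/-! ### Product functions and densities under product measures -/

section ProductIntegrals

variable {ι : Type*} [Fintype ι] {X : ι → Type*} [∀ i, MeasurableSpace (X i)]

theorem lintegral_pi_prod (μ : ∀ i, Measure (X i)) [∀ i, SigmaFinite (μ i)]
    {f : ∀ i, X i → ℝ≥0∞} (hf : ∀ i, Measurable (f i)) :
    ∫⁻ x, ∏ i, f i (x i) ∂Measure.pi μ = ∏ i, ∫⁻ t, f i t ∂μ i := by
  classical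
  -- Iterated marginals need a base point; without one some factor is empty and both sides vanish.
  rcases isEmpty_or_nonempty (∀ i, X i) with h | ⟨⟨x₀⟩⟩
  · rw [lintegral_of_isEmpty]
    obtain ⟨i, hi⟩ := isEmpty_pi.1 h
    exact (Finset.prod_eq_zero (Finset.mem_univ i) (lintegral_of_isEmpty _ _)).symm
  · rw [lintegral_eq_lmarginal_univ x₀]
    have key : ∀ s : Finset ι, ∀ x, (∫⋯∫⁻_s, (fun x => ∏ i ∈ s, f i (x i)) ∂μ) x =
        ∏ i ∈ s, ∫⁻ t, f i t ∂μ i := by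
      intro s
      induction s using Finset.induction_on with
      | empty => simp
      | insert i s hi ih =>
        intro x
        have hm : Measurable fun x : ∀ i, X i => ∏ i ∈ insert i s, f i (x i) :=
          Finset.measurable_prod _ fun i _ => (hf i).comp (measurable_pi_apply i)
        rw [lmarginal_insert' _ hm hi, Finset.prod_insert hi, ← ih x]
        have h1 : ∀ x : ∀ i, X i, ∫⁻ t, ∏ k ∈ insert i s, f k (Function.update x i t k) ∂μ i =
            (∫⁻ t, f i t ∂μ i) * ∏ k ∈ s, f k (x k) := by
          intro x
          rw [← lintegral_mul_const _ (hf i)]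
          refine lintegral_congr fun t => ?_
          rw [Finset.prod_insert hi, Function.update_self]
          congr 1
          exact Finset.prod_congr rfl fun k hk => by
            rw [Function.update_of_ne (by rintro rfl; exact hi hk)]
        simp_rw [h1]
        unfold lmarginal
        rw [lintegral_const_mul]
        exact (Finset.measurable_prod _ fun k _ => (hf k).comp (measurable_pi_apply k)).comp
          measurable_updateFinset
    exact key _ _

theorem pi_withDensity (μ : ∀ i, Measure (X i)) [∀ i, SigmaFinite (μ i)]
    {f : ∀ i, X i → ℝ≥0∞} (hf : ∀ i, Measurable (f i))
    [∀ i, SigmaFinite ((μ i).withDensity (f i))] :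
    Measure.pi (fun i => (μ i).withDensity (f i)) =
      (Measure.pi μ).withDensity fun x => ∏ i, f i (x i) := by
  refine Measure.pi_eq fun s hs => ?_
  rw [withDensity_apply _ (MeasurableSet.univ_pi hs), ← lintegral_indicator (.univ_pi hs)]
  have : ∀ x : ∀ i, X i, (Set.univ.pi s).indicator (fun x => ∏ i, f i (x i)) x =
      ∏ i, (s i).indicator (f i) (x i) := by
    intro x
    by_cases hx : x ∈ Set.univ.pi s
    · rw [Set.indicator_of_mem hx]
      exact Finset.prod_congr rfl fun i _ => (Set.indicator_of_mem (hx i trivial) _).symm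
    · rw [Set.indicator_of_notMem hx]
      simp only [Set.mem_univ_pi, not_forall] at hx
      obtain ⟨i, hi⟩ := hx
      exact (Finset.prod_eq_zero (Finset.mem_univ i) (Set.indicator_of_notMem hi _)).symm
  simp_rw [this]
  rw [lintegral_pi_prod μ fun i => (hf i).indicator (hs i)]
  exact Finset.prod_congr rfl fun i _ => by
    rw [lintegral_indicator (hs i), withDensity_apply _ (hs i)]

end ProductIntegrals

/-! ### Convolution powers of Lebesgue measure on the half-line -/

section Erlang

/-- The `n`-fold convolution power of Lebesgue measure on `(0, ∞)`. -/
def erlang : ℕ → Measure ℝ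
  | 0 => Measure.dirac 0
  | n + 1 => (volume : Measure ℝ).withDensity
      ((Set.Ioi 0).indicator fun s => ENNReal.ofReal (s ^ n / n.factorial))

theorem measurable_erlangDensity (n : ℕ) : Measurable
    ((Set.Ioi (0 : ℝ)).indicator fun s => ENNReal.ofReal (s ^ n / n.factorial)) :=
  Measurable.indicator (by fun_prop) measurableSet_Ioi

instance (n : ℕ) : SigmaFinite (erlang n) := by
  cases n with
  | zero => unfold erlang; infer_instance
  | succ n =>
    refine SigmaFinite.withDensity_of_ne_top (Eventually.of_forall fun s => ?_)
    by_cases h : s ∈ Set.Ioi (0 : ℝ) <;> simp [h]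

theorem lintegral_erlang_succ (n : ℕ) (f : ℝ → ℝ≥0∞) (hf : Measurable f) :
    ∫⁻ s, f s ∂erlang (n + 1) =
      ∫⁻ s in Set.Ioi 0, ENNReal.ofReal (s ^ n / n.factorial) * f s := by
  rw [erlang, lintegral_withDensity_eq_lintegral_mul _ (measurable_erlangDensity n) hf,
    ← lintegral_indicator measurableSet_Ioi]
  refine lintegral_congr fun s => ?_
  by_cases h : s ∈ Set.Ioi (0 : ℝ) <;> simp [h]

theorem lintegral_pow_div_factorial (n : ℕ) {u : ℝ} (hu : 0 < u) :
    ∫⁻ s in Set.Ioo 0 u, ENNReal.ofReal (s ^ n / n.factorial) =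
      ENNReal.ofReal (u ^ (n + 1) / (n + 1).factorial) := by
  rw [Measure.restrict_congr_set (Ioo_ae_eq_Ioc (μ := volume)), ← ofReal_integral_eq_lintegral_ofReal]
  · rw [← intervalIntegral.integral_of_le hu.le, intervalIntegral.integral_div, integral_pow]
    congr 1
    rw [Nat.factorial_succ]
    push_cast
    field_simp
    simp
  · exact (Continuous.intervalIntegrable (by fun_prop) 0 u).1
  · filter_upwards [self_mem_ae_restrict measurableSet_Ioc] with s hs
    have := hs.1.le
    simp only [Pi.zero_apply]
    positivity

/-- Substitute u = t + s for fixed t and exchange the integrals; the inner integral of t^n / n! over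
(0, u) is u^(n+1) / (n+1)!. -/
theorem lintegral_erlang_add (n : ℕ) {f : ℝ → ℝ≥0∞} (hf : Measurable f) :
    ∫⁻ s in Set.Ioi 0, ∫⁻ t, f (t + s) ∂erlang n = ∫⁻ t, f t ∂erlang (n + 1) := by
  rw [lintegral_erlang_succ n f hf]
  cases n with
  | zero =>
    refine setLIntegral_congr_fun measurableSet_Ioi fun s _ => ?_
    simp [erlang, lintegral_dirac' (0 : ℝ) (f := fun t => f (t + s)) (by fun_prop)]
  | succ n =>
    have h1 : ∀ s, ∫⁻ t, f (t + s) ∂erlang (n + 1) =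
        ∫⁻ t in Set.Ioi 0, ENNReal.ofReal (t ^ n / n.factorial) * f (t + s) :=
      fun s => lintegral_erlang_succ n _ (by fun_prop)
    simp_rw [h1]
    rw [lintegral_lintegral_swap (by fun_prop)]
    have h2 : ∀ t ∈ Set.Ioi (0 : ℝ),
        ∫⁻ s in Set.Ioi 0, ENNReal.ofReal (t ^ n / n.factorial) * f (t + s) =
        ∫⁻ u in Set.Ioi 0, (if t < u then ENNReal.ofReal (t ^ n / n.factorial) * f u else 0) := by
      intro t ht
      rw [← lintegral_indicator measurableSet_Ioi, ← lintegral_indicator measurableSet_Ioi,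
        ← lintegral_add_left_eq_self (fun u => (Set.Ioi (0 : ℝ)).indicator (fun u =>
          if t < u then ENNReal.ofReal (t ^ n / n.factorial) * f u else 0) u) t]
      refine lintegral_congr fun s => ?_
      have ht' : (0 : ℝ) < t := ht
      by_cases hs : 0 < s
      · simp [hs, show 0 < t + s by linarith]
      · rw [Set.indicator_of_notMem (show s ∉ Set.Ioi 0 from hs)]
        by_cases h : t + s ∈ Set.Ioi (0 : ℝ) <;> simp [h, hs]
    rw [setLIntegral_congr_fun measurableSet_Ioi h2, lintegral_lintegral_swap]
    · refine setLIntegral_congr_fun measurableSet_Ioi fun u hu => ?_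
      change ∫⁻ t in Set.Ioi 0, (if t < u then ENNReal.ofReal (t ^ n / n.factorial) * f u else 0) =
        ENNReal.ofReal (u ^ (n + 1) / (n + 1).factorial) * f u
      rw [← lintegral_pow_div_factorial n hu, ← lintegral_mul_const _ (by fun_prop),
        ← Set.Ioi_inter_Iio, Set.inter_comm, ← Measure.restrict_restrict measurableSet_Iio,
        ← lintegral_indicator measurableSet_Iio]
      rfl
    · refine Measurable.aemeasurable (Measurable.ite ?_ (by fun_prop) measurable_const)
      exact measurableSet_lt measurable_fst measurable_snd

/-- Source of the factor l_j^n / n! at the endpoint of a walk: n completed holds in j must leave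
room for the unfinished one. -/
theorem erlang_Iic (n : ℕ) {u : ℝ} (hu : 0 ≤ u) :
    erlang n (Set.Iic u) = ENNReal.ofReal (u ^ n / n.factorial) := by
  cases n with
  | zero => simp [erlang, hu]
  | succ n =>
    rcases hu.eq_or_lt with rfl | hu
    · rw [erlang, withDensity_apply _ measurableSet_Iic,
        setLIntegral_congr_fun (g := fun _ => 0) measurableSet_Iic fun s hs => by
          simpa using fun h : 0 < s => absurd h (not_lt.2 hs)]
      simp
    · rw [erlang, withDensity_apply _ measurableSet_Iic, ← lintegral_pow_div_factorial n hu,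
        lintegral_indicator measurableSet_Ioi, Measure.restrict_restrict measurableSet_Ioi,
        Set.Ioi_inter_Iic, Measure.restrict_congr_set (Ioo_ae_eq_Ioc (μ := volume))]

end Erlang

/-! ### Law of the local times under Lebesgue measure on holding times -/

section Occupation

variable {V : Type*} [Fintype V] [DecidableEq V]

/-- The image of Lebesgue measure on holding times in `(0, ∞)` under the map to local times, where
the vertex `v` is held `c v` times. -/
def occupation (c : V → ℕ) : Measure (V → ℝ) := Measure.pi fun v => erlang (c v)

instance (c : V → ℕ) : SigmaFinite (occupation c) := by
  unfold occupation; infer_instance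

theorem occupation_zero : occupation (0 : V → ℕ) = Measure.dirac 0 := by
  refine Measure.pi_eq fun s hs => ?_
  rw [Measure.dirac_apply' _ (MeasurableSet.univ_pi hs)]
  simp only [erlang]
  by_cases h : (0 : V → ℝ) ∈ Set.univ.pi s
  · rw [Set.indicator_of_mem h]
    refine (Finset.prod_eq_one fun v _ => ?_).symm
    rw [Measure.dirac_apply' _ (hs v)]
    exact Set.indicator_of_mem (h v trivial) _
  · rw [Set.indicator_of_notMem h]
    simp only [Set.mem_univ_pi, not_forall] at h
    obtain ⟨v, hv⟩ := h
    refine (Finset.prod_eq_zero (Finset.mem_univ v) ?_).symm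
    rw [Measure.dirac_apply' _ (hs v)]
    exact Set.indicator_of_notMem hv _

theorem measurable_add_single (v : V) :
    Measurable fun p : (V → ℝ) × ℝ => p.1 + Pi.single v p.2 := by
  refine measurable_pi_iff.2 fun w => ?_
  simp only [Pi.add_apply, Pi.single_apply]
  split_ifs <;> fun_prop

/-- One more hold in v changes the coordinate v alone, so only that factor is convolved, by
`lintegral_erlang_add`. -/
theorem occupation_add_single (c : V → ℕ) (v : V) :
    occupation (c + Pi.single v 1) =
      ((occupation c).prod (volume.restrict (Set.Ioi 0))).map fun p => p.1 + Pi.single v p.2 := by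
  refine Measure.pi_eq fun A hA => ?_
  rw [Measure.map_apply (measurable_add_single v) (MeasurableSet.univ_pi hA),
    Measure.prod_apply_symm (measurable_add_single v (MeasurableSet.univ_pi hA))]
  have h1 : ∀ s : ℝ, (fun l : V → ℝ => (l, s)) ⁻¹'
      ((fun p : (V → ℝ) × ℝ => p.1 + Pi.single v p.2) ⁻¹' Set.univ.pi A) =
      Set.univ.pi fun w => (fun t => t + (Pi.single v s : V → ℝ) w) ⁻¹' A w := by
    intro s
    ext l
    simp
  simp_rw [h1, occupation, Measure.pi_pi]
  have h2 : ∀ s : ℝ, ∏ w, erlang (c w) ((fun t => t + (Pi.single v s : V → ℝ) w) ⁻¹' A w) =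
      (∫⁻ t, (A v).indicator 1 (t + s) ∂erlang (c v)) *
        ∏ w ∈ Finset.univ.erase v, erlang (c w) (A w) := by
    intro s
    rw [← Finset.mul_prod_erase _ _ (Finset.mem_univ v)]
    congr 1
    · rw [Pi.single_eq_same, ← lintegral_indicator_one ((measurable_add_const s) (hA v))]
      rfl
    · refine Finset.prod_congr rfl fun w hw => ?_
      rw [Pi.single_eq_of_ne (Finset.ne_of_mem_erase hw)]
      simp
  simp_rw [h2]
  have hm : Measurable ((A v).indicator (1 : ℝ → ℝ≥0∞)) := measurable_one.indicator (hA v)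
  rw [lintegral_mul_const, lintegral_erlang_add _ hm, lintegral_indicator_one (hA v),
    ← Finset.mul_prod_erase _ _ (Finset.mem_univ v)]
  · congr 1
    · simp
    · exact Finset.prod_congr rfl fun w hw => by simp [Finset.ne_of_mem_erase hw]
  · exact Measurable.lintegral_prod_right (f := fun s t : ℝ => (A v).indicator 1 (t + s))
      (hm.comp (measurable_snd.add measurable_fst))

theorem lintegral_occupation_add_single (c : V → ℕ) (v : V) {g : (V → ℝ) → ℝ≥0∞}
    (hg : Measurable g) :
    ∫⁻ l, g l ∂occupation (c + Pi.single v 1) =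
      ∫⁻ l, (∫⁻ s in Set.Ioi (0 : ℝ), g (l + Pi.single v s)) ∂occupation c := by
  rw [occupation_add_single, lintegral_map hg (measurable_add_single v)]
  exact lintegral_prod _ (hg.comp (measurable_add_single v)).aemeasurable

end Occupation

/-! ### Lebesgue measure on the hyperplane of local times with fixed total -/

section Hyperplanes

variable {V : Type*} [Fintype V] [DecidableEq V]

theorem measurable_hyperplanePoint (i : V) (σ : ℝ) : Measurable (hyperplanePoint i σ) := by
  refine measurable_pi_iff.2 fun v => ?_
  unfold hyperplanePoint
  split_ifs <;> fun_prop

/-- The linear part of the reflection that exchanges the coordinate `j` with the dependent one. -/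
def coordReflection {ι : Type*} [Fintype ι] [DecidableEq ι] (j : ι) : (ι → ℝ) →ₗ[ℝ] (ι → ℝ) where
  toFun x := Function.update x j (-∑ i, x i)
  map_add' x y := by
    ext i
    by_cases h : i = j
    · subst h; simp [Finset.sum_add_distrib]; ring
    · simp [h]
  map_smul' c x := by
    ext i
    by_cases h : i = j
    · subst h; simp [Finset.mul_sum]
    · simp [h]

theorem coordReflection_comp_self {ι : Type*} [Fintype ι] [DecidableEq ι] (j : ι) :
    coordReflection j * coordReflection j = 1 := by
  ext x : 1
  ext i
  simp only [coordReflection, Module.End.mul_apply, LinearMap.coe_mk, AddHom.coe_mk,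
    Module.End.one_apply, Function.update_idem, LinearMap.comp_apply]
  by_cases h : i = j
  · subst h
    rw [Function.update_self, Finset.sum_update_of_mem (Finset.mem_univ i),
      ← Finset.add_sum_erase _ _ (Finset.mem_univ i), Finset.sdiff_singleton_eq_erase]
    ring
  · simp [h]

/-- The linear part is an involution, so its determinant is ±1; the rest is a translation. -/
theorem measurePreserving_update_sub_sum {ι : Type*} [Fintype ι] [DecidableEq ι] (j : ι) (σ : ℝ) :
    MeasurePreserving (fun x : ι → ℝ => Function.update x j (σ - ∑ i, x i)) := by
  have hdet : LinearMap.det (coordReflection j) * LinearMap.det (coordReflection j) = 1 := by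
    rw [← map_mul, coordReflection_comp_self, map_one]
  have habs : |(LinearMap.det (coordReflection j))⁻¹| = 1 := by
    rw [abs_inv]
    rcases mul_self_eq_one_iff.1 hdet with h | h <;> simp [h]
  have hlin : MeasurePreserving (coordReflection j) := by
    refine ⟨(coordReflection j).continuous_of_finiteDimensional.measurable, ?_⟩
    rw [Real.map_linearMap_volume_pi_eq_smul_volume_pi (left_ne_zero_of_mul_eq_one hdet), habs]
    simp
  have hadd := measurePreserving_add_right (volume : Measure (ι → ℝ)) (Pi.single j σ)
  have heq : (fun x : ι → ℝ => Function.update x j (σ - ∑ i, x i)) =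
      (fun x => x + Pi.single j σ) ∘ coordReflection j := by
    ext x i
    by_cases h : i = j
    · subst h; simp [coordReflection]; ring
    · simp [coordReflection, h]
  rw [heq]
  exact hadd.comp hlin

/-- The exchange of `i` and `j` as a map of the complement of `i` onto the complement of `j`. -/
def complSwap (i j : V) : {v : V // v ≠ i} ≃ {v : V // v ≠ j} :=
  (Equiv.swap i j).subtypeEquiv fun v => by
    rw [not_iff_not, Equiv.swap_apply_eq_iff, Equiv.swap_apply_right]

/-- The theorem omits the coordinate of i₀, while the local times of a walk are naturally
parametrized without its endpoint; this passes from one to the other. Up to renaming coordinates the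
change is the reflection of `measurePreserving_update_sub_sum`. -/
theorem hyperplaneMeasure_eq (i j : V) (σ : ℝ) : hyperplaneMeasure i σ = hyperplaneMeasure j σ := by
  rcases eq_or_ne i j with rfl | hij
  · rfl
  have h1 := measurePreserving_update_sub_sum (⟨j, hij.symm⟩ : {v : V // v ≠ i}) σ
  have h2 : MeasurePreserving (fun (x : {v : V // v ≠ i} → ℝ) (v : {v : V // v ≠ j}) =>
      x ((complSwap i j).symm v)) := by
    have heq : (fun (x : {v : V // v ≠ i} → ℝ) (v : {v : V // v ≠ j}) =>
        x ((complSwap i j).symm v)) = MeasurableEquiv.piCongrLeft (fun _ => ℝ) (complSwap i j) := by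
      ext x v
      obtain ⟨w, rfl⟩ := (complSwap i j).surjective v
      rw [MeasurableEquiv.coe_piCongrLeft, Equiv.piCongrLeft_apply_apply, Equiv.symm_apply_apply]
    rw [heq]
    exact volume_measurePreserving_piCongrLeft (fun _ => ℝ) (complSwap i j)
  unfold hyperplaneMeasure
  rw [← h1.map_eq, ← h2.map_eq, Measure.map_map (measurable_hyperplanePoint _ _) h1.measurable,
    Measure.map_map (measurable_hyperplanePoint _ _) h2.measurable]
  congr 1
  ext x v
  have hsum : ∑ w : {v : V // v ≠ j}, x ((complSwap i j).symm w) = ∑ w, x w :=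
    (complSwap i j).symm.sum_comp x
  simp only [Function.comp_apply, hyperplanePoint]
  by_cases hvi : v = i
  · subst hvi
    have : (complSwap v j).symm ⟨v, hij⟩ = ⟨j, hij.symm⟩ := by
      rw [Equiv.symm_apply_eq]; ext; simp [complSwap]
    rw [dif_neg (by simp), dif_pos hij, this, Finset.sum_update_of_mem (Finset.mem_univ _),
      ← Finset.add_sum_erase _ x (Finset.mem_univ ⟨j, hij.symm⟩),
      Finset.sdiff_singleton_eq_erase]
    ring
  · rw [dif_pos hvi]
    by_cases hvj : v = j
    · subst hvj
      rw [dif_neg (by simp), hsum, Function.update_self]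
    · have : (complSwap i j).symm ⟨v, hvj⟩ = ⟨v, hvi⟩ := by
        rw [Equiv.symm_apply_eq]
        ext
        simp [complSwap, Equiv.swap_apply_of_ne_of_ne hvi hvj]
      rw [dif_pos hvj, this, Function.update_of_ne (by simpa using hvj)]

theorem eq_hyperplanePoint {l : V → ℝ} {σ : ℝ} (h : ∑ v, l v = σ) (j : V) :
    l = hyperplanePoint j σ fun v => l v := by
  ext v
  unfold hyperplanePoint
  split_ifs with hv
  · rfl
  · push Not at hv
    subst hv
    rw [← h, ← Finset.add_sum_erase _ _ (Finset.mem_univ v),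
      Finset.sum_subtype (p := fun w => w ≠ v) (Finset.univ.erase v) (by simp)]
    ring

/-- The local times of a path with local times `l` that is completed in `j` up to time `σ`. -/
def fill (j : V) (σ : ℝ) (l : V → ℝ) : V → ℝ := l + Pi.single j (σ - ∑ v, l v)

theorem measurable_fill (j : V) (σ : ℝ) : Measurable (fill j σ) := by
  refine measurable_pi_iff.2 fun v => ?_
  simp only [fill, Pi.add_apply, Pi.single_apply]
  split_ifs <;> fun_prop

theorem sum_fill (j : V) (σ : ℝ) (l : V → ℝ) : ∑ v, fill j σ l v = σ := by
  simp [fill, Finset.sum_add_distrib]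

theorem fill_eq_hyperplanePoint (j : V) (σ : ℝ) (l : V → ℝ) :
    fill j σ l = hyperplanePoint j σ fun v => l v := by
  conv_lhs => rw [eq_hyperplanePoint (sum_fill j σ l) j]
  congr 1
  ext v
  simp [fill, Pi.single_eq_of_ne v.2]

/-- The density of the local times at time `σ` when `v` has been left `c v` times. -/
def occupationDensity (c : V → ℕ) (j : V) (l : V → ℝ) : ℝ :=
  (∏ v ∈ Finset.univ.erase j, l v ^ (c v - 1) / (c v - 1).factorial) *
    (l j ^ c j / (c j).factorial)

theorem measurable_occupationDensity (c : V → ℕ) (j : V) :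
    Measurable (occupationDensity c j) := by
  unfold occupationDensity
  fun_prop

/-- The filled local times depend only on the coordinates other than j. Since c v > 0 there, these
have Erlang densities. Integrating the constraint over the coordinate j yields the distribution
function `erlang_Iic` at the filled value of that coordinate. -/
theorem lintegral_occupation_fill {c : V → ℕ} {j : V} (hc : ∀ v, v ≠ j → 0 < c v) (i : V)
    (σ : ℝ) {g : (V → ℝ) → ℝ≥0∞} (hg : Measurable g) (hsupp : ∀ l, l ∉ simplex V σ → g l = 0) :
    ∫⁻ l, (if ∑ v, l v ≤ σ then g (fill j σ l) else 0) ∂occupation c =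
      ∫⁻ l, g l * ENNReal.ofReal (occupationDensity c j l) ∂hyperplaneMeasure i σ := by
  have hgm : Measurable fun l => g l * ENNReal.ofReal (occupationDensity c j l) :=
    hg.mul (measurable_occupationDensity c j).ennreal_ofReal
  rw [hyperplaneMeasure_eq i j, hyperplaneMeasure,
    lintegral_map hgm (measurable_hyperplanePoint j σ)]
  have hmp := measurePreserving_piEquivPiSubtypeProd (fun v => erlang (c v)) (fun v => v ≠ j)
  have hu : Unique {v : V // ¬ v ≠ j} :=
    ⟨⟨⟨j, by simp⟩⟩, fun v => Subtype.ext (not_not.1 v.2)⟩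
  have hdef : (default : {v : V // ¬ v ≠ j}).1 = j := not_not.1 (default : {v : V // ¬ v ≠ j}).2
  set F : ({v : V // v ≠ j} → ℝ) × ({v : V // ¬ v ≠ j} → ℝ) → ℝ≥0∞ := fun p =>
    if ∑ v, p.1 v + p.2 default ≤ σ then g (hyperplanePoint j σ p.1) else 0 with hF
  have hFm : Measurable F := by
    refine Measurable.ite (measurableSet_le (by fun_prop) measurable_const) ?_ measurable_const
    exact hg.comp ((measurable_hyperplanePoint j σ).comp measurable_fst)
  have h1 : ∀ l : V → ℝ, (if ∑ v, l v ≤ σ then g (fill j σ l) else 0) =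
      F (MeasurableEquiv.piEquivPiSubtypeProd (fun _ => ℝ) (fun v => v ≠ j) l) := by
    intro l
    rw [fill_eq_hyperplanePoint]
    simp only [hF, MeasurableEquiv.piEquivPiSubtypeProd, Equiv.piEquivPiSubtypeProd,
      MeasurableEquiv.coe_mk, Equiv.coe_fn_mk, hdef]
    rw [← Finset.add_sum_erase _ _ (Finset.mem_univ j),
      Finset.sum_subtype (p := fun v => v ≠ j) (Finset.univ.erase j) (by simp), add_comm]
  simp_rw [h1]
  rw [occupation, hmp.lintegral_comp hFm, lintegral_prod _ hFm.aemeasurable]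
  have h2 : ∀ y : {v : V // v ≠ j} → ℝ, ∫⁻ z, F (y, z) ∂Measure.pi
      (fun v : {v : V // ¬ v ≠ j} => erlang (c v)) =
      g (hyperplanePoint j σ y) *
        ENNReal.ofReal (hyperplanePoint j σ y j ^ c j / (c j).factorial) := by
    intro y
    have hm2 := measurePreserving_piUnique (fun v : {v : V // ¬ v ≠ j} => erlang (c v))
    have h3 : ∀ z : {v : V // ¬ v ≠ j} → ℝ, F (y, z) = (fun t : ℝ => g (hyperplanePoint j σ y) *
        (Set.Iic (hyperplanePoint j σ y j)).indicator 1 t) (MeasurableEquiv.piUnique _ z) := by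
      intro z
      have h4 : hyperplanePoint j σ y j = σ - ∑ v, y v := dif_neg (by simp)
      simp only [hF, MeasurableEquiv.piUnique_apply, Set.indicator_apply, Set.mem_Iic, h4,
        Pi.one_apply, mul_ite, mul_one, mul_zero]
      exact if_congr ⟨fun h => by linarith, fun h => by linarith⟩ rfl rfl
    simp_rw [h3]
    rw [hm2.lintegral_comp ((measurable_one.indicator measurableSet_Iic).const_mul _),
      lintegral_const_mul _ (measurable_one.indicator measurableSet_Iic),
      lintegral_indicator_one measurableSet_Iic, hdef]
    -- Off the simplex the filled value at j may be negative, where `erlang_Iic` does not apply;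
    -- there g vanishes.
    by_cases hs : hyperplanePoint j σ y ∈ simplex V σ
    · rw [erlang_Iic _ (hs.1 j).le]
    · rw [hsupp _ hs, zero_mul, zero_mul]
  simp_rw [h2]
  have hpi : Measure.pi (fun v : {v : V // v ≠ j} => erlang (c v)) =
      (volume : Measure ({v : V // v ≠ j} → ℝ)).withDensity fun y =>
        ∏ v, (Set.Ioi (0 : ℝ)).indicator
          (fun s => ENNReal.ofReal (s ^ (c v.1 - 1) / (c v.1 - 1).factorial)) (y v) := by
    have h5 : ∀ v : {v : V // v ≠ j}, erlang (c v) = (volume : Measure ℝ).withDensity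
        ((Set.Ioi (0 : ℝ)).indicator
          (fun s => ENNReal.ofReal (s ^ (c v.1 - 1) / (c v.1 - 1).factorial))) := by
      intro v
      obtain ⟨n, hn⟩ := Nat.exists_eq_succ_of_ne_zero (hc v.1 v.2).ne'
      rw [hn]
      rfl
    have h6 : ∀ v : {v : V // v ≠ j}, SigmaFinite ((volume : Measure ℝ).withDensity
        ((Set.Ioi (0 : ℝ)).indicator
          (fun s => ENNReal.ofReal (s ^ (c v.1 - 1) / (c v.1 - 1).factorial)))) := by
      intro v
      rw [← h5]
      infer_instance
    simp_rw [h5]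
    exact pi_withDensity (fun _ => volume) fun v => measurable_erlangDensity _
  have hdm : Measurable fun y : {v : V // v ≠ j} → ℝ => ∏ v, (Set.Ioi (0 : ℝ)).indicator
      (fun s => ENNReal.ofReal (s ^ (c v.1 - 1) / (c v.1 - 1).factorial)) (y v) :=
    Finset.measurable_prod _ fun v _ =>
      (measurable_erlangDensity _).comp (measurable_pi_apply v)
  rw [hpi, lintegral_withDensity_eq_lintegral_mul _ hdm]
  · refine lintegral_congr fun y => ?_
    rw [Pi.mul_apply]
    by_cases hs : hyperplanePoint j σ y ∈ simplex V σ
    · have hy : ∀ v, y v = hyperplanePoint j σ y v := fun v => by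
        rw [hyperplanePoint, dif_pos v.2]
      have h7 : ∏ v, (Set.Ioi (0 : ℝ)).indicator
          (fun s => ENNReal.ofReal (s ^ (c v.1 - 1) / (c v.1 - 1).factorial)) (y v) =
          ENNReal.ofReal (∏ v ∈ Finset.univ.erase j,
            hyperplanePoint j σ y v ^ (c v - 1) / (c v - 1).factorial) := by
        rw [Finset.prod_subtype (p := fun v => v ≠ j) (Finset.univ.erase j) (by simp),
          ENNReal.ofReal_prod_of_nonneg fun v _ => by
            have := (hs.1 v).le
            positivity]
        refine Finset.prod_congr rfl fun v _ => ?_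
        rw [hy v, Set.indicator_of_mem (Set.mem_Ioi.2 (hs.1 v))]
      rw [h7, occupationDensity, ENNReal.ofReal_mul]
      · ring
      · refine Finset.prod_nonneg fun v _ => ?_
        have := (hs.1 v).le
        positivity
    · rw [hsupp _ hs]
      simp
  · exact (hg.comp (measurable_hyperplanePoint j σ)).mul (Measurable.ennreal_ofReal
      (((measurable_pi_apply j).comp (measurable_hyperplanePoint j σ)).pow_const _ |>.div_const _))

end Hyperplanes

/-! ### The potential `expFactor` and its interplay with the holding time densities -/

section Energy

variable {V : Type*} [Fintype V] [DecidableEq V] {G : SimpleGraph V} [DecidableRel G.Adj]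

theorem two_mul_sum_edgeFinset (f : Sym2 V → ℝ) (hf : ∀ e, e ∉ G.edgeSet → f e = 0) :
    2 * ∑ e ∈ G.edgeFinset, f e = ∑ i, ∑ j, f s(i, j) := by
  have h1 : ∑ d : G.Dart, f d.edge = 2 * ∑ e ∈ G.edgeFinset, f e := by
    rw [← Finset.sum_fiberwise_of_maps_to (s := Finset.univ) (t := G.edgeFinset)
      (g := SimpleGraph.Dart.edge) (fun d _ => by simp), Finset.mul_sum]
    refine Finset.sum_congr rfl fun e he => ?_
    rw [Finset.sum_congr rfl (g := fun _ => f e) fun d hd => by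
      rw [(Finset.mem_filter.1 hd).2], Finset.sum_const,
      SimpleGraph.dart_edge_fiber_card G e (by simpa using he)]
    simp
  rw [← h1, ← Finset.sum_product', Finset.univ_product_univ]
  symm
  rw [← Finset.sum_subset (Finset.subset_univ ((Finset.univ : Finset G.Dart).image
    SimpleGraph.Dart.toProd)), Finset.sum_image]
  · rfl
  · exact fun d _ d' _ h => SimpleGraph.Dart.ext _ _ h
  · intro p _ hp
    refine hf _ fun h => hp ?_
    rw [Finset.mem_image]
    exact ⟨⟨p, h⟩, Finset.mem_univ _, rfl⟩

/-- The total jump rate out of `i` of the time-changed process, in terms of its local times. -/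
def exitRate (W : Sym2 V → ℝ) (i : V) (l : V → ℝ) : ℝ := ∑ j, W s(i, j) * √(1 + l j)

variable (G) in
-- The exponent is quadratic in a_v = √(1 + l_v), and W_ii = 0 makes it affine in a_i with slope
-- −`exitRate W i l`. The product omits i, so it does not change.
theorem expFactor_add_single (W : Sym2 V → ℝ) (hW : ∀ e, e ∉ G.edgeSet → W e = 0) (i : V)
    (l : V → ℝ) (s : ℝ) :
    expFactor G W i l * Real.exp (-(exitRate W i l * (√(1 + l i + s) - √(1 + l i)))) =
      expFactor G W i (l + Pi.single i s) := by
  unfold expFactor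
  have hprod : ∏ w ∈ Finset.univ.erase i, 1 / √(1 + (l + Pi.single i s : V → ℝ) w) =
      ∏ w ∈ Finset.univ.erase i, 1 / √(1 + l w) :=
    Finset.prod_congr rfl fun w hw => by simp [Finset.ne_of_mem_erase hw]
  rw [hprod, mul_right_comm, ← Real.exp_add]
  congr 2
  have hWii : W s(i, i) = 0 := hW _ (by simp)
  have hQ : ∀ m : V → ℝ, ∑ e ∈ G.edgeFinset, W e * (1 - (e.map fun i => √(1 + m i)).mul) =
      ∑ e ∈ G.edgeFinset, W e - (∑ a, ∑ b, W s(a, b) * (√(1 + m a) * √(1 + m b))) / 2 := by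
    intro m
    have := two_mul_sum_edgeFinset (G := G) (fun e => W e * (e.map fun i => √(1 + m i)).mul)
      (fun e he => by rw [hW e he, zero_mul])
    simp only [Sym2.map_mk, Sym2.mul_mk] at this
    rw [← this]
    simp only [mul_sub, mul_one, Finset.sum_sub_distrib]
    ring
  rw [hQ, hQ]
  set a : V → ℝ := fun v => √(1 + l v) with ha
  set δ := √(1 + l i + s) - √(1 + l i) with hδ
  have hupd : ∀ v, √(1 + (l + Pi.single i s : V → ℝ) v) = a v + if v = i then δ else 0 := by
    intro v
    by_cases hv : v = i
    · subst hv; simp [ha, hδ, add_assoc]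
    · simp [hv, ha]
  simp_rw [hupd]
  -- Expansion around a. The second-order term carries only W s(i, i) = 0, and the two first-order
  -- terms agree by symmetry, which absorbs the 1/2 from counting each edge twice.
  have h1 : ∀ v w, W s(v, w) * ((a v + if v = i then δ else 0) * (a w + if w = i then δ else 0)) =
      W s(v, w) * (a v * a w) + (if v = i then δ * (W s(v, w) * a w) else 0) +
      (if w = i then δ * (W s(w, v) * a v) else 0) +
      (if v = i then if w = i then δ ^ 2 * W s(v, w) else 0 else 0) := by
    intro v w
    rw [Sym2.eq_swap (a := w)]
    split_ifs <;> ring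
  simp_rw [h1, Finset.sum_add_distrib]
  simp only [Finset.sum_ite_irrel, Finset.sum_ite_eq', Finset.mem_univ, if_true,
    Finset.sum_const_zero, hWii, ← Finset.mul_sum]
  change _ = _ - (_ + δ * exitRate W i l + δ * exitRate W i l + _) / 2
  ring

/-- The density of the event that the time-changed process leaves `i`, where it is at local times
`l`, for `j` after a holding time `s`. -/
def holdDensity (W : Sym2 V → ℝ) (i j : V) (l : V → ℝ) (s : ℝ) : ℝ :=
  W s(i, j) * √(1 + l j) / (2 * √(1 + l i + s)) *
    Real.exp (-(exitRate W i l * (√(1 + l i + s) - √(1 + l i))))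

variable (G) in
-- The exponential of `holdDensity` raises l_i by s inside `expFactor`. The prefactor
-- √(1+l_j)/√(1+l_i+s) then replaces the factor of j by that of i, so that the omitted vertex
-- follows the walker. This is the telescoping step of the whole computation.
theorem expFactor_mul_holdDensity (W : Sym2 V → ℝ) (hW : ∀ e, e ∉ G.edgeSet → W e = 0) (i j : V)
    {l : V → ℝ} (hl : ∀ v, 0 ≤ l v) {s : ℝ} (hs : 0 ≤ s) :
    expFactor G W i l * holdDensity W i j l s =
      W s(i, j) / 2 * expFactor G W j (l + Pi.single i s) := by
  rcases eq_or_ne i j with rfl | hij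
  · have : W s(i, i) = 0 := hW _ (by simp)
    simp [holdDensity, this]
  have h1 : expFactor G W i l * holdDensity W i j l s =
      W s(i, j) * √(1 + l j) / (2 * √(1 + l i + s)) * expFactor G W i (l + Pi.single i s) := by
    rw [← expFactor_add_single G W hW, holdDensity]
    ring
  rw [h1, expFactor, expFactor]
  have hi : i ∈ Finset.univ.erase j := by simp [hij]
  have hj : j ∈ Finset.univ.erase i := by simp [hij.symm]
  rw [← Finset.mul_prod_erase _ _ hi, ← Finset.mul_prod_erase _ _ hj, Finset.erase_right_comm]
  simp only [Pi.add_apply, Pi.single_eq_same, Pi.single_eq_of_ne hij.symm, add_zero]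
  have h2 : √(1 + l j) ≠ 0 := (Real.sqrt_pos.2 (by linarith [hl j])).ne'
  have h3 : √(1 + l i + s) ≠ 0 := (Real.sqrt_pos.2 (by linarith [hl i])).ne'
  rw [← add_assoc]
  field_simp

variable (G) in
theorem expFactor_zero (W : Sym2 V → ℝ) (i : V) : expFactor G W i 0 = 1 := by
  have : ∀ e : Sym2 V, (e.map fun _ => (1 : ℝ)).mul = 1 := fun e => by
    induction e with | _ a b => simp
  simp [expFactor, this]

variable (G) in
theorem expFactor_nonneg (W : Sym2 V → ℝ) (i : V) (l : V → ℝ) : 0 ≤ expFactor G W i l := by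
  unfold expFactor
  positivity

variable (G) in
theorem measurable_expFactor (W : Sym2 V → ℝ) (i : V) : Measurable (expFactor G W i) := by
  unfold expFactor
  have : ∀ e : Sym2 V, Measurable fun l : V → ℝ => (e.map fun i => √(1 + l i)).mul := fun e => by
    induction e with | _ a b => simp only [Sym2.map_mk, Sym2.mul_mk]; fun_prop
  refine Measurable.mul (Real.measurable_exp.comp (Finset.measurable_sum _ fun e _ => ?_))
    (Finset.measurable_prod _ fun v _ => ?_)
  · exact ((this e).const_sub 1).const_mul _
  · exact (((measurable_pi_apply v).const_add 1).sqrt).const_div 1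

end Energy

/-! ### Local times and holding times in the original clock and in the clock D -/

section LocalTimes

variable {V : Type*} [Fintype V] [DecidableEq V]

/-- The time spent in each vertex when the vertices `x 0, x 1, …` are held for the times
`θ 0, …, θ (n - 1)`. -/
def localSum (x : ℕ → V) (θ : ℕ → ℝ) (n : ℕ) : V → ℝ :=
  ∑ m ∈ Finset.range n, Pi.single (x m) (θ m)

theorem localSum_succ (x : ℕ → V) (θ : ℕ → ℝ) (n : ℕ) :
    localSum x θ (n + 1) = localSum x θ n + Pi.single (x n) (θ n) :=
  Finset.sum_range_succ _ _

theorem sum_localSum (x : ℕ → V) (θ : ℕ → ℝ) (n : ℕ) :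
    ∑ v, localSum x θ n v = ∑ m ∈ Finset.range n, θ m := by
  induction n with
  | zero => simp [localSum]
  | succ n ih => simp [localSum_succ, Finset.sum_add_distrib, ih, Finset.sum_range_succ]

theorem localSum_nonneg {x : ℕ → V} {θ : ℕ → ℝ} {n : ℕ} (h : ∀ m < n, 0 ≤ θ m) (v : V) :
    0 ≤ localSum x θ n v := by
  rw [localSum, Finset.sum_apply]
  refine Finset.sum_nonneg fun m hm => ?_
  rw [Pi.single_apply]
  split_ifs
  · exact h m (Finset.mem_range.1 hm)
  · rfl

/-- The local times of the time-changed process after the holding times `r 0, …, r (n - 1)` of the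
original one. -/
def clockLocal (x : ℕ → V) (r : ℕ → ℝ) (n : ℕ) : V → ℝ := fun v => (1 + localSum x r n v) ^ 2 - 1

/-- The holding time of the time-changed process that corresponds to the holding time `s` of the
original one, started at local times `l` of the time-changed process. -/
def clockHold (a : ℝ) (s : ℝ) : ℝ := (√(1 + a) + s) ^ 2 - (1 + a)

theorem clockLocal_zero (x : ℕ → V) (r : ℕ → ℝ) : clockLocal x r 0 = 0 := by
  ext v
  simp [clockLocal, localSum]

/-- Inverts l = L² − 1; this turns the rates W_ij L_j into W_ij √(1 + l_j). -/
theorem sqrt_one_add_clockLocal {x : ℕ → V} {r : ℕ → ℝ} {n : ℕ} (h : ∀ m < n, 0 ≤ r m) (v : V) :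
    √(1 + clockLocal x r n v) = 1 + localSum x r n v := by
  have := localSum_nonneg (x := x) h v
  rw [clockLocal, add_sub_cancel, Real.sqrt_sq (by linarith)]

theorem clockLocal_nonneg {x : ℕ → V} {r : ℕ → ℝ} {n : ℕ} (h : ∀ m < n, 0 ≤ r m) (v : V) :
    0 ≤ clockLocal x r n v := by
  have := localSum_nonneg (x := x) h v
  rw [clockLocal]
  nlinarith

/-- The duration s is left free because the formula also serves for an unfinished last hold. -/
theorem clockLocal_add_single {x : ℕ → V} {r : ℕ → ℝ} {n : ℕ} (h : ∀ m < n, 0 ≤ r m) (s : ℝ) :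
    (fun v => (1 + (localSum x r n + Pi.single (x n) s : V → ℝ) v) ^ 2 - 1) =
      clockLocal x r n + Pi.single (x n) (clockHold (clockLocal x r n (x n)) s) := by
  ext v
  simp only [Pi.add_apply]
  rcases eq_or_ne v (x n) with hv | hv
  · rw [hv, Pi.single_eq_same, Pi.single_eq_same, clockHold, sqrt_one_add_clockLocal h]
    simp only [clockLocal]
    ring
  · rw [Pi.single_eq_of_ne hv, Pi.single_eq_of_ne hv]
    simp [clockLocal]

theorem clockLocal_succ {x : ℕ → V} {r : ℕ → ℝ} {n : ℕ} (h : ∀ m < n, 0 ≤ r m) :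
    clockLocal x r (n + 1) =
      clockLocal x r n + Pi.single (x n) (clockHold (clockLocal x r n (x n)) (r n)) := by
  rw [← clockLocal_add_single h, ← localSum_succ]
  rfl

/-- The `n`-th jump time of the time-changed process. -/
def clockTime (x : ℕ → V) (r : ℕ → ℝ) (n : ℕ) : ℝ := ∑ v, clockLocal x r n v

theorem clockTime_succ {x : ℕ → V} {r : ℕ → ℝ} {n : ℕ} (h : ∀ m < n, 0 ≤ r m) :
    clockTime x r (n + 1) = clockTime x r n + clockHold (clockLocal x r n (x n)) (r n) := by
  simp [clockTime, clockLocal_succ h, Finset.sum_add_distrib]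

theorem localSum_clockTime {x : ℕ → V} {r : ℕ → ℝ} {n : ℕ} (h : ∀ m < n, 0 ≤ r m) :
    localSum x (fun m => clockTime x r (m + 1) - clockTime x r m) n = clockLocal x r n := by
  induction n with
  | zero => rw [clockLocal_zero]; rfl
  | succ n ih =>
    have h' : ∀ m < n, 0 ≤ r m := fun m hm => h m (hm.trans n.lt_succ_self)
    rw [localSum_succ, ih h', clockLocal_succ h', clockTime_succ h', add_sub_cancel_left]

/-- Inverse of `clockHold a`. -/
def realHold (a : ℝ) (s : ℝ) : ℝ := √(1 + a + s) - √(1 + a)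

theorem clockHold_realHold {a s : ℝ} (ha : 0 ≤ a) (hs : 0 ≤ s) : clockHold a (realHold a s) = s := by
  rw [clockHold, realHold, add_sub_cancel, Real.sq_sqrt (by linarith)]
  ring

theorem realHold_clockHold {a s : ℝ} (ha : 0 ≤ a) (hs : 0 ≤ s) : realHold a (clockHold a s) = s := by
  rw [clockHold, realHold, add_sub_cancel, Real.sqrt_sq (by positivity)]
  ring

theorem realHold_nonneg {a s : ℝ} (hs : 0 ≤ s) : 0 ≤ realHold a s :=
  sub_nonneg.2 (Real.sqrt_le_sqrt (by linarith))

theorem clockHold_nonneg {a s : ℝ} (ha : 0 ≤ a) (hs : 0 ≤ s) : 0 ≤ clockHold a s := by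
  have h1 := Real.sq_sqrt (show 0 ≤ 1 + a by linarith)
  have h2 := Real.sqrt_nonneg (1 + a)
  rw [clockHold]
  nlinarith [mul_nonneg h2 hs]

end LocalTimes

/-! ### Deterministic step paths and their time change -/

section StepPaths

variable {V : Type*} [Fintype V] [DecidableEq V]

/-- Up to time `t` the path `z` has `n` jumps, at the times `u 1 < ⋯ < u n`, and visits the
vertices `x 0, …, x n`. -/
structure IsStepPath (z : ℝ → V) (x : ℕ → V) (u : ℕ → ℝ) (n : ℕ) (t : ℝ) : Prop where
  zero : u 0 = 0
  lt : ∀ m < n, u m < u (m + 1)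
  le : u n ≤ t
  eq : ∀ m < n, ∀ s, u m ≤ s → s < u (m + 1) → z s = x m
  eq_last : ∀ s, u n ≤ s → s ≤ t → z s = x n

variable {z : ℝ → V} {x : ℕ → V} {u : ℕ → ℝ} {n : ℕ} {t : ℝ}

theorem IsStepPath.u_le (h : IsStepPath z x u n t) {m m' : ℕ} (hm : m ≤ m') (hm' : m' ≤ n) :
    u m ≤ u m' := by
  induction m', hm using Nat.le_induction with
  | base => rfl
  | succ k _ ih => exact (ih (by omega)).trans (h.lt k (by omega)).le

theorem IsStepPath.u_lt (h : IsStepPath z x u n t) {m m' : ℕ} (hm : m < m') (hm' : m' ≤ n) :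
    u m < u m' :=
  (h.lt m (by omega)).trans_le (h.u_le hm hm')

theorem IsStepPath.u_nonneg (h : IsStepPath z x u n t) {m : ℕ} (hm : m ≤ n) : 0 ≤ u m :=
  h.zero ▸ h.u_le (Nat.zero_le m) hm

theorem IsStepPath.exists_index (h : IsStepPath z x u n t) {s : ℝ} (h0 : 0 ≤ s) (hs : s ≤ t) :
    ∃ m ≤ n, u m ≤ s ∧ (m < n → s < u (m + 1)) ∧ z s = x m := by
  classical
  set m := Nat.findGreatest (fun m => u m ≤ s) n with hm
  have hle : m ≤ n := Nat.findGreatest_le n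
  have hum : u m ≤ s :=
    Nat.findGreatest_spec (P := fun m => u m ≤ s) (Nat.zero_le n) (by rw [h.zero]; exact h0)
  have hlt : m < n → s < u (m + 1) := fun hmn =>
    not_le.1 (Nat.findGreatest_is_greatest (P := fun m => u m ≤ s) (Nat.lt_succ_self _) hmn)
  refine ⟨m, hle, hum, hlt, ?_⟩
  rcases hle.lt_or_eq with h' | h'
  · exact h.eq m h' s hum (hlt h')
  · rw [h'] at hum ⊢
    exact h.eq_last s hum hs

theorem IsStepPath.restrict (h : IsStepPath z x u n t) {N : ℕ} {s : ℝ} (hN : N ≤ n)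
    (hs : u N ≤ s) (hst : s ≤ t) (hlt : N < n → s < u (N + 1)) : IsStepPath z x u N s where
  zero := h.zero
  lt m hm := h.lt m (hm.trans_le hN)
  le := hs
  eq m hm := h.eq m (hm.trans_le hN)
  eq_last r h1 h2 := by
    rcases hN.lt_or_eq with h' | rfl
    · exact h.eq N h' r h1 (h2.trans_lt (hlt h'))
    · exact h.eq_last r h1 (h2.trans hst)

theorem intervalIntegral_step {z : ℝ → V} {a b : ℝ} (hab : a ≤ b) {v : V}
    (h : ∀ s, a ≤ s → s < b → z s = v) (i : V) :
    IntervalIntegrable (fun s => if z s = i then (1 : ℝ) else 0) volume a b ∧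
      ∫ s in a..b, (if z s = i then (1 : ℝ) else 0) = (Pi.single v (b - a) : V → ℝ) i := by
  have hae : (fun s => if z s = i then (1 : ℝ) else 0) =ᵐ[volume.restrict (Set.uIoc a b)]
      fun _ => if v = i then (1 : ℝ) else 0 := by
    rw [Set.uIoc_of_le hab, ← Measure.restrict_congr_set (Ioo_ae_eq_Ioc (μ := volume))]
    filter_upwards [self_mem_ae_restrict measurableSet_Ioo] with s hs
    rw [h s hs.1.le hs.2]
  have hc : IntervalIntegrable (fun _ => if v = i then (1 : ℝ) else 0) volume a b :=
    intervalIntegrable_const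
  refine ⟨hc.congr_ae hae.symm, ?_⟩
  rw [intervalIntegral.integral_congr_ae_restrict hae, intervalIntegral.integral_const,
    Pi.single_apply]
  simp only [eq_comm (a := i), smul_eq_mul, mul_ite, mul_one, mul_zero]

/-- Only weak monotonicity of the jump times is assumed, so that the lemma is available before
holding times are known to be positive. -/
theorem timeSpent_of_steps (h0 : u 0 = 0) (hle : ∀ m < n, u m ≤ u (m + 1))
    (hz : ∀ m < n, ∀ s, u m ≤ s → s < u (m + 1) → z s = x m) (i : V) {m : ℕ} (hm : m ≤ n) :
    IntervalIntegrable (fun s => if z s = i then (1 : ℝ) else 0) volume 0 (u m) ∧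
      timeSpent z i (u m) = localSum x (fun m => u (m + 1) - u m) m i := by
  induction m with
  | zero => rw [h0]; simp [timeSpent, localSum]
  | succ m ih =>
    obtain ⟨h1, h2⟩ := ih (by omega)
    obtain ⟨h3, h4⟩ := intervalIntegral_step (hle m hm) (hz m hm) i
    refine ⟨h1.trans h3, ?_⟩
    rw [localSum_succ, Pi.add_apply, ← h2, ← h4, timeSpent, timeSpent,
      intervalIntegral.integral_add_adjacent_intervals h1 h3]

theorem IsStepPath.timeSpent_u (h : IsStepPath z x u n t) (i : V) {m : ℕ} (hm : m ≤ n) :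
    IntervalIntegrable (fun s => if z s = i then (1 : ℝ) else 0) volume 0 (u m) ∧
      timeSpent z i (u m) = localSum x (fun m => u (m + 1) - u m) m i :=
  timeSpent_of_steps h.zero (fun m hm => (h.lt m hm).le) h.eq i hm

theorem IsStepPath.timeSpent_eq (h : IsStepPath z x u n t) (i : V) :
    IntervalIntegrable (fun s => if z s = i then (1 : ℝ) else 0) volume 0 t ∧
      timeSpent z i t =
        (localSum x (fun m => u (m + 1) - u m) n + Pi.single (x n) (t - u n) : V → ℝ) i := by
  obtain ⟨h1, h2⟩ := h.timeSpent_u i le_rfl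
  obtain ⟨h3, h4⟩ := intervalIntegral_step h.le (fun s hs hs' => h.eq_last s hs hs'.le) i
  refine ⟨h1.trans h3, ?_⟩
  rw [Pi.add_apply, ← h2, ← h4, timeSpent, timeSpent,
    intervalIntegral.integral_add_adjacent_intervals h1 h3]

theorem IsStepPath.timeSpent_eq_fill (h : IsStepPath z x u n t) :
    (fun i => timeSpent z i t) = fill (x n) t (localSum x (fun m => u (m + 1) - u m) n) := by
  ext i
  rw [(h.timeSpent_eq i).2, fill, sum_localSum, Finset.sum_range_sub, h.zero, sub_zero]

theorem timeSpent_sub {a b : ℝ} {i : V}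
    (h : IntervalIntegrable (fun s => if z s = i then (1 : ℝ) else 0) volume 0 t)
    (ha : 0 ≤ a) (hab : a ≤ b) (hb : b ≤ t) :
    IntervalIntegrable (fun s => if z s = i then (1 : ℝ) else 0) volume a b ∧
    timeSpent z i b - timeSpent z i a = ∫ s in a..b, if z s = i then (1 : ℝ) else 0 := by
  have hsub : ∀ c d, 0 ≤ c → c ≤ d → d ≤ t →
      IntervalIntegrable (fun s => if z s = i then (1 : ℝ) else 0) volume c d := by
    intro c d hc hcd hd
    refine h.mono_set ?_
    rw [Set.uIcc_of_le hcd, Set.uIcc_of_le (by linarith)]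
    exact Set.Icc_subset_Icc hc hd
  refine ⟨hsub a b ha hab hb, ?_⟩
  rw [timeSpent, timeSpent, intervalIntegral.integral_interval_sub_left
    (hsub 0 b le_rfl (ha.trans hab) hb) (hsub 0 a le_rfl ha (hab.trans hb))]

/-- L_i(b)² − L_i(a)² = (L_i(b) − L_i(a))(L_i(b) + L_i(a)) ≥ L_i(b) − L_i(a) because L_i ≥ 1, and
the increments of the L_i add up to b − a. This gives strict monotonicity of the clock and shows
that it reaches every level. -/
theorem IsStepPath.sub_le_clock_sub (h : IsStepPath z x u n t) {a b : ℝ} (ha : 0 ≤ a)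
    (hab : a ≤ b) (hb : b ≤ t) : b - a ≤ clock z b - clock z a := by
  have hi := fun i => (h.timeSpent_eq i).1
  have hmono : ∀ {c d : ℝ}, 0 ≤ c → c ≤ d → d ≤ t → ∀ i, timeSpent z i c ≤ timeSpent z i d := by
    intro c d hc hcd hd i
    rw [← sub_nonneg, (timeSpent_sub (hi i) hc hcd hd).2]
    exact intervalIntegral.integral_nonneg hcd fun s _ => by split_ifs <;> norm_num
  have hzero : ∀ i, timeSpent z i 0 = 0 := fun i => by simp [timeSpent]
  have hsum : ∑ i, (timeSpent z i b - timeSpent z i a) = b - a := by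
    simp_rw [fun i => (timeSpent_sub (hi i) ha hab hb).2]
    rw [← intervalIntegral.integral_finsetSum fun i _ => (timeSpent_sub (hi i) ha hab hb).1]
    simp
  rw [clock, clock, ← Finset.sum_sub_distrib]
  refine hsum ▸ Finset.sum_le_sum fun i _ => ?_
  have h1 := hmono ha hab hb i
  have h2 := hmono le_rfl ha (hab.trans hb) i
  rw [hzero] at h2
  rw [offsetLocalTime, offsetLocalTime]
  nlinarith

theorem IsStepPath.clock_strictMonoOn (h : IsStepPath z x u n t) :
    StrictMonoOn (clock z) (Set.Icc 0 t) := fun a ha b hb hab => by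
  have := h.sub_le_clock_sub ha.1 hab.le hb.2
  linarith

theorem IsStepPath.clock_continuousOn (h : IsStepPath z x u n t) :
    ContinuousOn (clock z) (Set.Icc 0 t) := by
  have ht : 0 ≤ t := (h.u_nonneg le_rfl).trans h.le
  have : ∀ i, ContinuousOn (fun s => timeSpent z i s) (Set.Icc 0 t) := by
    intro i
    have := intervalIntegral.continuousOn_primitive_interval' (h.timeSpent_eq i).1
      (Set.left_mem_uIcc)
    rwa [Set.uIcc_of_le ht] at this
  unfold clock offsetLocalTime
  fun_prop

theorem IsStepPath.timeChange_clock (h : IsStepPath z x u n t) {s : ℝ} (hs : s ∈ Set.Icc 0 t) :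
    timeChange z (clock z s) = z s := by
  have : IsLeast {r : ℝ | 0 ≤ r ∧ clock z s ≤ clock z r} s := by
    refine ⟨⟨hs.1, le_rfl⟩, fun r hr => ?_⟩
    by_contra hlt
    push Not at hlt
    exact absurd (h.clock_strictMonoOn ⟨hr.1, hlt.le.trans hs.2⟩ hs hlt) (not_lt.2 hr.2)
  rw [timeChange, clockInv, this.csInf_eq]

/-- The clock is continuous and strictly increasing on [0, t], so every clock time below `clock z t`
is attained, within the image of the right holding interval. -/
theorem IsStepPath.timeChange (h : IsStepPath z x u n t) :
    IsStepPath (timeChange z) x (fun m => clock z (u m)) n (clock z t) := by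
  have ht : 0 ≤ t := (h.u_nonneg le_rfl).trans h.le
  have hmem : ∀ m ≤ n, u m ∈ Set.Icc 0 t := fun m hm =>
    ⟨h.u_nonneg hm, (h.u_le hm le_rfl).trans h.le⟩
  have hsurj : ∀ a b w, 0 ≤ a → a ≤ b → b ≤ t → clock z a ≤ w → w ≤ clock z b →
      ∃ s, a ≤ s ∧ s ≤ b ∧ clock z s = w := by
    intro a b w ha hab hb h1 h2
    obtain ⟨s, hs, rfl⟩ := intermediate_value_Icc hab
      (h.clock_continuousOn.mono (Set.Icc_subset_Icc ha hb)) ⟨h1, h2⟩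
    exact ⟨s, hs.1, hs.2, rfl⟩
  refine ⟨?_, fun m hm => ?_, ?_, fun m hm w h1 h2 => ?_, fun w h1 h2 => ?_⟩
  · simp [h.zero, clock, offsetLocalTime, timeSpent]
  · exact h.clock_strictMonoOn (hmem m hm.le) (hmem (m + 1) hm) (h.lt m hm)
  · exact h.clock_strictMonoOn.monotoneOn (hmem n le_rfl) ⟨ht, le_rfl⟩ h.le
  · obtain ⟨s, hs, hs', rfl⟩ := hsurj _ _ w (hmem m hm.le).1 (h.lt m hm).le (hmem (m + 1) hm).2
      h1 h2.le
    rw [h.timeChange_clock ⟨(hmem m hm.le).1.trans hs, hs'.trans (hmem (m + 1) hm).2⟩]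
    refine h.eq m hm s hs (lt_of_le_of_ne hs' ?_)
    rintro rfl
    exact lt_irrefl _ h2
  · obtain ⟨s, hs, hs', rfl⟩ := hsurj _ _ w (hmem n le_rfl).1 h.le le_rfl h1 h2
    rw [h.timeChange_clock ⟨(hmem n le_rfl).1.trans hs, hs'⟩]
    exact h.eq_last s hs hs'

theorem IsStepPath.clock_u (h : IsStepPath z x u n t) {r : ℕ → ℝ}
    (hr : ∀ m < n, r m = u (m + 1) - u m) {m : ℕ} (hm : m ≤ n) :
    clock z (u m) = clockTime x r m := by
  unfold clock clockTime clockLocal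
  refine Finset.sum_congr rfl fun v _ => ?_
  rw [offsetLocalTime, (h.timeSpent_u v hm).2]
  have : localSum x (fun m => u (m + 1) - u m) m = localSum x r m :=
    Finset.sum_congr rfl fun k hk => by rw [hr k (by have := Finset.mem_range.1 hk; omega)]
  rw [this]

theorem IsStepPath.clock_t (h : IsStepPath z x u n t) {r : ℕ → ℝ}
    (hr : ∀ m < n, r m = u (m + 1) - u m) :
    clock z t = clockTime x r n + clockHold (clockLocal x r n (x n)) (t - u n) := by
  have h0 : ∀ m < n, 0 ≤ r m := fun m hm => by rw [hr m hm]; linarith [h.lt m hm]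
  have h1 : localSum x (fun m => u (m + 1) - u m) n = localSum x r n :=
    Finset.sum_congr rfl fun k hk => by rw [hr k (Finset.mem_range.1 hk)]
  have h2 : clock z t = ∑ v, (clockLocal x r n +
      Pi.single (x n) (clockHold (clockLocal x r n (x n)) (t - u n)) : V → ℝ) v := by
    rw [← clockLocal_add_single h0]
    unfold clock
    refine Finset.sum_congr rfl fun v _ => ?_
    rw [offsetLocalTime, (h.timeSpent_eq v).2, h1]
  rw [h2]
  simp [Finset.sum_add_distrib, clockTime]

end StepPaths

/-! ### Jumps, crossing numbers and last exits of step paths -/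

section Crossings

variable {V : Type*} [Fintype V] [DecidableEq V] {G : SimpleGraph V}
variable {z : ℝ → V} {x : ℕ → V} {u : ℕ → ℝ} {n : ℕ} {t : ℝ}

/-- At a time that is not one of the u (m + 1), the left limit equals the value, which i ≠ j
excludes. At u (m + 1) the left limit is x m. -/
theorem IsStepPath.jumpsAt_iff (h : IsStepPath z x u n t) {i j : V} (hij : i ≠ j) {s : ℝ}
    (hs : s ≤ t) : JumpsAt z i j s ↔ ∃ m < n, s = u (m + 1) ∧ x m = i ∧ x (m + 1) = j := by
  have hleft : ∀ (a b : ℝ) (v : V), a < b → (∀ r, a ≤ r → r < b → z r = v) →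
      ∀ᶠ r in 𝓝[<] b, z r = v := by
    intro a b v hab hz
    filter_upwards [Ioo_mem_nhdsLT hab] with r hr using hz r hr.1.le hr.2
  constructor
  · rintro ⟨h0, hl, hz⟩
    obtain ⟨m, hmn, hum, hlt, hzm⟩ := h.exists_index h0.le hs
    have hne : u m = s := by
      by_contra hne
      have hum' : u m < s := lt_of_le_of_ne hum hne
      have hl' := hleft (u m) s (x m) hum' fun r h1 h2 => by
        rcases hmn.lt_or_eq with hmn | rfl
        · exact h.eq m hmn r h1 (h2.trans (hlt hmn))
        · exact h.eq_last r h1 (h2.le.trans hs)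
      obtain ⟨r, hr1, hr2⟩ := (hl.and hl').exists
      exact hij (hr1.symm.trans (hr2.trans (hzm.symm.trans hz)))
    cases m with
    | zero => rw [h.zero] at hne; exact absurd hne h0.ne
    | succ m =>
      have hl' := hleft (u m) s (x m) (hne ▸ h.lt m hmn) fun r h1 h2 =>
        h.eq m hmn r h1 (hne ▸ h2)
      obtain ⟨r, hr1, hr2⟩ := (hl.and hl').exists
      exact ⟨m, hmn, hne.symm, hr2.symm.trans hr1, hzm.symm.trans hz⟩
  · rintro ⟨m, hm, rfl, rfl, rfl⟩
    refine ⟨(h.u_nonneg hm.le).trans_lt (h.lt m hm), hleft _ _ _ (h.lt m hm) (h.eq m hm), ?_⟩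
    rcases Nat.lt_or_ge (m + 1) n with h' | h'
    · exact h.eq (m + 1) h' _ le_rfl (h.lt _ h')
    · obtain rfl : m + 1 = n := by omega
      exact h.eq_last _ le_rfl hs

theorem card_filter_getElem_eq_count (d : List G.Dart) (e : G.Dart) :
    ((Finset.range d.length).filter fun m => d[m]? = some e).card = d.count e := by
  induction d using List.reverseRecOn with
  | nil => simp
  | append_singleton d f ih =>
    rw [List.length_append, List.length_singleton, Finset.range_add_one, Finset.filter_insert,
      List.count_append, ← ih]
    have h1 : (Finset.range d.length).filter (fun m => (d ++ [f])[m]? = some e) =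
        (Finset.range d.length).filter fun m => d[m]? = some e :=
      Finset.filter_congr fun m hm => by
        rw [List.getElem?_append_left (Finset.mem_range.1 hm)]
    rw [h1]
    have h2 : (d ++ [f])[d.length]? = some f := by simp
    rw [h2]
    by_cases hfe : f = e
    · subst hfe
      rw [if_pos rfl, Finset.card_insert_of_notMem (by simp)]
      simp
    · rw [if_neg (by simpa using hfe)]
      simp [hfe]

/-- The steps of the sequence `x` from `a` on are the directed edges in the list `d`. -/
def FollowsFrom (x : ℕ → V) (a : ℕ) (d : List G.Dart) : Prop :=
  ∀ m (hm : m < d.length), x (a + m) = d[m].fst ∧ x (a + m + 1) = d[m].snd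

theorem IsStepPath.crossings_eq (h : IsStepPath z x u n t) {d : List G.Dart} (hd : d.length = n)
    (hx : FollowsFrom x 0 d) (e : G.Dart) : crossings G z t e = crossCount d e := by
  have hset : {s : ℝ | s ≤ t ∧ JumpsAt z e.fst e.snd s} =
      (fun m => u (m + 1)) '' (((Finset.range d.length).filter fun m => d[m]? = some e : Finset ℕ) :
        Set ℕ) := by
    ext s
    simp only [Set.mem_ofPred_eq, Set.mem_image, Finset.coe_filter, Finset.mem_range]
    constructor
    · rintro ⟨hs, hj⟩
      obtain ⟨m, hm, rfl, h1, h2⟩ := (h.jumpsAt_iff e.adj.ne hs).1 hj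
      have hmd : m < d.length := hd ▸ hm
      have hxm := hx m hmd
      rw [zero_add] at hxm
      refine ⟨m, ⟨hmd, ?_⟩, rfl⟩
      rw [List.getElem?_eq_getElem hmd, Option.some_inj]
      exact SimpleGraph.Dart.ext _ _ (Prod.ext (hxm.1.symm.trans h1) (hxm.2.symm.trans h2))
    · rintro ⟨m, ⟨hmd, hde⟩, rfl⟩
      rw [List.getElem?_eq_getElem hmd, Option.some_inj] at hde
      have hxm := hx m hmd
      rw [zero_add, hde] at hxm
      have hle : u (m + 1) ≤ t := (h.u_le (show m + 1 ≤ n by omega) le_rfl).trans h.le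
      exact ⟨hle, (h.jumpsAt_iff e.adj.ne hle).2 ⟨m, hd ▸ hmd, rfl, hxm.1, hxm.2⟩⟩
  rw [crossings, hset, Set.InjOn.ncard_image, Set.ncard_coe_finset, card_filter_getElem_eq_count]
  · rfl
  · intro a ha b hb hab
    simp only [Finset.coe_filter, Finset.mem_range, Set.mem_ofPred_eq, hd] at ha hb
    rcases lt_trichotomy a b with hlt | heq | hlt
    · exact absurd hab (h.u_lt (show a + 1 < b + 1 by omega) hb.1).ne
    · exact heq
    · exact absurd hab.symm (h.u_lt (show b + 1 < a + 1 by omega) ha.1).ne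

/-- N is the number of jumps up to time a, so d lists exactly the jumps in (a, t]. A jump at u (m +
1) with no later visit to its tail is an entry of d whose tail is neither left again nor the
endpoint. -/
theorem IsStepPath.lastExitDarts_eq (h : IsStepPath z x u n t) {N : ℕ} {a : ℝ} (hN : N ≤ n)
    (ha : u N ≤ a) (hlt : N < n → a < u (N + 1)) {d : List G.Dart} (hd : N + d.length = n)
    (hx : FollowsFrom x N d) :
    lastExitDarts G z a t = {e | e.fst ≠ x n ∧ LastExit d e} := by
  have hz : ∀ m ≤ n, u m ≤ t ∧ z (u m) = x m := by
    intro m hm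
    rcases hm.lt_or_eq with hm | rfl
    · exact ⟨(h.u_le hm.le le_rfl).trans h.le, h.eq m hm _ le_rfl (h.lt m hm)⟩
    · exact ⟨h.le, h.eq_last _ le_rfl h.le⟩
  ext e
  simp only [lastExitDarts, Set.mem_ofPred_eq]
  rw [lastExit_iff_getElem]
  constructor
  · rintro ⟨s, has, hst, hj, hlast⟩
    obtain ⟨m, hm, rfl, h1, h2⟩ := (h.jumpsAt_iff e.adj.ne hst).1 hj
    have hNm : N ≤ m := by
      by_contra hlt'
      exact absurd (h.u_le (show m + 1 ≤ N by omega) hN) (not_le.2 (ha.trans_lt has))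
    have hne : ∀ r, m < r → r ≤ n → x r ≠ e.fst := fun r hr hrn => by
      rw [← (hz r hrn).2]
      exact hlast _ (h.u_le hr hrn) (hz r hrn).1
    refine ⟨(hne n hm le_rfl).symm, m - N, by omega, ?_, fun r hr hmr => ?_⟩
    · have hxm := hx (m - N) (by omega)
      rw [show N + (m - N) = m by omega] at hxm
      exact SimpleGraph.Dart.ext _ _ (Prod.ext (hxm.1.symm.trans h1) (hxm.2.symm.trans h2))
    · rw [← (hx r hr).1]
      exact hne _ (by omega) (by omega)
  · rintro ⟨hen, m, hm, hde, hlast⟩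
    have hxm := hx m hm
    rw [hde] at hxm
    have hne : ∀ r, N + m < r → r ≤ n → x r ≠ e.fst := by
      intro r hr hrn
      rcases hrn.lt_or_eq with hrn | rfl
      · have := hlast (r - N) (by omega) (by omega)
        rwa [← (hx (r - N) (by omega)).1, show N + (r - N) = r by omega] at this
      · exact hen.symm
    have hle : u (N + m + 1) ≤ t := (hz _ (by omega)).1
    refine ⟨u (N + m + 1), ?_, hle,
      (h.jumpsAt_iff e.adj.ne hle).2 ⟨N + m, by omega, rfl, hxm.1, hxm.2⟩, fun s hs hst => ?_⟩
    · exact (hlt (by omega)).trans_le (h.u_le (by omega) (by omega))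
    · obtain ⟨r, hrn, hur, hlt', hzr⟩ := h.exists_index
        ((h.u_nonneg (show N + m + 1 ≤ n by omega)).trans hs) hst
      rw [hzr]
      refine hne r ?_ hrn
      by_contra hr
      exact absurd (hs.trans_lt (hlt' (by omega)))
        (not_lt.2 (h.u_le (show r + 1 ≤ N + m + 1 by omega) (by omega)))

theorem IsTrail.followsFrom {i j : V} {d : List G.Dart} (h : IsTrail i d j) :
    FollowsFrom (vertexSeq i d) 0 d := fun m hm => by
  rw [zero_add, h.fst_getElem hm, vertexSeq_succ hm]
  exact ⟨rfl, rfl⟩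

theorem IsTrail.followsFrom_append {i j r : V} {d d' : List G.Dart} (h : IsTrail i d j)
    (h' : IsTrail j d' r) : FollowsFrom (vertexSeq i (d ++ d')) d.length d' := fun m hm => by
  rw [add_assoc, h.vertexSeq_append_right, h.vertexSeq_append_right, h'.fst_getElem hm,
    vertexSeq_succ hm]
  exact ⟨rfl, rfl⟩

theorem FollowsFrom.append_left {x : ℕ → V} {a : ℕ} {d d' : List G.Dart}
    (h : FollowsFrom x a (d ++ d')) : FollowsFrom x a d := fun m hm => by
  have := h m (by simp; omega)
  rwa [List.getElem_append_left hm] at this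

theorem crossCount_append (d d' : List G.Dart) (e : G.Dart) :
    crossCount (d ++ d') e = crossCount d e + crossCount d' e :=
  List.count_append

/-- The functionals of a path on `[0, t]` that follows `d` up to time `s` and `d'` afterwards. -/
structure PathData (G : SimpleGraph V) (z : ℝ → V) (s t : ℝ) (i j r : V) (d d' : List G.Dart) :
    Prop where
  left : z s = j
  right : z t = r
  cross_left : ∀ e, crossings G z s e = crossCount d e
  cross_right : ∀ e, crossings G z t e = crossCount d e + crossCount d' e
  exit_left : lastExitDarts G z 0 s = {e | e.fst ≠ j ∧ LastExit d e}
  exit_right : lastExitDarts G z s t = {e | e.fst ≠ r ∧ LastExit d' e}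

theorem IsStepPath.pathData {i j r : V} {d d' : List G.Dart} (hd : IsTrail i d j)
    (hd' : IsTrail j d' r) {s : ℝ}
    (h : IsStepPath z (vertexSeq i (d ++ d')) u (d.length + d'.length) t)
    (hs : u d.length ≤ s) (hst : s ≤ t) (hlt : 0 < d'.length → s < u (d.length + 1)) :
    PathData G z s t i j r d d' := by
  have hN : d.length ≤ d.length + d'.length := Nat.le_add_right _ _
  have hlt' : d.length < d.length + d'.length → s < u (d.length + 1) := fun h' => hlt (by omega)
  have hr := h.restrict hN hs hst hlt'
  have hxj : vertexSeq i (d ++ d') d.length = j := by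
    have := hd.vertexSeq_append_right (d' := d') 0
    rwa [add_zero, vertexSeq_zero] at this
  have hxr : vertexSeq i (d ++ d') (d.length + d'.length) = r := by
    rw [hd.vertexSeq_append_right, hd'.vertexSeq_length]
  have hf := (hd.append hd').followsFrom
  refine ⟨?_, ?_, hr.crossings_eq rfl hf.append_left, fun e => ?_, ?_, ?_⟩
  · rw [hr.eq_last s hs le_rfl, hxj]
  · rw [h.eq_last t h.le le_rfl, hxr]
  · rw [h.crossings_eq (by simp) hf, crossCount_append]
  · rw [hr.lastExitDarts_eq (Nat.zero_le _) h.zero.le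
      (fun h' => h.zero ▸ hr.u_lt Nat.zero_lt_one h') (zero_add _) hf.append_left, hxj]
  · rw [h.lastExitDarts_eq hN hs hlt' rfl (hd.followsFrom_append hd'), hxr]

end Crossings

/-! ### From holding times to the number of jumps before σ and σ + σ' -/

section Pieces

variable {V : Type*} [Fintype V] [DecidableEq V] {G : SimpleGraph V}

theorem clock_zero (z : ℝ → V) : clock z 0 = 0 := by
  simp [clock, offsetLocalTime, timeSpent]

theorem IsStepPath.congr {z : ℝ → V} {x x' : ℕ → V} {u u' : ℕ → ℝ} {n : ℕ} {t : ℝ}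
    (h : IsStepPath z x u n t) (hx : ∀ m ≤ n, x m = x' m) (hu : ∀ m ≤ n, u m = u' m) :
    IsStepPath z x' u' n t where
  zero := by rw [← hu 0 (Nat.zero_le _), h.zero]
  lt m hm := by rw [← hu m hm.le, ← hu (m + 1) hm]; exact h.lt m hm
  le := by rw [← hu n le_rfl]; exact h.le
  eq m hm := by rw [← hu m hm.le, ← hu (m + 1) hm, ← hx m hm.le]; exact h.eq m hm
  eq_last := by rw [← hu n le_rfl, ← hx n le_rfl]; exact h.eq_last

variable (G) in
/-- The properties that almost all paths of the process share: `y` is the path with vertices `X`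
and holding times `τ`, which are positive, and its jumps are along edges. -/
structure IsGood (y : ℝ → V) (X : ℕ → V) (τ : ℕ → ℝ≥0∞) : Prop where
  cover : ∀ t : ℝ, 0 ≤ t → ∃ n, ∑ m ∈ Finset.range n, τ m ≤ ENNReal.ofReal t ∧
    ENNReal.ofReal t < ∑ m ∈ Finset.range (n + 1), τ m ∧ y t = X n
  pos : ∀ n, ∑ m ∈ Finset.range n, τ m < ∞ → 0 < τ n
  adj : ∀ n, ∑ m ∈ Finset.range (n + 1), τ m < ∞ → G.Adj (X n) (X (n + 1))

variable {y : ℝ → V} {X : ℕ → V} {τ : ℕ → ℝ≥0∞}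

theorem sum_range_mono (τ : ℕ → ℝ≥0∞) {m n : ℕ} (h : m ≤ n) :
    ∑ k ∈ Finset.range m, τ k ≤ ∑ k ∈ Finset.range n, τ k :=
  Finset.sum_le_sum_of_subset (Finset.range_mono h)

theorem index_unique {τ : ℕ → ℝ≥0∞} {s : ℝ≥0∞} {m n : ℕ}
    (hm : ∑ k ∈ Finset.range m, τ k ≤ s) (hm' : s < ∑ k ∈ Finset.range (m + 1), τ k)
    (hn : ∑ k ∈ Finset.range n, τ k ≤ s) (hn' : s < ∑ k ∈ Finset.range (n + 1), τ k) : m = n := by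
  rcases lt_trichotomy m n with h | h | h
  · exact absurd (hm'.trans_le ((sum_range_mono τ h).trans hn)) (lt_irrefl _)
  · exact h
  · exact absurd (hn'.trans_le ((sum_range_mono τ h).trans hm)) (lt_irrefl _)

theorem toReal_sum_succ {τ : ℕ → ℝ≥0∞} {m : ℕ} (h : ∑ k ∈ Finset.range (m + 1), τ k < ∞) :
    (∑ k ∈ Finset.range (m + 1), τ k).toReal =
      (∑ k ∈ Finset.range m, τ k).toReal + (τ m).toReal := by
  rw [Finset.sum_range_succ] at h ⊢
  exact ENNReal.toReal_add (ENNReal.add_lt_top.1 h).1.ne (ENNReal.add_lt_top.1 h).2.ne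

theorem IsGood.isStepPath (h : IsGood G y X τ) {n : ℕ} {t : ℝ} (ht : 0 ≤ t)
    (hn : ∑ m ∈ Finset.range n, τ m ≤ ENNReal.ofReal t)
    (hn' : ENNReal.ofReal t < ∑ m ∈ Finset.range (n + 1), τ m) :
    IsStepPath y X (fun m => (∑ k ∈ Finset.range m, τ k).toReal) n t := by
  have hfin : ∀ m ≤ n, ∑ k ∈ Finset.range m, τ k < ∞ := fun m hm =>
    ((sum_range_mono τ hm).trans hn).trans_lt ENNReal.ofReal_lt_top
  have hval : ∀ s : ℝ, 0 ≤ s → ∀ m, ∑ k ∈ Finset.range m, τ k ≤ ENNReal.ofReal s →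
      ENNReal.ofReal s < ∑ k ∈ Finset.range (m + 1), τ k → y s = X m := by
    intro s hs m h1 h2
    obtain ⟨m', h1', h2', hy⟩ := h.cover s hs
    rw [hy, index_unique h1' h2' h1 h2]
  refine ⟨by simp, fun m hm => ?_, ?_, fun m hm s h1 h2 => ?_, fun s h1 h2 => ?_⟩
  · rw [toReal_sum_succ (hfin _ hm)]
    have := hfin _ hm
    rw [Finset.sum_range_succ] at this
    have := ENNReal.toReal_pos (h.pos m (hfin m hm.le)).ne' (ENNReal.add_lt_top.1 this).2.ne
    linarith
  · exact ENNReal.toReal_le_of_le_ofReal ht hn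
  · have hs : 0 ≤ s := ENNReal.toReal_nonneg.trans h1
    refine hval s hs m ?_ ?_
    · rwa [ENNReal.le_ofReal_iff_toReal_le (hfin m hm.le).ne hs]
    · rwa [ENNReal.ofReal_lt_iff_lt_toReal hs (hfin _ hm).ne]
  · have hs : 0 ≤ s := ENNReal.toReal_nonneg.trans h1
    refine hval s hs n ?_ ((ENNReal.ofReal_le_ofReal h2).trans_lt hn')
    rwa [ENNReal.le_ofReal_iff_toReal_le (hfin n le_rfl).ne hs]

theorem holdingTime_eq {τ : ℕ → ℝ≥0∞} {n : ℕ} (h : ∑ m ∈ Finset.range n, τ m < ∞) :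
    ∀ m < n, (τ m).toReal = (∑ k ∈ Finset.range (m + 1), τ k).toReal -
      (∑ k ∈ Finset.range m, τ k).toReal := fun m hm => by
  rw [toReal_sum_succ ((sum_range_mono τ hm).trans_lt h), add_sub_cancel_left]

/-- Positivity of the holding times is deliberately not assumed: it is a consequence of the law of
the jump chain, and this lemma is needed to put that law into explicit form. -/
theorem offsetLocalTime_of_cover (hcover : ∀ t : ℝ, 0 ≤ t → ∃ n,
      ∑ m ∈ Finset.range n, τ m ≤ ENNReal.ofReal t ∧
      ENNReal.ofReal t < ∑ m ∈ Finset.range (n + 1), τ m ∧ y t = X n) {n : ℕ}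
    (hn : ∑ m ∈ Finset.range n, τ m < ∞) (j : V) :
    offsetLocalTime y j (∑ m ∈ Finset.range n, τ m).toReal =
      1 + localSum X (fun m => (τ m).toReal) n j := by
  have hfin : ∀ m ≤ n, ∑ k ∈ Finset.range m, τ k < ∞ := fun m hm =>
    (sum_range_mono τ hm).trans_lt hn
  have hsum : localSum X (fun m => (∑ k ∈ Finset.range (m + 1), τ k).toReal -
      (∑ k ∈ Finset.range m, τ k).toReal) n = localSum X (fun m => (τ m).toReal) n :=
    Finset.sum_congr rfl fun m hm =>
      congrArg (Pi.single (X m)) (holdingTime_eq hn m (Finset.mem_range.1 hm)).symm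
  rw [offsetLocalTime, ← hsum]
  congr 1
  refine (timeSpent_of_steps (u := fun m => (∑ k ∈ Finset.range m, τ k).toReal) (x := X) (n := n)
    (by simp) (fun m hm => ?_) (fun m hm s h1 h2 => ?_) j le_rfl).2
  · exact ENNReal.toReal_mono (hfin _ hm).ne (sum_range_mono τ (Nat.le_succ m))
  · have hs : 0 ≤ s := ENNReal.toReal_nonneg.trans h1
    obtain ⟨m', h1', h2', hy⟩ := hcover s hs
    rw [hy, index_unique h1' h2' (m := m') (n := m)]
    · rwa [ENNReal.le_ofReal_iff_toReal_le (hfin m hm.le).ne hs]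
    · rwa [ENNReal.ofReal_lt_iff_lt_toReal hs (hfin _ hm).ne]

/-- The time-changed path with holding times `τ` along `x` has `N` jumps up to time `σ` and `n`
jumps up to time `σ + σ'`. -/
structure JumpCounts (x : ℕ → V) (τ : ℕ → ℝ≥0∞) (N n : ℕ) (σ σ' : ℝ) : Prop where
  fin : ∑ m ∈ Finset.range n, τ m < ∞
  le : N ≤ n
  le_left : clockTime x (fun m => (τ m).toReal) N ≤ σ
  lt_left : N < n → σ < clockTime x (fun m => (τ m).toReal) (N + 1)
  le_right : clockTime x (fun m => (τ m).toReal) n ≤ σ + σ'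
  -- The current hold may be infinite, so its survival is stated in the original time rather than
  -- through the next clock time, whose `toReal` would be a junk value.
  lt_right : ENNReal.ofReal (realHold (clockLocal x (fun m => (τ m).toReal) n (x n))
    (σ + σ' - clockTime x (fun m => (τ m).toReal) n)) < τ n

theorem localSum_congr {x x' : ℕ → V} (r : ℕ → ℝ) {n : ℕ} (h : ∀ m < n, x m = x' m) :
    localSum x r n = localSum x' r n :=
  Finset.sum_congr rfl fun m hm => by rw [h m (Finset.mem_range.1 hm)]

theorem clockLocal_congr {x x' : ℕ → V} (r : ℕ → ℝ) {n : ℕ} (h : ∀ m < n, x m = x' m) :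
    clockLocal x r n = clockLocal x' r n := by
  unfold clockLocal
  rw [localSum_congr r h]

theorem clockTime_congr {x x' : ℕ → V} (r : ℕ → ℝ) {n : ℕ} (h : ∀ m < n, x m = x' m) :
    clockTime x r n = clockTime x' r n := by
  unfold clockTime
  rw [clockLocal_congr r h]

theorem JumpCounts.congr {x x' : ℕ → V} {N n : ℕ} {σ σ' : ℝ} (h : JumpCounts x τ N n σ σ')
    (hx : ∀ m ≤ n, x m = x' m) : JumpCounts x' τ N n σ σ' where
  fin := h.fin
  le := h.le
  le_left := by
    rw [← clockTime_congr _ fun m hm => hx m (hm.le.trans h.le)]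
    exact h.le_left
  lt_left hN := by
    rw [← clockTime_congr _ fun m hm => hx m (by omega)]
    exact h.lt_left hN
  le_right := by
    rw [← clockTime_congr _ fun m hm => hx m hm.le]
    exact h.le_right
  lt_right := by
    rw [← clockTime_congr _ fun m hm => hx m hm.le, ← clockLocal_congr _ fun m hm => hx m hm.le,
      ← hx n le_rfl]
    exact h.lt_right

theorem clockTime_mono (x : ℕ → V) (τ : ℕ → ℝ≥0∞) :
    Monotone (clockTime x fun m => (τ m).toReal) := by
  refine monotone_nat_of_le_succ fun n => ?_
  rw [clockTime_succ fun m _ => ENNReal.toReal_nonneg]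
  have := clockHold_nonneg (clockLocal_nonneg (x := x) (n := n)
    (fun m _ => (ENNReal.toReal_nonneg : 0 ≤ (τ m).toReal)) (x n))
    (ENNReal.toReal_nonneg : 0 ≤ (τ n).toReal)
  linarith

theorem clockHold_strictMono {a s s' : ℝ} (ha : 0 ≤ a) (hs : 0 ≤ s) (h : s < s') :
    clockHold a s < clockHold a s' := by
  have h2 : 0 < √(1 + a) := Real.sqrt_pos.2 (by linarith)
  rw [clockHold, clockHold]
  nlinarith [mul_pos h2 (sub_pos.2 h)]

theorem JumpCounts.right_lt {x : ℕ → V} {N n : ℕ} {σ σ' : ℝ} (h : JumpCounts x τ N n σ σ')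
    (hfin : τ n < ∞) : σ + σ' < clockTime x (fun m => (τ m).toReal) (n + 1) := by
  have h0 : 0 ≤ σ + σ' - clockTime x (fun m => (τ m).toReal) n := sub_nonneg.2 h.le_right
  have hl := clockLocal_nonneg (x := x) (n := n)
    (fun m _ => (ENNReal.toReal_nonneg : 0 ≤ (τ m).toReal)) (x n)
  rw [clockTime_succ fun m _ => ENNReal.toReal_nonneg]
  have h1 := (ENNReal.ofReal_lt_iff_lt_toReal (realHold_nonneg h0) hfin.ne).1 h.lt_right
  have h2 := clockHold_strictMono hl (realHold_nonneg h0) h1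
  rw [clockHold_realHold hl h0] at h2
  linarith

/-- If n < n', the hold of index n is finite, so the clock time n + 1 exceeds σ + σ' by `right_lt`,
yet it is at most the clock time n' ≤ σ + σ'. The argument for N is the same with σ. -/
theorem JumpCounts.unique {x : ℕ → V} {N N' n n' : ℕ} {σ σ' : ℝ} (h : JumpCounts x τ N n σ σ')
    (h' : JumpCounts x τ N' n' σ σ') : N = N' ∧ n = n' := by
  have key : ∀ {N N' n n'}, JumpCounts x τ N n σ σ' → JumpCounts x τ N' n' σ σ' → ¬ n < n' := by
    intro N N' n n' h h' hlt
    have hfin : τ n < ∞ :=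
      (Finset.single_le_sum (fun _ _ => zero_le) (Finset.mem_range.2 hlt)).trans_lt h'.fin
    exact absurd ((h.right_lt hfin).trans_le ((clockTime_mono x τ hlt).trans h'.le_right))
      (lt_irrefl _)
  obtain rfl : n = n' := le_antisymm (not_lt.1 (key h' h)) (not_lt.1 (key h h'))
  have key' : ∀ {N N'}, JumpCounts x τ N n σ σ' → JumpCounts x τ N' n σ σ' → ¬ N < N' := by
    intro N N' h h' hlt
    exact absurd ((h.lt_left (hlt.trans_le h'.le)).trans_le
      ((clockTime_mono x τ hlt).trans h'.le_left)) (lt_irrefl _)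
  exact ⟨le_antisymm (not_lt.1 (key' h' h)) (not_lt.1 (key' h h')), rfl⟩

/-- The clock reaches σ + σ' at the original time S + s, where S is the n-th jump time and s is
`realHold` of the clock time still missing. The time change of the path on [0, S + s] is then the
required step path. -/
theorem IsGood.isStepPath_timeChange (h : IsGood G y X τ) {x : ℕ → V} {N n : ℕ} {σ σ' : ℝ}
    (hx : ∀ m ≤ n, X m = x m) (hc : JumpCounts x τ N n σ σ') :
    IsStepPath (timeChange y) x (clockTime x fun m => (τ m).toReal) n (σ + σ') := by
  have hc' := hc.congr fun m hm => (hx m hm).symm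
  set r : ℕ → ℝ := fun m => (τ m).toReal with hr
  set S := ∑ m ∈ Finset.range n, τ m with hS
  have h0 : 0 ≤ σ + σ' - clockTime X r n := sub_nonneg.2 hc'.le_right
  have hl := clockLocal_nonneg (x := X) (n := n)
    (fun m _ => (ENNReal.toReal_nonneg : 0 ≤ (τ m).toReal)) (X n)
  set s := realHold (clockLocal X r n (X n)) (σ + σ' - clockTime X r n) with hs
  have hs0 : 0 ≤ s := realHold_nonneg h0
  have hT : ENNReal.ofReal (S.toReal + s) = S + ENNReal.ofReal s := by
    rw [ENNReal.ofReal_add ENNReal.toReal_nonneg hs0, ENNReal.ofReal_toReal hc.fin.ne]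
  have hp := h.isStepPath (n := n) (t := S.toReal + s) (by positivity)
    (by rw [hT]; exact le_self_add)
    (by
      rw [hT, Finset.sum_range_succ]
      exact ENNReal.add_lt_add_left hc.fin.ne hc'.lt_right)
  have hz := hp.timeChange
  rw [hp.clock_t (holdingTime_eq hc.fin)] at hz
  change IsStepPath _ _ _ _ (clockTime X r n + clockHold (clockLocal X r n (X n))
    (S.toReal + s - S.toReal)) at hz
  rw [add_sub_cancel_left, hs, clockHold_realHold hl h0, add_sub_cancel] at hz
  refine hz.congr hx fun m hm => ?_
  rw [hp.clock_u (holdingTime_eq hc.fin) hm]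
  exact clockTime_congr _ fun k hk => hx k (hk.le.trans hm)

/-- The clock runs at least as fast as time, so it takes the value σ + σ' at some T ≤ σ + σ'. The
index n is that of the hold in progress at T, and N is found on the time-changed path. -/
theorem IsGood.exists_jumpCounts (h : IsGood G y X τ) {σ σ' : ℝ} (hσ : 0 ≤ σ) (hσ' : 0 ≤ σ') :
    ∃ N n, JumpCounts X τ N n σ σ' := by
  have hT0 : 0 ≤ σ + σ' := add_nonneg hσ hσ'
  obtain ⟨n₀, h1, h2, -⟩ := h.cover (σ + σ') hT0
  have hp₀ := h.isStepPath hT0 h1 h2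
  have hge := hp₀.sub_le_clock_sub le_rfl hT0 le_rfl
  rw [clock_zero, sub_zero, sub_zero] at hge
  obtain ⟨T, hT, hTc⟩ := intermediate_value_Icc hT0 hp₀.clock_continuousOn
    (show σ + σ' ∈ Set.Icc (clock y 0) (clock y (σ + σ')) from ⟨by rw [clock_zero]; exact hT0, hge⟩)
  obtain ⟨n, hn, hn', -⟩ := h.cover T hT.1
  have hp := h.isStepPath hT.1 hn hn'
  have hfin : ∑ m ∈ Finset.range n, τ m < ∞ := hn.trans_lt ENNReal.ofReal_lt_top
  have hz := hp.timeChange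
  have hct := hp.clock_t (holdingTime_eq hfin)
  rw [hTc] at hz hct
  obtain ⟨N, hN, hN1, hN2, -⟩ := hz.exists_index hσ (by linarith)
  have hl := clockLocal_nonneg (x := X) (n := n)
    (fun m _ => (ENNReal.toReal_nonneg : 0 ≤ (τ m).toReal)) (X n)
  have hle : 0 ≤ T - (∑ m ∈ Finset.range n, τ m).toReal := sub_nonneg.2 hp.le
  have hu := fun m hm => hp.clock_u (holdingTime_eq hfin) (m := m) hm
  refine ⟨N, n, hfin, hN, ?_, fun hNn => ?_, ?_, ?_⟩
  · rw [← hu N hN]; exact hN1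
  · rw [← hu (N + 1) hNn]; exact hN2 hNn
  · rw [← hu n le_rfl]; exact hz.le
  · rw [hct, add_sub_cancel_left, realHold_clockHold hl hle,
      ENNReal.ofReal_sub _ ENNReal.toReal_nonneg, ENNReal.ofReal_toReal hfin.ne]
    rw [Finset.sum_range_succ] at hn'
    exact ENNReal.sub_lt_of_lt_add hn (by rwa [add_comm])

end Pieces

/-! ### The law of the jump chain as densities of holding times -/

section Chain

variable {V : Type*} [Fintype V] [DecidableEq V] {Ω : Type*}

/-- The first `n` holding times. -/
def holds (τ : ℕ → Ω → ℝ≥0∞) (n : ℕ) (ω : Ω) : Fin n → ℝ≥0∞ := fun m => τ m ω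

/-- The local times of the time-changed process after `N` of the holding times `h`. -/
def localUpTo (x : ℕ → V) (N : ℕ) {n : ℕ} (h : Fin n → ℝ≥0∞) : V → ℝ :=
  clockLocal x (fun m => if hm : m < n then (h ⟨m, hm⟩).toReal else 0) N

theorem localUpTo_holds (x : ℕ → V) (τ : ℕ → Ω → ℝ≥0∞) {N n : ℕ} (hN : N ≤ n) (ω : Ω) :
    localUpTo x N (holds τ n ω) = clockLocal x (fun m => (τ m ω).toReal) N := by
  have : localSum x (fun m => if hm : m < n then (holds τ n ω ⟨m, hm⟩).toReal else 0) N =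
      localSum x (fun m => (τ m ω).toReal) N :=
    Finset.sum_congr rfl fun m hm =>
      congrArg (Pi.single (x m)) (dif_pos ((Finset.mem_range.1 hm).trans_le hN))
  unfold localUpTo clockLocal
  rw [this]

theorem measurable_localUpTo (x : ℕ → V) (N n : ℕ) :
    Measurable (localUpTo x N : (Fin n → ℝ≥0∞) → V → ℝ) := by
  refine measurable_pi_iff.2 fun v => ?_
  unfold localUpTo clockLocal localSum
  refine ((Measurable.const_add ?_ 1).pow_const 2).sub_const 1
  simp only [Finset.sum_apply, Pi.single_apply]
  refine Finset.measurable_sum _ fun m _ => ?_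
  split_ifs <;> fun_prop

/-- The sequence of vertices `X` and holding times `τ` has the transition probabilities of the
vertex-reinforced jump process. -/
structure IsJumpChain [MeasurableSpace Ω] (W : Sym2 V → ℝ) (P : Measure Ω) (X : ℕ → Ω → V)
    (τ : ℕ → Ω → ℝ≥0∞) : Prop where
  measurable_vertex : ∀ n i, MeasurableSet {ω | X n ω = i}
  measurable_hold : ∀ n, Measurable (τ n)
  law : ∀ (n : ℕ) (x : ℕ → V) (B : Set (Fin n → ℝ≥0∞)), MeasurableSet B →
    ∀ (t : ℝ), 0 ≤ t → ∀ j : V,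
      P (history X τ n x B ∩
          {ω | ENNReal.ofReal t ≤ τ n ω ∧ τ n ω < ∞ ∧ X (n + 1) ω = j}) =
        ∫⁻ ω in history X τ n x B, ENNReal.ofReal
          (W s(x n, j) * √(1 + localUpTo x n (holds τ n ω) j) /
              exitRate W (x n) (localUpTo x n (holds τ n ω)) *
            Real.exp (-(exitRate W (x n) (localUpTo x n (holds τ n ω)) * t))) ∂P

variable [MeasurableSpace Ω] {W : Sym2 V → ℝ} {P : Measure Ω} {X : ℕ → Ω → V}
  {τ : ℕ → Ω → ℝ≥0∞}

theorem measurable_holds (hτ : ∀ n, Measurable (τ n)) (n : ℕ) : Measurable (holds τ n) :=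
  measurable_pi_iff.2 fun m => hτ m

theorem measurableSet_history (hX : ∀ n i, MeasurableSet {ω | X n ω = i})
    (hτ : ∀ n, Measurable (τ n)) (n : ℕ) (x : ℕ → V) {B : Set (Fin n → ℝ≥0∞)}
    (hB : MeasurableSet B) : MeasurableSet (history X τ n x B) := by
  have h1 : MeasurableSet {ω | jumpTime τ n ω < ∞} :=
    measurableSet_lt (Finset.measurable_sum _ fun m _ => hτ m) measurable_const
  have h2 : MeasurableSet {ω | ∀ m ≤ n, X m ω = x m} := by
    simp only [Set.ofPred_forall]
    exact .iInter fun m => .iInter fun _ => hX m (x m)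
  exact h1.inter (h2.inter (measurable_holds hτ n hB))

/-- On a fixed history the offset local times at the n-th jump are explicit functions of the first n
holding times, so the rates no longer refer to Y. -/
theorem IsVRJP.exists_isJumpChain {i₀ : V} {Y : ℝ → Ω → V} (hY : IsVRJP W P i₀ Y) :
    ∃ (X : ℕ → Ω → V) (τ : ℕ → Ω → ℝ≥0∞), IsJumpChain W P X τ ∧
      ∀ᵐ ω ∂P, ∀ t : ℝ, 0 ≤ t → ∃ n, ∑ m ∈ Finset.range n, τ m ω ≤ ENNReal.ofReal t ∧
        ENNReal.ofReal t < ∑ m ∈ Finset.range (n + 1), τ m ω ∧ Y t ω = X n ω := by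
  obtain ⟨X, τ, hX, hτ, hcover, hlaw⟩ := hY.jumps
  refine ⟨X, τ, ⟨hX, hτ, fun n x B hB t ht j => ?_⟩, hcover⟩
  rw [hlaw n x B hB t ht j]
  refine setLIntegral_congr_fun_ae (measurableSet_history hX hτ n x hB) ?_
  filter_upwards [hcover] with ω hω hmem
  have hrate : ∀ v, jumpRate W (fun s => Y s ω) (x n) v (jumpTime τ n ω).toReal =
      W s(x n, v) * √(1 + localUpTo x n (holds τ n ω) v) := by
    intro v
    rw [localUpTo_holds x τ le_rfl, sqrt_one_add_clockLocal fun m _ => ENNReal.toReal_nonneg, jumpRate]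
    have h1 := offsetLocalTime_of_cover (y := fun s => Y s ω) (X := fun m => X m ω)
      (τ := fun m => τ m ω) hω (n := n) hmem.1 v
    rw [localSum_congr _ fun m (hm : m < n) => hmem.2.1 m hm.le] at h1
    rw [← h1]
    rfl
  simp only [totalRate, hrate]
  rfl

/-- The hypothesis `ha` covers R = 0, where the quotient is 0 by convention and no jump has positive
density. -/
theorem lintegral_exp_Ioi {a R t : ℝ} (hR : 0 ≤ R) (ha : R = 0 → a = 0) (ha0 : 0 ≤ a) :
    ∫⁻ s in Set.Ioi t, ENNReal.ofReal (a * Real.exp (-(R * s))) =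
      ENNReal.ofReal (a / R * Real.exp (-(R * t))) := by
  rcases hR.eq_or_lt with rfl | hR
  · simp [ha rfl]
  · rw [← ofReal_integral_eq_lintegral_ofReal]
    · rw [integral_const_mul]
      have := integral_exp_mul_Ioi (a := -R) (by linarith) t
      simp only [neg_mul] at this
      rw [this]
      congr 1
      field_simp
    · have := exp_neg_integrableOn_Ioi t hR
      simp only [neg_mul] at this
      exact this.const_mul a
    · exact Eventually.of_forall fun s => by positivity

theorem measurable_exitRate (W : Sym2 V → ℝ) (i : V) : Measurable (exitRate W i) := by
  unfold exitRate
  fun_prop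

theorem exitRate_nonneg (hW : ∀ e, 0 ≤ W e) (i : V) (l : V → ℝ) : 0 ≤ exitRate W i l :=
  Finset.sum_nonneg fun _ _ => mul_nonneg (hW _) (Real.sqrt_nonneg _)

theorem rate_eq_zero (hW : ∀ e, 0 ≤ W e) {i : V} {l : V → ℝ} (h : exitRate W i l = 0) (j : V) :
    W s(i, j) * √(1 + l j) = 0 :=
  (Finset.sum_eq_zero_iff_of_nonneg fun _ _ => mul_nonneg (hW _) (Real.sqrt_nonneg _)).1 h j
    (Finset.mem_univ j)

theorem history_eq_inter (n : ℕ) (x : ℕ → V) (B : Set (Fin n → ℝ≥0∞)) :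
    history X τ n x B = history X τ n x Set.univ ∩ holds τ n ⁻¹' B := by
  ext ω
  simp only [history, Set.mem_inter_iff, Set.mem_univ, and_true, Set.mem_preimage]
  exact ⟨fun h => ⟨⟨h.1, h.2.1⟩, h.2.2⟩, fun h => ⟨h.1.1, h.1.2, h.2⟩⟩

theorem mem_history_succ {n : ℕ} {x : ℕ → V} {ω : Ω} : ω ∈ history X τ (n + 1) x Set.univ ↔
    ω ∈ history X τ n x Set.univ ∧ τ n ω < ∞ ∧ X (n + 1) ω = x (n + 1) := by
  simp only [history, Set.mem_univ, and_true, jumpTime, Finset.sum_range_succ,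
    ENNReal.add_lt_top]
  constructor
  · exact fun h => ⟨⟨h.1.1, fun m hm => h.2 m (by omega)⟩, h.1.2, h.2 _ le_rfl⟩
  · rintro ⟨⟨h1, h2⟩, h3, h4⟩
    refine ⟨⟨h1, h3⟩, fun m hm => ?_⟩
    rcases Nat.lt_or_ge n m with h | h
    · obtain rfl : m = n + 1 := by omega
      exact h4
    · exact h2 m h

/-- The density of the next holding time and vertex. -/
def realDensity (W : Sym2 V → ℝ) (i j : V) (l : V → ℝ) (s : ℝ) : ℝ :=
  W s(i, j) * √(1 + l j) * Real.exp (-(exitRate W i l * s))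

theorem measurable_realDensity (W : Sym2 V → ℝ) (i j : V) :
    Measurable fun p : (V → ℝ) × ℝ => realDensity W i j p.1 p.2 := by
  unfold realDensity
  have : Measurable fun p : (V → ℝ) × ℝ => exitRate W i p.1 :=
    (measurable_exitRate W i).comp measurable_fst
  fun_prop

/-- The law is given on rectangles B × [t, ∞), and the tail a/R · exp(−R t) is the integral of the
density a · exp(−R s) over (t, ∞). For each B these half-lines determine a finite measure in the
second coordinate. -/
theorem IsJumpChain.map_eq [IsProbabilityMeasure P] (h : IsJumpChain W P X τ)
    (hW : ∀ e, 0 ≤ W e) (n : ℕ) (x : ℕ → V) :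
    (P.restrict (history X τ (n + 1) x Set.univ)).map (fun ω => (holds τ n ω, (τ n ω).toReal)) =
      (((P.restrict (history X τ n x Set.univ)).map (holds τ n)).prod
        (volume.restrict (Set.Ioi 0))).withDensity fun p =>
          ENNReal.ofReal (realDensity W (x n) (x (n + 1)) (localUpTo x n p.1) p.2) := by
  have hH := measurable_holds h.measurable_hold n
  have hHτ : Measurable fun ω => (holds τ n ω, (τ n ω).toReal) :=
    hH.prodMk (h.measurable_hold n).ennreal_toReal
  have hhist := measurableSet_history h.measurable_vertex h.measurable_hold n x MeasurableSet.univ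
  have hdm : Measurable fun p : (Fin n → ℝ≥0∞) × ℝ =>
      ENNReal.ofReal (realDensity W (x n) (x (n + 1)) (localUpTo x n p.1) p.2) :=
    ((measurable_realDensity W _ _).comp
      (((measurable_localUpTo x n n).comp measurable_fst).prodMk measurable_snd)).ennreal_ofReal
  set μ₁ := (P.restrict (history X τ (n + 1) x Set.univ)).map
    (fun ω => (holds τ n ω, (τ n ω).toReal)) with hμ₁
  set μ₂ := (((P.restrict (history X τ n x Set.univ)).map (holds τ n)).prod
    (volume.restrict (Set.Ioi 0))).withDensity fun p =>
      ENNReal.ofReal (realDensity W (x n) (x (n + 1)) (localUpTo x n p.1) p.2) with hμ₂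
  have : IsFiniteMeasure μ₁ := Measure.isFiniteMeasure_map _ _
  have h0 : ∀ (B : Set (Fin n → ℝ≥0∞)), MeasurableSet B → ∀ t : ℝ, 0 ≤ t →
      μ₁ (B ×ˢ Set.Ici t) = μ₂ (B ×ˢ Set.Ici t) := by
    intro B hB t ht
    have hset : history X τ (n + 1) x Set.univ ∩
        (fun ω => (holds τ n ω, (τ n ω).toReal)) ⁻¹' (B ×ˢ Set.Ici t) =
        history X τ n x B ∩
          {ω | ENNReal.ofReal t ≤ τ n ω ∧ τ n ω < ∞ ∧ X (n + 1) ω = x (n + 1)} := by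
      rw [history_eq_inter n x B]
      ext ω
      rw [Set.mem_inter_iff, mem_history_succ]
      simp only [Set.mem_inter_iff, Set.mem_preimage, Set.mem_prod, Set.mem_Ici, Set.mem_ofPred_eq]
      constructor
      · rintro ⟨⟨h1, h2, h3⟩, h4, h5⟩
        exact ⟨⟨h1, h4⟩, (ENNReal.ofReal_le_iff_le_toReal h2.ne).2 h5, h2, h3⟩
      · rintro ⟨⟨h1, h4⟩, h5, h2, h3⟩
        exact ⟨⟨h1, h2, h3⟩, h4, (ENNReal.ofReal_le_iff_le_toReal h2.ne).1 h5⟩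
    rw [hμ₁, Measure.map_apply hHτ (hB.prod measurableSet_Ici),
      Measure.restrict_apply (hHτ (hB.prod measurableSet_Ici)), Set.inter_comm, hset,
      h.law n x B hB t ht, hμ₂, withDensity_apply _ (hB.prod measurableSet_Ici),
      ← Measure.prod_restrict, lintegral_prod _ hdm.aemeasurable,
      Measure.restrict_map hH hB, lintegral_map hdm.lintegral_prod_right' hH,
      Measure.restrict_restrict (hH hB), history_eq_inter n x B, Set.inter_comm]
    refine lintegral_congr fun ω => ?_
    rw [Measure.restrict_restrict measurableSet_Ici]
    have hae : (Set.Ici t ∩ Set.Ioi 0 : Set ℝ) =ᵐ[volume] Set.Ioi t := by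
      rcases ht.eq_or_lt with rfl | ht
      · rw [Set.inter_eq_right.2 Set.Ioi_subset_Ici_self]
        exact EventuallyEq.rfl
      · rw [Set.inter_eq_left.2 (Set.Ici_subset_Ioi.2 ht)]
        exact Ioi_ae_eq_Ici.symm
    rw [Measure.restrict_congr_set hae]
    exact (lintegral_exp_Ioi (exitRate_nonneg hW _ _) (fun h0 => rate_eq_zero hW h0 _)
      (mul_nonneg (hW _) (Real.sqrt_nonneg _))).symm
  -- Both measures live on nonnegative second coordinates, so thresholds t ≤ 0 reduce to t = 0.
  have hneg₁ : ∀ (B : Set (Fin n → ℝ≥0∞)), MeasurableSet B → ∀ t : ℝ, t ≤ 0 →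
      μ₁ (B ×ˢ Set.Ici t) = μ₁ (B ×ˢ Set.Ici 0) := by
    intro B hB t ht
    rw [hμ₁, Measure.map_apply hHτ (hB.prod measurableSet_Ici),
      Measure.map_apply hHτ (hB.prod measurableSet_Ici)]
    congr 1
    ext ω
    simp [ht.trans ENNReal.toReal_nonneg]
  have hneg₂ : ∀ (B : Set (Fin n → ℝ≥0∞)), MeasurableSet B → ∀ t : ℝ, t ≤ 0 →
      μ₂ (B ×ˢ Set.Ici t) = μ₂ (B ×ˢ Set.Ici 0) := by
    intro B hB t ht
    rw [hμ₂, withDensity_apply _ (hB.prod measurableSet_Ici),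
      withDensity_apply _ (hB.prod measurableSet_Ici), ← Measure.prod_restrict,
      ← Measure.prod_restrict, Measure.restrict_restrict measurableSet_Ici,
      Measure.restrict_restrict measurableSet_Ici,
      Set.inter_eq_right.2 (Set.Ioi_subset_Ici_self : Set.Ioi (0 : ℝ) ⊆ Set.Ici 0),
      Set.inter_eq_right.2 (Set.Ioi_subset_Ici ht)]
  have hall : ∀ (B : Set (Fin n → ℝ≥0∞)), MeasurableSet B → ∀ t : ℝ,
      μ₁ (B ×ˢ Set.Ici t) = μ₂ (B ×ˢ Set.Ici t) := by
    intro B hB t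
    rcases le_total 0 t with ht | ht
    · exact h0 B hB t ht
    · rw [hneg₁ B hB t ht, hneg₂ B hB t ht, h0 B hB 0 le_rfl]
  refine Measure.ext_prod fun {B C} hB hC => ?_
  have hsnd : ∀ (μ : Measure ((Fin n → ℝ≥0∞) × ℝ)) (C : Set ℝ), MeasurableSet C →
      (μ.restrict (B ×ˢ Set.univ)).snd C = μ (B ×ˢ C) := by
    intro μ C hC
    rw [Measure.snd_apply hC, Measure.restrict_apply (measurable_snd hC)]
    congr 1
    ext p
    simp [and_comm]
  rw [← hsnd μ₁ C hC, ← hsnd μ₂ C hC]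
  congr 1
  refine Measure.ext_of_Ici _ _ fun t => ?_
  rw [hsnd _ _ measurableSet_Ici, hsnd _ _ measurableSet_Ici, hall B hB t]

theorem IsJumpChain.lintegral_succ [IsProbabilityMeasure P] (h : IsJumpChain W P X τ)
    (hW : ∀ e, 0 ≤ W e) (n : ℕ) (x : ℕ → V) {F : (Fin n → ℝ≥0∞) × ℝ → ℝ≥0∞}
    (hF : Measurable F) :
    ∫⁻ ω in history X τ (n + 1) x Set.univ, F (holds τ n ω, (τ n ω).toReal) ∂P =
      ∫⁻ ω in history X τ n x Set.univ, (∫⁻ s in Set.Ioi (0 : ℝ), F (holds τ n ω, s) *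
        ENNReal.ofReal (realDensity W (x n) (x (n + 1)) (localUpTo x n (holds τ n ω)) s)) ∂P := by
  have hH := measurable_holds h.measurable_hold n
  have hHτ : Measurable fun ω => (holds τ n ω, (τ n ω).toReal) :=
    hH.prodMk (h.measurable_hold n).ennreal_toReal
  have hdm : Measurable fun p : (Fin n → ℝ≥0∞) × ℝ =>
      ENNReal.ofReal (realDensity W (x n) (x (n + 1)) (localUpTo x n p.1) p.2) :=
    ((measurable_realDensity W _ _).comp
      (((measurable_localUpTo x n n).comp measurable_fst).prodMk measurable_snd)).ennreal_ofReal
  rw [← lintegral_map hF hHτ, h.map_eq hW n x, lintegral_withDensity_eq_lintegral_mul _ hdm hF,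
    lintegral_prod _ (hdm.mul hF).aemeasurable, lintegral_map (hdm.mul hF).lintegral_prod_right' hH]
  simp only [Pi.mul_apply, mul_comm]

end Chain

/-! ### Almost sure regularity of paths and survival of a hold -/

section Survival

variable {V : Type*} [Fintype V] [DecidableEq V] {Ω : Type*} [MeasurableSpace Ω]
  {W : Sym2 V → ℝ} {P : Measure Ω} {X : ℕ → Ω → V} {τ : ℕ → Ω → ℝ≥0∞}

/-- Test `lintegral_succ` with the constant 1, whose integral vanishes when the weight of the step
does, and with the indicator of s ≤ 0, which misses the domain of integration. -/
theorem IsJumpChain.ae_of_mem_history [IsProbabilityMeasure P] (h : IsJumpChain W P X τ)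
    (hW : ∀ e, 0 ≤ W e) (n : ℕ) (x : ℕ → V) :
    ∀ᵐ ω ∂P, ω ∈ history X τ (n + 1) x Set.univ → 0 < (τ n ω).toReal ∧ W s(x n, x (n + 1)) ≠ 0 := by
  have hhist := measurableSet_history h.measurable_vertex h.measurable_hold (n + 1) x
    MeasurableSet.univ
  by_cases hx : W s(x n, x (n + 1)) = 0
  · have h1 := h.lintegral_succ hW n x (F := fun _ => 1) measurable_const
    simp only [realDensity, hx, zero_mul, ENNReal.ofReal_zero, mul_zero, lintegral_zero,
      setLIntegral_one] at h1
    filter_upwards [measure_eq_zero_iff_ae_notMem.1 h1] with ω hω hmem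
    exact absurd hmem hω
  · have hm : Measurable fun p : (Fin n → ℝ≥0∞) × ℝ => (Set.Iic (0 : ℝ)).indicator
        (fun _ => (1 : ℝ≥0∞)) p.2 :=
      (measurable_const.indicator measurableSet_Iic).comp measurable_snd
    have h1 := h.lintegral_succ hW n x hm
    have h2 : ∀ ω, ∫⁻ s in Set.Ioi (0 : ℝ), (Set.Iic (0 : ℝ)).indicator (fun _ => (1 : ℝ≥0∞)) s *
        ENNReal.ofReal (realDensity W (x n) (x (n + 1)) (localUpTo x n (holds τ n ω)) s) = 0 := by
      intro ω
      rw [setLIntegral_congr_fun (g := fun _ => 0) measurableSet_Ioi fun s hs => by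
        simp [Set.mem_Ioi.1 hs]]
      simp
    simp only [h2, lintegral_zero] at h1
    rw [lintegral_eq_zero_iff (by
      exact (measurable_const.indicator measurableSet_Iic).comp
        (h.measurable_hold n).ennreal_toReal)] at h1
    have h3 := (ae_restrict_iff' hhist).1 h1
    filter_upwards [h3] with ω hω hmem
    refine ⟨?_, hx⟩
    by_contra hle
    have := hω hmem
    simp [not_lt.1 hle] at this

theorem IsJumpChain.ae_isGood [IsProbabilityMeasure P] (h : IsJumpChain W P X τ)
    {G : SimpleGraph V} (hW : ∀ e, 0 ≤ W e) (hW0 : ∀ e, e ∉ G.edgeSet → W e = 0) {i₀ : V}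
    {Y : ℝ → Ω → V} (hY0 : ∀ᵐ ω ∂P, Y 0 ω = i₀)
    (hcover : ∀ᵐ ω ∂P, ∀ t : ℝ, 0 ≤ t → ∃ n, ∑ m ∈ Finset.range n, τ m ω ≤ ENNReal.ofReal t ∧
      ENNReal.ofReal t < ∑ m ∈ Finset.range (n + 1), τ m ω ∧ Y t ω = X n ω) :
    ∀ᵐ ω ∂P, IsGood G (fun t => Y t ω) (fun n => X n ω) (fun n => τ n ω) ∧ X 0 ω = i₀ := by
  -- Only the first n + 2 vertices matter, and finite words over V are countable, so the null sets
  -- of all histories can be united.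
  have hall : ∀ᵐ ω ∂P, ∀ (n : ℕ) (x : Fin (n + 2) → V),
      ω ∈ history X τ (n + 1) (fun m => if hm : m < n + 2 then x ⟨m, hm⟩ else i₀) Set.univ →
      0 < (τ n ω).toReal ∧ W s(x ⟨n, by omega⟩, x ⟨n + 1, by omega⟩) ≠ 0 := by
    rw [ae_all_iff]
    intro n
    rw [ae_all_iff]
    intro x
    have := h.ae_of_mem_history hW n (fun m => if hm : m < n + 2 then x ⟨m, hm⟩ else i₀)
    simpa only [show n < n + 2 by omega, show n + 1 < n + 2 by omega, dif_pos] using this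
  filter_upwards [hall, hY0, hcover] with ω hω hω0 hωc
  have key : ∀ n, ∑ m ∈ Finset.range (n + 1), τ m ω < ∞ →
      0 < (τ n ω).toReal ∧ W s(X n ω, X (n + 1) ω) ≠ 0 := fun n hn =>
    hω n (fun m => X m ω) ⟨hn, fun m hm => by
      simp only [dif_pos (show m < n + 2 by omega)], trivial⟩
  have hpos : ∀ n, ∑ m ∈ Finset.range n, τ m ω < ∞ → 0 < τ n ω := by
    intro n hn
    by_cases htop : τ n ω < ∞
    · have := (key n (by rw [Finset.sum_range_succ]; exact ENNReal.add_lt_top.2 ⟨hn, htop⟩)).1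
      exact (ENNReal.toReal_pos_iff.1 this).1
    · rw [not_lt_top_iff.1 htop]
      exact ENNReal.zero_lt_top
  refine ⟨⟨hωc, hpos, fun n hn => ?_⟩, ?_⟩
  · by_contra hadj
    exact (key n hn).2 (hW0 _ hadj)
  -- A positive first holding time forces the index of time 0 to be 0, hence X 0 = Y 0.
  · obtain ⟨n, hn, -, hYn⟩ := hωc 0 le_rfl
    cases n with
    | zero => rw [← hYn, hω0]
    | succ n =>
      rw [ENNReal.ofReal_zero, nonpos_iff_eq_zero, Finset.sum_eq_zero_iff] at hn
      exact absurd (hn 0 (by simp)) (hpos 0 (by simp)).ne'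

theorem history_congr {x x' : ℕ → V} {n : ℕ} (h : ∀ m ≤ n, x m = x' m)
    (B : Set (Fin n → ℝ≥0∞)) : history X τ n x B = history X τ n x' B := by
  ext ω
  simp only [history, Set.mem_ofPred_eq]
  exact and_congr_right fun _ => and_congr_left fun _ =>
    forall₂_congr fun m hm => by rw [h m hm]

theorem localUpTo_congr {x x' : ℕ → V} {N n : ℕ} (h : ∀ m < N, x m = x' m)
    (f : Fin n → ℝ≥0∞) : localUpTo x N f = localUpTo x' N f :=
  clockLocal_congr _ h

theorem sum_realDensity (W : Sym2 V → ℝ) (i : V) (l : V → ℝ) (s : ℝ) :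
    ∑ j, realDensity W i j l s = exitRate W i l * Real.exp (-(exitRate W i l * s)) := by
  unfold realDensity
  rw [← Finset.sum_mul]
  rfl

theorem lintegral_exp_Ioc {R c : ℝ} (hR : 0 ≤ R) (hc : 0 ≤ c) :
    ∫⁻ s in Set.Ioc 0 c, ENNReal.ofReal (R * Real.exp (-(R * s))) =
      ENNReal.ofReal (1 - Real.exp (-(R * c))) := by
  rw [← ofReal_integral_eq_lintegral_ofReal]
  · rw [← intervalIntegral.integral_of_le hc]
    have hd : ∀ s ∈ Set.uIcc 0 c, HasDerivAt (fun s => -Real.exp (-(R * s)))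
        (R * Real.exp (-(R * s))) s := by
      intro s _
      have := ((hasDerivAt_id s).const_mul R).neg.exp.neg
      simp only [id] at this
      refine this.congr_deriv ?_
      simp only [Pi.neg_apply]
      ring
    rw [intervalIntegral.integral_eq_sub_of_hasDerivAt hd
      (Continuous.intervalIntegrable (by fun_prop) _ _)]
    congr 1
    simp only [mul_zero, neg_zero, Real.exp_zero]
    ring
  · exact (Continuous.intervalIntegrable (by fun_prop) 0 c).1
  · exact Eventually.of_forall fun s => by positivity

theorem measurable_lintegral_realDensity (W : Sym2 V → ℝ) (i j : V) {n : ℕ} (x : ℕ → V)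
    {c : (Fin n → ℝ≥0∞) → ℝ} (hc : Measurable c) : Measurable fun f : Fin n → ℝ≥0∞ =>
      ∫⁻ s in Set.Ioc 0 (c f), ENNReal.ofReal (realDensity W i j (localUpTo x n f) s) := by
  have h1 : MeasurableSet {p : (Fin n → ℝ≥0∞) × ℝ | p.2 ∈ Set.Ioc 0 (c p.1)} :=
    (measurableSet_lt measurable_const measurable_snd).inter
      (measurableSet_le measurable_snd (hc.comp measurable_fst))
  have h2 : Measurable fun p : (Fin n → ℝ≥0∞) × ℝ =>
      ENNReal.ofReal (realDensity W i j (localUpTo x n p.1) p.2) :=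
    ((measurable_realDensity W _ _).comp (((measurable_localUpTo x n n).comp
      measurable_fst).prodMk measurable_snd)).ennreal_ofReal
  have h3 := (h2.indicator h1).lintegral_prod_right' (ν := volume)
  convert h3 using 2 with f
  rw [← lintegral_indicator measurableSet_Ioc]
  rfl

theorem measurable_exp_exitRate (W : Sym2 V → ℝ) (i : V) {n : ℕ} (x : ℕ → V)
    {c : (Fin n → ℝ≥0∞) → ℝ} (hc : Measurable c) : Measurable fun f : Fin n → ℝ≥0∞ =>
      ENNReal.ofReal (Real.exp (-(exitRate W i (localUpTo x n f) * c f))) :=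
  ((((measurable_exitRate W i).comp (measurable_localUpTo x n n)).mul hc).neg).exp.ennreal_ofReal

/-- The law speaks only of jumps that occur, whereas survival includes τ n = ∞. So the complement is
computed: a jump within c, summed over the next vertex, has conditional probability 1 − exp(−R c),
also for R = 0. Finiteness of P allows the subtraction. -/
theorem IsJumpChain.measure_survival [IsProbabilityMeasure P] (h : IsJumpChain W P X τ)
    (hW : ∀ e, 0 ≤ W e) (n : ℕ) (x : ℕ → V) {c : (Fin n → ℝ≥0∞) → ℝ} (hc : Measurable c)
    (hc0 : ∀ f, 0 ≤ c f) {B : Set (Fin n → ℝ≥0∞)} (hB : MeasurableSet B) :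
    P (history X τ n x B ∩ {ω | ENNReal.ofReal (c (holds τ n ω)) < τ n ω}) =
      ∫⁻ ω in history X τ n x B, ENNReal.ofReal
        (Real.exp (-(exitRate W (x n) (localUpTo x n (holds τ n ω)) * c (holds τ n ω)))) ∂P := by
  have hH := measurable_holds h.measurable_hold n
  set A := history X τ n x B with hA
  have hAm : MeasurableSet A := measurableSet_history h.measurable_vertex h.measurable_hold n x hB
  have hSm : MeasurableSet {ω | ENNReal.ofReal (c (holds τ n ω)) < τ n ω} :=
    measurableSet_lt (hc.comp hH).ennreal_ofReal (h.measurable_hold n)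
  set D : Set ((Fin n → ℝ≥0∞) × ℝ) := {p | p.1 ∈ B ∧ p.2 ≤ c p.1} with hD
  have hDm : MeasurableSet D :=
    (measurable_fst hB).inter (measurableSet_le measurable_snd (hc.comp measurable_fst))
  have hHτ : Measurable fun ω => (holds τ n ω, (τ n ω).toReal) :=
    hH.prodMk (h.measurable_hold n).ennreal_toReal
  set xs : V → ℕ → V := fun j => Function.update x (n + 1) j with hxs
  have hxs_le : ∀ j, ∀ m ≤ n, xs j m = x m := fun j m hm =>
    Function.update_of_ne (by omega) _ _
  have hexit : ∀ ω, 0 ≤ exitRate W (x n) (localUpTo x n (holds τ n ω)) * c (holds τ n ω) := fun ω =>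
    mul_nonneg (exitRate_nonneg hW _ _) (hc0 _)
  have hpiece : ∀ j, P (history X τ (n + 1) (xs j) Set.univ ∩
      (fun ω => (holds τ n ω, (τ n ω).toReal)) ⁻¹' D) =
      ∫⁻ ω in A, (∫⁻ s in Set.Ioc 0 (c (holds τ n ω)),
        ENNReal.ofReal (realDensity W (x n) j (localUpTo x n (holds τ n ω)) s)) ∂P := by
    intro j
    have h1 := h.lintegral_succ hW n (xs j) (F := D.indicator 1) (measurable_one.indicator hDm)
    have h2 : ∀ ω, D.indicator (1 : (Fin n → ℝ≥0∞) × ℝ → ℝ≥0∞) (holds τ n ω, (τ n ω).toReal) =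
        ((fun ω => (holds τ n ω, (τ n ω).toReal)) ⁻¹' D).indicator 1 ω := fun ω => rfl
    simp_rw [h2] at h1
    rw [lintegral_indicator_one (hHτ hDm), Measure.restrict_apply (hHτ hDm), Set.inter_comm] at h1
    rw [h1, history_congr (hxs_le j), hA, history_eq_inter n x B, Set.inter_comm,
      ← Measure.restrict_restrict (hH hB), ← lintegral_indicator (hH hB)]
    refine lintegral_congr fun ω => ?_
    rw [localUpTo_congr (x' := x) fun m hm => hxs_le j m hm.le, hxs_le j n le_rfl,
      show xs j (n + 1) = j from Function.update_self _ _ _]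
    by_cases hω : holds τ n ω ∈ B
    · rw [Set.indicator_of_mem (show ω ∈ holds τ n ⁻¹' B from hω), ← Set.Ioi_inter_Iic,
        Set.inter_comm, ← Measure.restrict_restrict measurableSet_Iic,
        ← lintegral_indicator measurableSet_Iic]
      refine lintegral_congr fun s => ?_
      by_cases hs : s ≤ c (holds τ n ω)
      · rw [Set.indicator_of_mem (show (holds τ n ω, s) ∈ D from ⟨hω, hs⟩),
          Set.indicator_of_mem (show s ∈ Set.Iic _ from hs), Pi.one_apply, one_mul]
      · rw [Set.indicator_of_notMem (show (holds τ n ω, s) ∉ D from fun h => hs h.2),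
          Set.indicator_of_notMem (show s ∉ Set.Iic _ from hs), zero_mul]
    · rw [Set.indicator_of_notMem (show ω ∉ holds τ n ⁻¹' B from hω)]
      have : ∀ s, D.indicator (1 : (Fin n → ℝ≥0∞) × ℝ → ℝ≥0∞) (holds τ n ω, s) = 0 := fun s =>
        Set.indicator_of_notMem (fun h => hω h.1) _
      simp [this]
  have hcompl : A \ {ω | ENNReal.ofReal (c (holds τ n ω)) < τ n ω} =
      ⋃ j, (history X τ (n + 1) (xs j) Set.univ ∩
        (fun ω => (holds τ n ω, (τ n ω).toReal)) ⁻¹' D) := by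
    ext ω
    simp only [Set.mem_sdiff, Set.mem_ofPred_eq, not_lt, Set.mem_iUnion, Set.mem_inter_iff,
      mem_history_succ, Set.mem_preimage, history_congr (hxs_le _) Set.univ]
    rw [hA, history_eq_inter n x B, Set.mem_inter_iff, Set.mem_preimage]
    constructor
    · rintro ⟨⟨h1, h2⟩, h3⟩
      have hfin : τ n ω < ∞ := h3.trans_lt ENNReal.ofReal_lt_top
      exact ⟨X (n + 1) ω, ⟨h1, hfin, by simp [hxs]⟩, h2,
        ENNReal.toReal_le_of_le_ofReal (hc0 _) h3⟩
    · rintro ⟨j, ⟨h1, hfin, -⟩, h2, h3⟩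
      exact ⟨⟨h1, h2⟩, (ENNReal.le_ofReal_iff_toReal_le hfin.ne (hc0 _)).2 h3⟩
  have hdiff : P (A \ {ω | ENNReal.ofReal (c (holds τ n ω)) < τ n ω}) =
      ∫⁻ ω in A, ENNReal.ofReal (1 - Real.exp
        (-(exitRate W (x n) (localUpTo x n (holds τ n ω)) * c (holds τ n ω)))) ∂P := by
    rw [hcompl, measure_iUnion]
    · rw [tsum_fintype]
      simp_rw [hpiece]
      rw [← lintegral_finsetSum']
      · refine lintegral_congr fun ω => ?_
        rw [← lintegral_exp_Ioc (exitRate_nonneg hW _ _) (hc0 _), ← lintegral_finsetSum]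
        · refine lintegral_congr fun s => ?_
          rw [← sum_realDensity, ENNReal.ofReal_sum_of_nonneg]
          exact fun j _ => mul_nonneg (mul_nonneg (hW _) (Real.sqrt_nonneg _)) (Real.exp_nonneg _)
        · intro j _
          unfold realDensity
          fun_prop
      · intro j _
        exact ((measurable_lintegral_realDensity W (x n) j x hc).comp hH).aemeasurable
    · intro i j hij
      rw [Function.onFun, Set.disjoint_left]
      rintro ω ⟨h1, -⟩ ⟨h2, -⟩
      refine hij ?_
      rw [mem_history_succ] at h1 h2
      have := h1.2.2.symm.trans h2.2.2
      simpa [hxs] using this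
    · intro j
      exact (measurableSet_history h.measurable_vertex h.measurable_hold _ _
        MeasurableSet.univ).inter (hHτ hDm)
  have htot : P A = ∫⁻ ω in A, ENNReal.ofReal
      (Real.exp (-(exitRate W (x n) (localUpTo x n (holds τ n ω)) * c (holds τ n ω)))) ∂P +
      ∫⁻ ω in A, ENNReal.ofReal (1 - Real.exp
        (-(exitRate W (x n) (localUpTo x n (holds τ n ω)) * c (holds τ n ω)))) ∂P := by
    have hm : Measurable fun ω => ENNReal.ofReal
        (Real.exp (-(exitRate W (x n) (localUpTo x n (holds τ n ω)) * c (holds τ n ω)))) :=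
      (measurable_exp_exitRate W (x n) x hc).comp hH
    rw [← lintegral_add_left hm, ← setLIntegral_one]
    refine lintegral_congr fun ω => ?_
    rw [← ENNReal.ofReal_add (Real.exp_nonneg _)
      (sub_nonneg.2 (Real.exp_le_one_iff.2 (neg_nonpos.2 (hexit ω))))]
    simp
  rw [← measure_inter_add_sdiff A hSm, hdiff] at htot
  refine (ENNReal.add_left_inj ?_).1 htot
  rw [← hdiff]
  exact measure_ne_top _ _

theorem IsJumpChain.lintegral_survival [IsProbabilityMeasure P] (h : IsJumpChain W P X τ)
    (hW : ∀ e, 0 ≤ W e) (n : ℕ) (x : ℕ → V) {c : (Fin n → ℝ≥0∞) → ℝ} (hc : Measurable c)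
    (hc0 : ∀ f, 0 ≤ c f) {F : (Fin n → ℝ≥0∞) → ℝ≥0∞} (hF : Measurable F) :
    ∫⁻ ω in history X τ n x Set.univ ∩ {ω | ENNReal.ofReal (c (holds τ n ω)) < τ n ω},
        F (holds τ n ω) ∂P =
      ∫⁻ ω in history X τ n x Set.univ, F (holds τ n ω) * ENNReal.ofReal
        (Real.exp (-(exitRate W (x n) (localUpTo x n (holds τ n ω)) * c (holds τ n ω)))) ∂P := by
  have hH := measurable_holds h.measurable_hold n
  have hexpm := measurable_exp_exitRate W (x n) x hc
  have hmap : (P.restrict (history X τ n x Set.univ ∩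
      {ω | ENNReal.ofReal (c (holds τ n ω)) < τ n ω})).map (holds τ n) =
      ((P.restrict (history X τ n x Set.univ)).map (holds τ n)).withDensity fun f =>
        ENNReal.ofReal (Real.exp (-(exitRate W (x n) (localUpTo x n f) * c f))) := by
    ext B hB
    rw [Measure.map_apply hH hB, Measure.restrict_apply (hH hB), withDensity_apply _ hB,
      Measure.restrict_map hH hB, lintegral_map hexpm hH, Measure.restrict_restrict (hH hB),
      Set.inter_comm (holds τ n ⁻¹' B) (history X τ n x Set.univ), ← history_eq_inter, ← h.measure_survival hW n x hc hc0 hB,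
      history_eq_inter n x B]
    congr 1
    ext ω
    simp only [Set.mem_inter_iff]
    tauto
  rw [← lintegral_map hF hH, hmap, lintegral_withDensity_eq_lintegral_mul _ hexpm hF,
    lintegral_map (hexpm.mul hF) hH]
  simp only [Pi.mul_apply, mul_comm]

end Survival

/-! ### Change to the clock D and the density of the local times at a jump -/

section ClockDensity

variable {V : Type*} [Fintype V] [DecidableEq V] {Ω : Type*}

theorem hasDerivAt_realHold {a u : ℝ} (h : 0 < 1 + a + u) :
    HasDerivAt (realHold a) (1 / (2 * √(1 + a + u))) u :=
  (((hasDerivAt_id u).const_add (1 + a)).sqrt h.ne').sub_const _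

theorem image_realHold {a : ℝ} (ha : 0 ≤ a) : realHold a '' Set.Ioi 0 = Set.Ioi 0 := by
  ext s
  simp only [Set.mem_image, Set.mem_Ioi]
  constructor
  · rintro ⟨u, hu, rfl⟩
    exact sub_pos.2 (Real.sqrt_lt_sqrt (by linarith) (by linarith))
  · intro hs
    refine ⟨clockHold a s, ?_, realHold_clockHold ha hs.le⟩
    have := clockHold_strictMono ha le_rfl hs
    rwa [clockHold, add_zero, Real.sq_sqrt (by linarith), sub_self] at this

/-- Change of variables s = `realHold (l i) u`, with derivative 1 / (2 √(1 + l i + u)). -/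
theorem lintegral_clockHold (W : Sym2 V → ℝ) (i j : V) {l : V → ℝ} (hl : 0 ≤ l i)
    (g : ℝ → ℝ≥0∞) :
    ∫⁻ s in Set.Ioi (0 : ℝ), g (clockHold (l i) s) * ENNReal.ofReal (realDensity W i j l s) =
      ∫⁻ u in Set.Ioi (0 : ℝ), g u * ENNReal.ofReal (holdDensity W i j l u) := by
  have hinj : Set.InjOn (realHold (l i)) (Set.Ioi 0) := fun u hu u' hu' h => by
    rw [← clockHold_realHold hl (le_of_lt hu), h, clockHold_realHold hl (le_of_lt hu')]
  have := lintegral_image_eq_lintegral_abs_deriv_mul measurableSet_Ioi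
    (fun u (hu : 0 < u) => (hasDerivAt_realHold (a := l i) (u := u)
      (by linarith)).hasDerivWithinAt) hinj
    fun s => g (clockHold (l i) s) * ENNReal.ofReal (realDensity W i j l s)
  rw [image_realHold hl] at this
  rw [this]
  refine setLIntegral_congr_fun measurableSet_Ioi fun u (hu : 0 < u) => ?_
  have h2 : 0 < √(1 + l i + u) := Real.sqrt_pos.2 (by linarith)
  rw [clockHold_realHold hl hu.le, abs_of_pos (by positivity), mul_left_comm,
    ← ENNReal.ofReal_mul (by positivity), realDensity, holdDensity, realHold]
  congr 2
  field_simp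

theorem measurable_holdDensity (W : Sym2 V → ℝ) (i j : V) :
    Measurable fun p : (V → ℝ) × ℝ => holdDensity W i j p.1 p.2 := by
  unfold holdDensity
  have : Measurable fun p : (V → ℝ) × ℝ => exitRate W i p.1 :=
    (measurable_exitRate W i).comp measurable_fst
  fun_prop

theorem erlang_ae_nonneg (n : ℕ) : ∀ᵐ s ∂erlang n, 0 ≤ s := by
  cases n with
  | zero => exact (ae_dirac_iff measurableSet_Ici).2 le_rfl
  | succ n =>
    refine (ae_withDensity_iff (measurable_erlangDensity n)).2 (Eventually.of_forall fun s hs => ?_)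
    by_contra h
    exact hs (Set.indicator_of_notMem (fun h' => h (le_of_lt h')) _)

theorem occupation_ae_nonneg (c : V → ℕ) : ∀ᵐ l ∂occupation c, ∀ v, 0 ≤ l v :=
  ae_all_iff.2 fun v =>
    (Measure.tendsto_eval_ae_ae (μ := fun v => erlang (c v)) (i := v)).eventually
      (erlang_ae_nonneg (c v))

theorem measurable_add_single_prod (v : V) :
    Measurable fun p : (V → ℝ) × ℝ => (p.1 + Pi.single v p.2 : V → ℝ) := by
  refine measurable_pi_iff.2 fun w => ?_
  simp only [Pi.add_apply, Pi.single_apply]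
  split_ifs <;> fun_prop

/-- The local times of the time-changed process at its `N`-th jump. -/
def chainLocal (x : ℕ → V) (τ : ℕ → Ω → ℝ≥0∞) (N : ℕ) (ω : Ω) : V → ℝ :=
  clockLocal x (fun m => (τ m ω).toReal) N

theorem chainLocal_nonneg (x : ℕ → V) (τ : ℕ → Ω → ℝ≥0∞) (N : ℕ) (ω : Ω) (v : V) :
    0 ≤ chainLocal x τ N ω v :=
  clockLocal_nonneg (fun _ _ => ENNReal.toReal_nonneg) v

variable [MeasurableSpace Ω] {W : Sym2 V → ℝ} {P : Measure Ω} {X : ℕ → Ω → V}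
  {τ : ℕ → Ω → ℝ≥0∞}

/-- F may depend on the earlier holding times, which lets conditions about time σ be carried through
later steps. -/
theorem IsJumpChain.lintegral_step [IsProbabilityMeasure P] (h : IsJumpChain W P X τ)
    (hW : ∀ e, 0 ≤ W e) (n : ℕ) (x : ℕ → V) {F : (Fin n → ℝ≥0∞) × (V → ℝ) → ℝ≥0∞}
    (hF : Measurable F) :
    ∫⁻ ω in history X τ (n + 1) x Set.univ, F (holds τ n ω, chainLocal x τ (n + 1) ω) ∂P =
      ∫⁻ ω in history X τ n x Set.univ, (∫⁻ s in Set.Ioi (0 : ℝ),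
        F (holds τ n ω, chainLocal x τ n ω + Pi.single (x n) s) *
        ENNReal.ofReal (holdDensity W (x n) (x (n + 1)) (chainLocal x τ n ω) s)) ∂P := by
  have hl := measurable_localUpTo x n n
  have hm : Measurable fun p : (Fin n → ℝ≥0∞) × ℝ => F (p.1, (localUpTo x n p.1 +
      Pi.single (x n) (clockHold (localUpTo x n p.1 (x n)) p.2) : V → ℝ)) := by
    refine hF.comp (measurable_fst.prodMk ((measurable_add_single_prod (x n)).comp
      ((hl.comp measurable_fst).prodMk ?_)))
    have h1 : Measurable fun p : (Fin n → ℝ≥0∞) × ℝ => localUpTo x n p.1 (x n) :=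
      (measurable_pi_apply (x n)).comp (hl.comp measurable_fst)
    exact ((h1.const_add 1).sqrt.add measurable_snd).pow_const 2 |>.sub (h1.const_add 1)
  have h1 := h.lintegral_succ hW n x hm
  simp only [localUpTo_holds x τ le_rfl] at h1
  have h2 : ∀ ω, chainLocal x τ (n + 1) ω = clockLocal x (fun m => (τ m ω).toReal) n +
      Pi.single (x n) (clockHold (clockLocal x (fun m => (τ m ω).toReal) n (x n))
        (τ n ω).toReal) := fun ω => clockLocal_succ fun m _ => ENNReal.toReal_nonneg
  simp_rw [h2]
  rw [h1]
  refine lintegral_congr fun ω => ?_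
  exact lintegral_clockHold W (x n) (x (n + 1)) (chainLocal_nonneg x τ n ω (x n))
    fun u => F (holds τ n ω, (chainLocal x τ n ω + Pi.single (x n) u : V → ℝ))

/-- The number of times each vertex is left in the steps `a, …, a + n - 1`. -/
def visits (x : ℕ → V) (a n : ℕ) : V → ℕ := ∑ m ∈ Finset.range n, Pi.single (x (a + m)) 1

theorem visits_succ (x : ℕ → V) (a n : ℕ) :
    visits x a (n + 1) = visits x a n + Pi.single (x (a + n)) 1 :=
  Finset.sum_range_succ _ _

/-- The product of the halved weights along the first `n` steps. -/
def weightProd (W : Sym2 V → ℝ) (x : ℕ → V) (n : ℕ) : ℝ :=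
  ∏ m ∈ Finset.range n, (W s(x m, x (m + 1)) / 2)

theorem weightProd_nonneg (hW : ∀ e, 0 ≤ W e) (x : ℕ → V) (n : ℕ) : 0 ≤ weightProd W x n :=
  Finset.prod_nonneg fun _ _ => div_nonneg (hW _) zero_le_two

theorem ofReal_weightProd_succ (hW : ∀ e, 0 ≤ W e) (x : ℕ → V) (n : ℕ) :
    ENNReal.ofReal (weightProd W x (n + 1)) =
      ENNReal.ofReal (weightProd W x n) * ENNReal.ofReal (W s(x n, x (n + 1)) / 2) := by
  rw [← ENNReal.ofReal_mul (weightProd_nonneg hW x n), weightProd, Finset.prod_range_succ, weightProd]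

variable {G : SimpleGraph V} [DecidableRel G.Adj]

theorem lintegral_holdDensity_mul_expFactor (hW : ∀ e, 0 ≤ W e)
    (hW0 : ∀ e, e ∉ G.edgeSet → W e = 0) (i j : V) {b : V → ℝ} (hb : ∀ v, 0 ≤ b v)
    {f : ℝ → ℝ≥0∞} (hf : Measurable f) :
    (∫⁻ s in Set.Ioi (0 : ℝ), f s * ENNReal.ofReal (holdDensity W i j b s)) *
        ENNReal.ofReal (expFactor G W i b) =
      ENNReal.ofReal (W s(i, j) / 2) * ∫⁻ s in Set.Ioi (0 : ℝ), f s *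
        ENNReal.ofReal (expFactor G W j (b + Pi.single i s)) := by
  have hd : Measurable fun s : ℝ => ENNReal.ofReal (holdDensity W i j b s) :=
    ((measurable_holdDensity W i j).comp (measurable_const.prodMk measurable_id)).ennreal_ofReal
  have he : Measurable fun s : ℝ => ENNReal.ofReal (expFactor G W j (b + Pi.single i s)) :=
    ((measurable_expFactor G W j).comp ((measurable_add_single_prod i).comp
      (measurable_const.prodMk measurable_id))).ennreal_ofReal
  have hfd : Measurable fun s => f s * ENNReal.ofReal (holdDensity W i j b s) := hf.mul hd
  have hfe : Measurable fun s => f s * ENNReal.ofReal (expFactor G W j (b + Pi.single i s)) :=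
    hf.mul he
  rw [← lintegral_mul_const _ hfd, ← lintegral_const_mul _ hfe]
  refine setLIntegral_congr_fun measurableSet_Ioi fun s (hs : 0 < s) => ?_
  rw [mul_assoc, mul_comm (ENNReal.ofReal (holdDensity W i j b s)),
    ← ENNReal.ofReal_mul (expFactor_nonneg G W i b),
    expFactor_mul_holdDensity G W hW0 i j hb hs.le,
    ENNReal.ofReal_mul (div_nonneg (hW _) zero_le_two)]
  ring

/-- Induction on the number of jumps. Integrating out the last hold replaces f by f'; `expFactor`
then absorbs its density, leaving half the edge weight, and the hold itself adds one unit at x N to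
the occupation measure. -/
theorem IsJumpChain.lintegral_chainLocal [IsProbabilityMeasure P] (h : IsJumpChain W P X τ)
    (hW : ∀ e, 0 ≤ W e) (hW0 : ∀ e, e ∉ G.edgeSet → W e = 0) (x : ℕ → V)
    (hx : ∀ᵐ ω ∂P, X 0 ω = x 0) (N : ℕ) {f : (V → ℝ) → ℝ≥0∞} (hf : Measurable f) :
    ∫⁻ ω in history X τ N x Set.univ, f (chainLocal x τ N ω) ∂P =
      ENNReal.ofReal (weightProd W x N) * ∫⁻ l, f l * ENNReal.ofReal (expFactor G W (x N) l)
        ∂occupation (visits x 0 N) := by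
  induction N generalizing f with
  | zero =>
    have hae : history X τ 0 x Set.univ =ᵐ[P] Set.univ := by
      filter_upwards [hx] with ω hω
      refine eq_true (⟨by simp [jumpTime], fun m hm => ?_, trivial⟩ : ω ∈ history X τ 0 x Set.univ)
      rw [Nat.le_zero.1 hm, hω]
    have h0 : ∀ ω, chainLocal x τ 0 ω = 0 := fun ω => clockLocal_zero _ _
    have hv : visits x 0 0 = 0 := rfl
    have hm : Measurable fun l => f l * ENNReal.ofReal (expFactor G W (x 0) l) :=
      hf.mul (measurable_expFactor G W (x 0)).ennreal_ofReal
    rw [Measure.restrict_congr_set hae]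
    simp_rw [h0]
    rw [hv, occupation_zero, lintegral_dirac' _ hm]
    simp [weightProd, expFactor_zero]
  | succ N ih =>
    have h1 := h.lintegral_step hW N x (F := fun p => f p.2) (hf.comp measurable_snd)
    set f' : (V → ℝ) → ℝ≥0∞ := fun b => ∫⁻ s in Set.Ioi (0 : ℝ), f (b + Pi.single (x N) s) *
      ENNReal.ofReal (holdDensity W (x N) (x (N + 1)) b s) with hf'
    have hf'm : Measurable f' := by
      have hm : Measurable fun p : (V → ℝ) × ℝ => f (p.1 + Pi.single (x N) p.2) *
          ENNReal.ofReal (holdDensity W (x N) (x (N + 1)) p.1 p.2) :=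
        (hf.comp (measurable_add_single_prod _)).mul (measurable_holdDensity _ _ _).ennreal_ofReal
      exact hm.lintegral_prod_right'
    have hg : Measurable fun l => f l * ENNReal.ofReal (expFactor G W (x (N + 1)) l) :=
      hf.mul (measurable_expFactor G W _).ennreal_ofReal
    refine h1.trans ((ih hf'm).trans ?_)
    rw [visits_succ, zero_add, lintegral_occupation_add_single _ _ hg, ofReal_weightProd_succ hW,
      mul_assoc]
    congr 1
    have hgi : Measurable fun l : V → ℝ => ∫⁻ s in Set.Ioi (0 : ℝ), f (l + Pi.single (x N) s) *
        ENNReal.ofReal (expFactor G W (x (N + 1)) (l + Pi.single (x N) s)) :=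
      (hg.comp (measurable_add_single_prod (x N))).lintegral_prod_right'
    rw [← lintegral_const_mul _ hgi]
    refine lintegral_congr_ae ?_
    filter_upwards [occupation_ae_nonneg (visits x 0 N)] with b hb
    have hfb : Measurable fun s : ℝ => f (b + Pi.single (x N) s) :=
      hf.comp ((measurable_add_single_prod (x N)).comp (measurable_const.prodMk measurable_id))
    exact lintegral_holdDensity_mul_expFactor hW hW0 _ _ hb hfb

end ClockDensity

/-! ### Splitting the chain at time σ -/

section TwoTimes

variable {V : Type*} [Fintype V] [DecidableEq V] {Ω : Type*} [MeasurableSpace Ω]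
  {W : Sym2 V → ℝ} {P : Measure Ω} {X : ℕ → Ω → V} {τ : ℕ → Ω → ℝ≥0∞}
  {G : SimpleGraph V} [DecidableRel G.Adj]

theorem setLIntegral_Ioi_shift {c : ℝ} (hc : 0 ≤ c) (q : ℝ → ℝ≥0∞) :
    ∫⁻ s in Set.Ioi (0 : ℝ), (if c < s then q (s - c) else 0) = ∫⁻ u in Set.Ioi (0 : ℝ), q u := by
  rw [← lintegral_indicator measurableSet_Ioi, ← lintegral_indicator measurableSet_Ioi,
    ← lintegral_sub_right_eq_self ((Set.Ioi (0 : ℝ)).indicator q) c]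
  refine lintegral_congr fun s => ?_
  simp only [Set.indicator_apply, Set.mem_Ioi, sub_pos]
  split_ifs <;> first | rfl | (exfalso; linarith)

theorem fill_nonneg {j : V} {σ : ℝ} {l : V → ℝ} (hl : ∀ v, 0 ≤ l v) (h : ∑ v, l v ≤ σ) (v : V) :
    0 ≤ fill j σ l v := by
  rw [fill, Pi.add_apply, Pi.single_apply]
  have := hl v
  split_ifs <;> linarith

theorem add_single_eq_fill_add (j : V) (σ : ℝ) (l : V → ℝ) (s : ℝ) :
    (l + Pi.single j s : V → ℝ) = fill j σ l + Pi.single j (s - (σ - ∑ v, l v)) := by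
  rw [fill, add_assoc, ← Pi.single_add, add_sub_cancel]

theorem measurable_pair_single (v : V) : Measurable fun p : ((V → ℝ) × (V → ℝ)) × ℝ =>
    (p.1.1, (p.1.2 + Pi.single v p.2 : V → ℝ)) :=
  (measurable_fst.comp measurable_fst).prodMk
    ((measurable_add_single_prod v).comp ((measurable_snd.comp measurable_fst).prodMk measurable_snd))

theorem measurable_sum_coord : Measurable fun l : V → ℝ => ∑ v, l v :=
  Finset.measurable_sum _ fun v _ => measurable_pi_apply v

theorem visits_one (x : ℕ → V) (N : ℕ) : visits x N 1 = 0 + Pi.single (x N) 1 := by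
  simp [visits]

theorem lintegral_occupation_visits_one (x : ℕ → V) (N : ℕ) {g : (V → ℝ) → ℝ≥0∞}
    (hg : Measurable g) : ∫⁻ l, g l ∂occupation (visits x N 1) =
      ∫⁻ s in Set.Ioi (0 : ℝ), g (Pi.single (x N) s) := by
  have hm : Measurable fun l : V → ℝ => ∫⁻ s in Set.Ioi (0 : ℝ), g (l + Pi.single (x N) s) :=
    (hg.comp (measurable_add_single_prod (x N))).lintegral_prod_right'
  rw [visits_one, lintegral_occupation_add_single _ _ hg, occupation_zero, lintegral_dirac' _ hm]
  simp only [zero_add]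

/-- The hold in x N during which σ falls has length s > σ − ∑ l. Its initial part completes the
first local times to `fill (x N) σ l`. The remainder, after a translation, ranges over (0, ∞) with
Lebesgue measure and opens the second period, whose occupation therefore starts with a hold in x N.
-/
theorem IsJumpChain.lintegral_chainLocal_succ [IsProbabilityMeasure P] (h : IsJumpChain W P X τ)
    (hW : ∀ e, 0 ≤ W e) (hW0 : ∀ e, e ∉ G.edgeSet → W e = 0) (x : ℕ → V)
    (hx : ∀ᵐ ω ∂P, X 0 ω = x 0) (σ : ℝ) (N : ℕ) {f : (V → ℝ) × (V → ℝ) → ℝ≥0∞}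
    (hf : Measurable f) :
    ∫⁻ ω in history X τ (N + 1) x Set.univ,
        (if ∑ v, chainLocal x τ N ω v ≤ σ ∧ σ < ∑ v, chainLocal x τ (N + 1) ω v then
          f (chainLocal x τ N ω, chainLocal x τ (N + 1) ω - fill (x N) σ (chainLocal x τ N ω))
        else 0) ∂P =
      ENNReal.ofReal (weightProd W x (N + 1)) *
        ∫⁻ l, (if ∑ v, l v ≤ σ then ∫⁻ l', f (l, l') *
          ENNReal.ofReal (expFactor G W (x (N + 1)) (fill (x N) σ l + l'))
            ∂occupation (visits x N 1) else 0) ∂occupation (visits x 0 N) := by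
  set K : (V → ℝ) × (V → ℝ) → ℝ≥0∞ := fun p =>
    if ∑ v, p.1 v ≤ σ ∧ σ < ∑ v, p.2 v then f (p.1, p.2 - fill (x N) σ p.1) else 0 with hK
  have hKm : Measurable K := by
    refine Measurable.ite ?_ (hf.comp (measurable_fst.prodMk
      (measurable_snd.sub ((measurable_fill _ _).comp measurable_fst)))) measurable_const
    exact (measurableSet_le (measurable_sum_coord.comp measurable_fst) measurable_const).inter
      (measurableSet_lt measurable_const (measurable_sum_coord.comp measurable_snd))
  have h1 := h.lintegral_step hW N x (F := fun p => K (localUpTo x N p.1, p.2))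
    (hKm.comp (((measurable_localUpTo x N N).comp measurable_fst).prodMk measurable_snd))
  simp only [localUpTo_holds x τ le_rfl] at h1
  have hsm : Measurable fun p : (V → ℝ) × ℝ => (p.1, (p.1 + Pi.single (x N) p.2 : V → ℝ)) :=
    measurable_fst.prodMk (measurable_add_single_prod _)
  have hm : Measurable fun b : V → ℝ => ∫⁻ s in Set.Ioi (0 : ℝ), K (b, b + Pi.single (x N) s) *
      ENNReal.ofReal (holdDensity W (x N) (x (N + 1)) b s) := by
    have : Measurable fun p : (V → ℝ) × ℝ => K (p.1, p.1 + Pi.single (x N) p.2) *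
        ENNReal.ofReal (holdDensity W (x N) (x (N + 1)) p.1 p.2) :=
      (hKm.comp hsm).mul (measurable_holdDensity _ _ _).ennreal_ofReal
    exact this.lintegral_prod_right'
  refine h1.trans ((h.lintegral_chainLocal hW hW0 x hx N hm).trans ?_)
  rw [ofReal_weightProd_succ hW, mul_assoc]
  congr 1
  have hpm : Measurable fun p : (V → ℝ) × (V → ℝ) => f p *
      ENNReal.ofReal (expFactor G W (x (N + 1)) (fill (x N) σ p.1 + p.2)) :=
    hf.mul ((measurable_expFactor G W _).comp
      (((measurable_fill _ _).comp measurable_fst).add measurable_snd)).ennreal_ofReal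
  have hrm : Measurable fun l : V → ℝ => if ∑ v, l v ≤ σ then ∫⁻ l', f (l, l') *
      ENNReal.ofReal (expFactor G W (x (N + 1)) (fill (x N) σ l + l'))
        ∂occupation (visits x N 1) else 0 :=
    Measurable.ite (measurableSet_le measurable_sum_coord measurable_const)
      hpm.lintegral_prod_right' measurable_const
  rw [← lintegral_const_mul _ hrm]
  refine lintegral_congr_ae ?_
  filter_upwards [occupation_ae_nonneg (visits x 0 N)] with b hb
  have hfb : Measurable fun s : ℝ => K (b, b + Pi.single (x N) s) :=
    (hKm.comp hsm).comp (measurable_const.prodMk measurable_id)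
  rw [lintegral_holdDensity_mul_expFactor hW hW0 _ _ hb hfb]
  congr 1
  split_ifs with hbσ
  · have hpb : Measurable fun l' => f (b, l') *
        ENNReal.ofReal (expFactor G W (x (N + 1)) (fill (x N) σ b + l')) :=
      hpm.comp (measurable_const.prodMk measurable_id)
    rw [lintegral_occupation_visits_one x N hpb]
    refine Eq.trans (lintegral_congr fun s => ?_) (setLIntegral_Ioi_shift (sub_nonneg.2 hbσ) _)
    have hsum : ∑ v, (b + Pi.single (x N) s : V → ℝ) v = ∑ v, b v + s := by
      simp [Finset.sum_add_distrib]
    simp only [hK, hsum, hbσ, true_and, sub_lt_iff_lt_add']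
    rw [ite_mul, zero_mul, add_single_eq_fill_add (x N) σ b s, add_sub_cancel_left]
  · simp [hK, hbσ]

/-- Induction on the further jumps, as in `lintegral_chainLocal`. The cut at σ is already fixed, so
each new hold enlarges the second occupation only, while `expFactor` sees the total local times. -/
theorem IsJumpChain.lintegral_chainLocal_pair [IsProbabilityMeasure P] (h : IsJumpChain W P X τ)
    (hW : ∀ e, 0 ≤ W e) (hW0 : ∀ e, e ∉ G.edgeSet → W e = 0) (x : ℕ → V)
    (hx : ∀ᵐ ω ∂P, X 0 ω = x 0) (σ : ℝ) (N M : ℕ) {f : (V → ℝ) × (V → ℝ) → ℝ≥0∞}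
    (hf : Measurable f) :
    ∫⁻ ω in history X τ (N + 1 + M) x Set.univ,
        (if ∑ v, chainLocal x τ N ω v ≤ σ ∧ σ < ∑ v, chainLocal x τ (N + 1) ω v then
          f (chainLocal x τ N ω, chainLocal x τ (N + 1 + M) ω - fill (x N) σ (chainLocal x τ N ω))
        else 0) ∂P =
      ENNReal.ofReal (weightProd W x (N + 1 + M)) *
        ∫⁻ l, (if ∑ v, l v ≤ σ then ∫⁻ l', f (l, l') *
          ENNReal.ofReal (expFactor G W (x (N + 1 + M)) (fill (x N) σ l + l'))
            ∂occupation (visits x N (1 + M)) else 0) ∂occupation (visits x 0 N) := by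
  induction M generalizing f with
  | zero => exact h.lintegral_chainLocal_succ hW hW0 x hx σ N hf
  | succ M ih =>
    set n := N + 1 + M with hn
    have hcond : Measurable fun p : (Fin n → ℝ≥0∞) × (V → ℝ) =>
        if ∑ v, localUpTo x N p.1 v ≤ σ ∧ σ < ∑ v, localUpTo x (N + 1) p.1 v then
          f (localUpTo x N p.1, p.2 - fill (x N) σ (localUpTo x N p.1)) else 0 := by
      have hl := (measurable_localUpTo x N n).comp
        (measurable_fst : Measurable (Prod.fst : (Fin n → ℝ≥0∞) × (V → ℝ) → _))
      have hl' := (measurable_localUpTo x (N + 1) n).comp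
        (measurable_fst : Measurable (Prod.fst : (Fin n → ℝ≥0∞) × (V → ℝ) → _))
      refine Measurable.ite ?_ (hf.comp (hl.prodMk
        (measurable_snd.sub ((measurable_fill _ _).comp hl)))) measurable_const
      exact (measurableSet_le (measurable_sum_coord.comp hl) measurable_const).inter
        (measurableSet_lt measurable_const (measurable_sum_coord.comp hl'))
    have h1 := h.lintegral_step hW n x hcond
    simp only [localUpTo_holds x τ (show N ≤ n by omega),
      localUpTo_holds x τ (show N + 1 ≤ n by omega)] at h1
    set f' : (V → ℝ) × (V → ℝ) → ℝ≥0∞ := fun p => ∫⁻ s in Set.Ioi (0 : ℝ),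
      f (p.1, p.2 + Pi.single (x n) s) * ENNReal.ofReal
        (holdDensity W (x n) (x (n + 1)) (fill (x N) σ p.1 + p.2) s) with hf'
    have hfs : Measurable fun p : ((V → ℝ) × (V → ℝ)) × ℝ =>
        f (p.1.1, p.1.2 + Pi.single (x n) p.2) := hf.comp (measurable_pair_single _)
    have hfillm : Measurable fun p : (V → ℝ) × (V → ℝ) => fill (x N) σ p.1 + p.2 :=
      ((measurable_fill _ _).comp measurable_fst).add measurable_snd
    have hf'm : Measurable f' := by
      have : Measurable fun p : ((V → ℝ) × (V → ℝ)) × ℝ =>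
          f (p.1.1, p.1.2 + Pi.single (x n) p.2) * ENNReal.ofReal
            (holdDensity W (x n) (x (n + 1)) (fill (x N) σ p.1.1 + p.1.2) p.2) :=
        hfs.mul ((measurable_holdDensity _ _ _).comp
          ((hfillm.comp measurable_fst).prodMk measurable_snd)).ennreal_ofReal
      exact this.lintegral_prod_right'
    refine h1.trans (Eq.trans ?_ ((ih hf'm).trans ?_))
    · refine lintegral_congr fun ω => ?_
      change ∫⁻ s in Set.Ioi (0 : ℝ), (if ∑ v, chainLocal x τ N ω v ≤ σ ∧
        σ < ∑ v, chainLocal x τ (N + 1) ω v then _ else 0) * _ = _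
      split_ifs with hc
      · refine lintegral_congr fun s => ?_
        change f (chainLocal x τ N ω, chainLocal x τ n ω + Pi.single (x n) s -
          fill (x N) σ (chainLocal x τ N ω)) * _ = _
        simp only
        rw [add_sub_cancel, add_sub_right_comm]
      · simp
    · rw [show N + 1 + (M + 1) = n + 1 from rfl, ofReal_weightProd_succ hW, mul_assoc]
      congr 1
      have hpm : Measurable fun p : (V → ℝ) × (V → ℝ) => f p *
          ENNReal.ofReal (expFactor G W (x (n + 1)) (fill (x N) σ p.1 + p.2)) :=
        hf.mul ((measurable_expFactor G W _).comp hfillm).ennreal_ofReal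
      have hrm : Measurable fun l : V → ℝ => if ∑ v, l v ≤ σ then ∫⁻ l', f (l, l') *
          ENNReal.ofReal (expFactor G W (x (n + 1)) (fill (x N) σ l + l'))
            ∂occupation (visits x N (1 + (M + 1))) else 0 :=
        Measurable.ite (measurableSet_le measurable_sum_coord measurable_const)
          hpm.lintegral_prod_right' measurable_const
      rw [← lintegral_const_mul _ hrm]
      refine lintegral_congr_ae ?_
      filter_upwards [occupation_ae_nonneg (visits x 0 N)] with l hl
      split_ifs with hlσ
      · have hpl : Measurable fun l' => f (l, l') *
            ENNReal.ofReal (expFactor G W (x (n + 1)) (fill (x N) σ l + l')) :=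
          hpm.comp (measurable_const.prodMk measurable_id)
        have hpi : Measurable fun l' : V → ℝ => ∫⁻ s in Set.Ioi (0 : ℝ),
            f (l, l' + Pi.single (x n) s) * ENNReal.ofReal
              (expFactor G W (x (n + 1)) (fill (x N) σ l + (l' + Pi.single (x n) s))) :=
          (hpl.comp (measurable_add_single_prod (x n))).lintegral_prod_right'
        rw [← add_assoc 1 M 1, visits_succ, show N + (1 + M) = n by omega,
          lintegral_occupation_add_single _ _ hpl, ← lintegral_const_mul _ hpi]
        refine lintegral_congr_ae ?_
        filter_upwards [occupation_ae_nonneg (visits x N (1 + M))] with l' hl'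
        have hb : ∀ v, 0 ≤ (fill (x N) σ l + l') v := fun v =>
          add_nonneg (fill_nonneg hl hlσ v) (hl' v)
        have hfb : Measurable fun s : ℝ => f (l, l' + Pi.single (x n) s) :=
          hfs.comp ((measurable_const (a := (l, l'))).prodMk measurable_id)
        refine (lintegral_holdDensity_mul_expFactor hW hW0 _ _ hb hfb).trans ?_
        simp only [add_assoc]
      · simp

end TwoTimes

/-! ### Integrals over the event of following a fixed sequence of vertices -/

section PieceFormula

variable {V : Type*} [Fintype V] [DecidableEq V] {Ω : Type*}

/-- The event that the time-changed process follows the vertices `x` with `N` jumps up to time `σ`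
and `n` jumps up to time `σ + σ'`. -/
def piece (X : ℕ → Ω → V) (τ : ℕ → Ω → ℝ≥0∞) (x : ℕ → V) (N n : ℕ) (σ σ' : ℝ) : Set Ω :=
  {ω | (∀ m ≤ n, X m ω = x m) ∧ JumpCounts x (fun m => τ m ω) N n σ σ'}

/-- The local times during `[0, σ]` and `[σ, σ + σ']` on a piece. -/
def pieceLocal (x : ℕ → V) (τ : ℕ → Ω → ℝ≥0∞) (N n : ℕ) (σ σ' : ℝ) (ω : Ω) :
    (V → ℝ) × (V → ℝ) :=
  (fill (x N) σ (chainLocal x τ N ω),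
    fill (x n) (σ + σ') (chainLocal x τ n ω) - fill (x N) σ (chainLocal x τ N ω))

variable [MeasurableSpace Ω] {W : Sym2 V → ℝ} {P : Measure Ω} {X : ℕ → Ω → V}
  {τ : ℕ → Ω → ℝ≥0∞} {G : SimpleGraph V} [DecidableRel G.Adj]

theorem measurable_chainLocal (hτ : ∀ n, Measurable (τ n)) (x : ℕ → V) (N : ℕ) :
    Measurable (chainLocal x τ N) := by
  have := (measurable_localUpTo x N N).comp (measurable_holds hτ N)
  convert this using 1
  exact funext fun ω => (localUpTo_holds x τ le_rfl ω).symm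

theorem measurable_realHold : Measurable fun p : ℝ × ℝ => realHold p.1 p.2 := by
  unfold realHold
  fun_prop

theorem measurableSet_imp_lt {α : Type*} [MeasurableSpace α] {p : Prop} {c : ℝ} {f : α → ℝ}
    (hf : Measurable f) : MeasurableSet {a | p → c < f a} := by
  by_cases h : p
  · simp only [h, true_imp_iff]
    exact measurableSet_lt measurable_const hf
  · simp [h]

theorem measurableSet_piece (hX : ∀ n i, MeasurableSet {ω | X n ω = i})
    (hτ : ∀ n, Measurable (τ n)) (x : ℕ → V) {N n : ℕ} (hN : N ≤ n) (σ σ' : ℝ) :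
    MeasurableSet (piece X τ x N n σ σ') := by
  have hc := fun m => measurable_sum_coord.comp (measurable_chainLocal hτ x m)
  have h1 := measurableSet_history hX hτ n x MeasurableSet.univ
  have h2 : MeasurableSet {ω | ∑ v, chainLocal x τ N ω v ≤ σ} :=
    measurableSet_le (hc N) measurable_const
  have h3 : MeasurableSet {ω | N < n → σ < ∑ v, chainLocal x τ (N + 1) ω v} :=
    measurableSet_imp_lt (hc (N + 1))
  have h4 : MeasurableSet {ω | ∑ v, chainLocal x τ n ω v ≤ σ + σ'} :=
    measurableSet_le (hc n) measurable_const
  have h5 : MeasurableSet {ω | ENNReal.ofReal (realHold (chainLocal x τ n ω (x n))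
      (σ + σ' - ∑ v, chainLocal x τ n ω v)) < τ n ω} :=
    measurableSet_lt (measurable_realHold.comp
      (((measurable_pi_apply (x n)).comp (measurable_chainLocal hτ x n)).prodMk
        ((hc n).const_sub _))).ennreal_ofReal (hτ n)
  convert h1.inter (h2.inter (h3.inter (h4.inter h5))) using 1
  ext ω
  exact ⟨fun h => ⟨⟨h.2.fin, h.1, trivial⟩, h.2.le_left, h.2.lt_left, h.2.le_right, h.2.lt_right⟩,
    fun h => ⟨h.1.2.1, h.1.1, hN, h.2.1, h.2.2.1, h.2.2.2.1, h.2.2.2.2⟩⟩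

/-- The integrand that remains after integrating out the holding time at time `σ + σ'`. -/
def survivalDensity (W : Sym2 V → ℝ) (i : V) (t : ℝ) (b : V → ℝ) : ℝ :=
  Real.exp (-(exitRate W i b * realHold (b i) (t - ∑ v, b v)))

theorem measurable_survivalDensity (W : Sym2 V → ℝ) (i : V) (t : ℝ) :
    Measurable (survivalDensity W i t) :=
  (((measurable_exitRate W i).mul (measurable_realHold.comp ((measurable_pi_apply i).prodMk
    (measurable_sum_coord.const_sub t)))).neg).exp

theorem IsJumpChain.lintegral_piece_eq [IsProbabilityMeasure P] (h : IsJumpChain W P X τ)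
    (hW : ∀ e, 0 ≤ W e) (x : ℕ → V) {N n : ℕ} (hN : N ≤ n) (σ σ' : ℝ)
    {g : (V → ℝ) × (V → ℝ) → ℝ≥0∞} (hg : Measurable g) :
    ∫⁻ ω in piece X τ x N n σ σ', g (pieceLocal x τ N n σ σ' ω) ∂P =
      ∫⁻ ω in history X τ n x Set.univ, (if (∑ v, chainLocal x τ N ω v ≤ σ ∧
          (N < n → σ < ∑ v, chainLocal x τ (N + 1) ω v)) ∧ ∑ v, chainLocal x τ n ω v ≤ σ + σ' then
        g (pieceLocal x τ N n σ σ' ω) *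
          ENNReal.ofReal (survivalDensity W (x n) (σ + σ') (chainLocal x τ n ω)) else 0) ∂P := by
  classical
  set loc : ℕ → (Fin n → ℝ≥0∞) → V → ℝ := fun m => localUpTo x m with hloc
  have hlocm : ∀ m, Measurable (loc m) := fun m => measurable_localUpTo x m n
  have hlocs : ∀ m, Measurable fun f => ∑ v, loc m f v := fun m => measurable_sum_coord.comp (hlocm m)
  set C : Set (Fin n → ℝ≥0∞) := {f | (∑ v, loc N f v ≤ σ ∧ (N < n → σ < ∑ v, loc (N + 1) f v)) ∧
    ∑ v, loc n f v ≤ σ + σ'} with hC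
  have hCm : MeasurableSet C := by
    refine MeasurableSet.inter (MeasurableSet.inter (measurableSet_le (hlocs N) measurable_const) ?_)
      (measurableSet_le (hlocs n) measurable_const)
    exact measurableSet_imp_lt (hlocs (N + 1))
  -- The maximum with 0 makes the threshold nonnegative everywhere, as the survival lemma requires;
  -- on C it changes nothing.
  set c : (Fin n → ℝ≥0∞) → ℝ := fun f =>
    realHold (loc n f (x n)) (max (σ + σ' - ∑ v, loc n f v) 0) with hc
  have hcm : Measurable c := measurable_realHold.comp
    (((measurable_pi_apply (x n)).comp (hlocm n)).prodMk
      (((hlocs n).const_sub _).max measurable_const))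
  have hc0 : ∀ f, 0 ≤ c f := fun f => realHold_nonneg (le_max_right _ _)
  set q : (Fin n → ℝ≥0∞) → (V → ℝ) × (V → ℝ) := fun f =>
    (fill (x N) σ (loc N f), fill (x n) (σ + σ') (loc n f) - fill (x N) σ (loc N f)) with hq
  have hqm : Measurable q := ((measurable_fill _ _).comp (hlocm N)).prodMk
    (((measurable_fill _ _).comp (hlocm n)).sub ((measurable_fill _ _).comp (hlocm N)))
  have hFm : Measurable (C.indicator fun f => g (q f)) := (hg.comp hqm).indicator hCm
  have hlN : ∀ ω, loc N (holds τ n ω) = chainLocal x τ N ω := fun ω => localUpTo_holds x τ hN ω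
  have hln : ∀ ω, loc n (holds τ n ω) = chainLocal x τ n ω := fun ω => localUpTo_holds x τ le_rfl ω
  have hqω : ∀ ω, q (holds τ n ω) = pieceLocal x τ N n σ σ' ω := fun ω => by
    simp only [hq, hlN, hln]
    rfl
  have hCω : ∀ ω, holds τ n ω ∈ C ↔ (∑ v, chainLocal x τ N ω v ≤ σ ∧
      (N < n → σ < ∑ v, chainLocal x τ (N + 1) ω v)) ∧ ∑ v, chainLocal x τ n ω v ≤ σ + σ' := by
    intro ω
    simp only [hC, Set.mem_ofPred_eq, hlN, hln]
    refine and_congr_left fun _ => and_congr_right fun _ => forall_congr' fun hNn => ?_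
    rw [show loc (N + 1) (holds τ n ω) = chainLocal x τ (N + 1) ω from localUpTo_holds x τ hNn ω]
  have hcω : ∀ ω, holds τ n ω ∈ C → c (holds τ n ω) =
      realHold (chainLocal x τ n ω (x n)) (σ + σ' - ∑ v, chainLocal x τ n ω v) := by
    intro ω hω
    have := ((hCω ω).1 hω).2
    simp only [hc, hln]
    rw [max_eq_left (sub_nonneg.2 this)]
  have hset : piece X τ x N n σ σ' = holds τ n ⁻¹' C ∩
      (history X τ n x Set.univ ∩ {ω | ENNReal.ofReal (c (holds τ n ω)) < τ n ω}) := by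
    ext ω
    constructor
    · intro h
      have hmem : holds τ n ω ∈ C := (hCω ω).2 ⟨⟨h.2.le_left, h.2.lt_left⟩, h.2.le_right⟩
      refine ⟨hmem, ⟨h.2.fin, h.1, trivial⟩, ?_⟩
      rw [Set.mem_ofPred_eq, hcω ω hmem]
      exact h.2.lt_right
    · rintro ⟨hmem, hh, hlt⟩
      rw [Set.mem_ofPred_eq, hcω ω hmem] at hlt
      have := (hCω ω).1 hmem
      exact ⟨hh.2.1, hh.1, hN, this.1.1, this.1.2, this.2, hlt⟩
  have hHm := measurable_holds h.measurable_hold n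
  have key := h.lintegral_survival hW n x hcm hc0 hFm
  rw [hset, ← Measure.restrict_restrict (hHm hCm), ← lintegral_indicator (hHm hCm)]
  refine Eq.trans (lintegral_congr fun ω => ?_) (key.trans (lintegral_congr fun ω => ?_))
  · simp only [Set.indicator_apply, Set.mem_preimage, hqω]
  · simp only [Set.indicator_apply, hCω, hqω, ite_mul, zero_mul]
    split_ifs with h1
    · rw [hcω ω ((hCω ω).2 h1), show localUpTo x n (holds τ n ω) = chainLocal x τ n ω from hln ω]
      rfl
    · rfl

/-- Staying in i until time t raises only l_i, and without a jump the omitted vertex stays i: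
`expFactor_add_single` with s the time missing. -/
theorem expFactor_mul_survivalDensity (hW0 : ∀ e, e ∉ G.edgeSet → W e = 0) (i : V) (t : ℝ)
    (b : V → ℝ) : ENNReal.ofReal (survivalDensity W i t b) * ENNReal.ofReal (expFactor G W i b) =
      ENNReal.ofReal (expFactor G W i (fill i t b)) := by
  rw [mul_comm, ← ENNReal.ofReal_mul (expFactor_nonneg G W i b), fill,
    ← expFactor_add_single G W hW0 i b]
  rfl

theorem fill_add_eq (j : V) (σ σ' : ℝ) (b : V → ℝ) : fill j (σ + σ') b =
    fill j σ b + Pi.single j σ' := by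
  rw [fill, fill, add_assoc, ← Pi.single_add]
  congr 2
  ring

theorem fill_sum_add (j r : V) (σ σ' : ℝ) (a l' : V → ℝ) : fill r (σ + σ') (fill j σ a + l') =
    fill j σ a + fill r σ' l' := by
  have : ∑ v, (fill j σ a + l') v = σ + ∑ v, l' v := by
    simp only [Pi.add_apply, Finset.sum_add_distrib, sum_fill]
  rw [fill, this, add_assoc, fill]
  congr 3
  ring

/-- The local times of the two periods are independent under the occupation measures, and
`expFactor` of their sum is the only coupling. Survival of the last hold supplies what `expFactor`
needs to pass to the filled local times. -/
theorem IsJumpChain.lintegral_piece [IsProbabilityMeasure P] (h : IsJumpChain W P X τ)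
    (hW : ∀ e, 0 ≤ W e) (hW0 : ∀ e, e ∉ G.edgeSet → W e = 0) (x : ℕ → V)
    (hx : ∀ᵐ ω ∂P, X 0 ω = x 0) (N M : ℕ) {σ σ' : ℝ} (hσ' : 0 ≤ σ')
    {g : (V → ℝ) × (V → ℝ) → ℝ≥0∞} (hg : Measurable g) :
    ∫⁻ ω in piece X τ x N (N + M) σ σ', g (pieceLocal x τ N (N + M) σ σ' ω) ∂P =
      ENNReal.ofReal (weightProd W x (N + M)) *
        ∫⁻ l, (if ∑ v, l v ≤ σ then ∫⁻ l', (if ∑ v, l' v ≤ σ' then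
          g (fill (x N) σ l, fill (x (N + M)) σ' l') * ENNReal.ofReal
            (expFactor G W (x (N + M)) (fill (x N) σ l + fill (x (N + M)) σ' l')) else 0)
          ∂occupation (visits x N M) else 0) ∂occupation (visits x 0 N) := by
  rw [h.lintegral_piece_eq hW x (Nat.le_add_right N M) σ σ' hg]
  cases M with
  | zero =>
    -- Without a jump in the second period one hold contains both σ and σ + σ'. The second
    -- occupation is the Dirac mass at 0, and `fill` supplies all of σ' at x N.
    have hf : Measurable fun b : V → ℝ => if ∑ v, b v ≤ σ then
        g (fill (x N) σ b, Pi.single (x N) σ') *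
          ENNReal.ofReal (survivalDensity W (x N) (σ + σ') b) else 0 :=
      Measurable.ite (measurableSet_le measurable_sum_coord measurable_const)
        ((hg.comp ((measurable_fill _ _).prodMk measurable_const)).mul
          (measurable_survivalDensity _ _ _).ennreal_ofReal) measurable_const
    refine Eq.trans (lintegral_congr fun ω => ?_)
      ((h.lintegral_chainLocal hW hW0 x hx N hf).trans ?_)
    · simp only [add_zero, lt_irrefl, false_imp_iff, and_true, pieceLocal]
      by_cases hc : ∑ v, chainLocal x τ N ω v ≤ σ
      · rw [if_pos ⟨hc, by linarith⟩, if_pos hc, fill_add_eq, add_sub_cancel_left]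
      · rw [if_neg fun h => hc h.1, if_neg hc]
    · congr 1
      refine lintegral_congr fun b => ?_
      have hm : Measurable fun l' : V → ℝ => if ∑ v, l' v ≤ σ' then
          g (fill (x N) σ b, fill (x (N + 0)) σ' l') * ENNReal.ofReal
            (expFactor G W (x (N + 0)) (fill (x N) σ b + fill (x (N + 0)) σ' l')) else 0 :=
        Measurable.ite (measurableSet_le measurable_sum_coord measurable_const)
          ((hg.comp (measurable_const.prodMk (measurable_fill _ _))).mul
            ((measurable_expFactor G W _).comp
              ((measurable_fill _ _).const_add _)).ennreal_ofReal) measurable_const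
      rw [show visits x N 0 = 0 from rfl, occupation_zero, lintegral_dirac' _ hm, ite_mul, zero_mul,
        mul_assoc, expFactor_mul_survivalDensity hW0]
      have h0 : fill (x N) σ' 0 = Pi.single (x N) σ' := by simp [fill]
      simp only [add_zero, h0, fill_add_eq]
      simp [hσ']
  | succ M =>
    have hn : N + (M + 1) = N + 1 + M := by omega
    rw [hn, add_comm M 1]
    set n := N + 1 + M with hn'
    have hfm : Measurable fun p : (V → ℝ) × (V → ℝ) => fill (x N) σ p.1 + p.2 :=
      ((measurable_fill _ _).comp measurable_fst).add measurable_snd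
    have hf : Measurable fun p : (V → ℝ) × (V → ℝ) => if ∑ v, p.2 v ≤ σ' then
        g (fill (x N) σ p.1, fill (x n) σ' p.2) *
          ENNReal.ofReal (survivalDensity W (x n) (σ + σ') (fill (x N) σ p.1 + p.2)) else 0 :=
      Measurable.ite (measurableSet_le (measurable_sum_coord.comp measurable_snd) measurable_const)
        ((hg.comp (((measurable_fill _ _).comp measurable_fst).prodMk
          ((measurable_fill _ _).comp measurable_snd))).mul
          ((measurable_survivalDensity _ _ _).comp hfm).ennreal_ofReal) measurable_const
    refine Eq.trans (lintegral_congr fun ω => ?_)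
      ((h.lintegral_chainLocal_pair hW hW0 x hx σ N M hf).trans ?_)
    · have hsum : ∑ v, (chainLocal x τ n ω - fill (x N) σ (chainLocal x τ N ω)) v =
          ∑ v, chainLocal x τ n ω v - σ := by
        simp only [Pi.sub_apply, Finset.sum_sub_distrib, sum_fill]
      have hfill := fill_sum_add (x N) (x n) σ σ' (chainLocal x τ N ω)
        (chainLocal x τ n ω - fill (x N) σ (chainLocal x τ N ω))
      rw [add_sub_cancel] at hfill
      simp only [← hn', hsum, show N < n by omega, true_imp_iff, pieceLocal, hfill, add_sub_cancel,
        add_sub_cancel_left, sub_le_iff_le_add']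
      rw [ite_and]
    · congr 1
      refine lintegral_congr fun l => ?_
      congr 1
      refine lintegral_congr fun l' => ?_
      rw [ite_mul, zero_mul, mul_assoc, expFactor_mul_survivalDensity hW0, fill_sum_add]

end PieceFormula

/-! ### Summation over walks and the factor 𝒫 -/

section WalkFormula

variable {V : Type*} [Fintype V] [DecidableEq V] {G : SimpleGraph V} [DecidableRel G.Adj]

theorem visits_congr {x x' : ℕ → V} {a a' n : ℕ} (h : ∀ m < n, x (a + m) = x' (a' + m)) :
    visits x a n = visits x' a' n :=
  Finset.sum_congr rfl fun m hm => by rw [h m (Finset.mem_range.1 hm)]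

theorem visits_vertexSeq {i j : V} {d : List G.Dart} (h : IsTrail i d j) :
    visits (vertexSeq i d) 0 d.length = outFlow (crossCount d) := by
  induction d generalizing i with
  | nil =>
    ext v
    simp [visits, crossCount_nil, outFlow]
  | cons e d ih =>
    have h1 := ih h.2
    ext v
    have h2 := congrFun h1 v
    rw [crossCount_cons, outFlow_add_single, ← h2, h.1]
    simp only [visits, List.length_cons, Finset.sum_range_succ', zero_add, Pi.add_apply,
      vertexSeq, Pi.single_apply, eq_comm]

theorem visits_append_left {i j : V} {d d' : List G.Dart} (h : IsTrail i d j) :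
    visits (vertexSeq i (d ++ d')) 0 d.length = outFlow (crossCount d) := by
  rw [← visits_vertexSeq h]
  refine visits_congr fun m hm => ?_
  rw [zero_add]
  exact vertexSeq_append_left hm

theorem visits_append_right {i j r : V} {d d' : List G.Dart} (h : IsTrail i d j)
    (h' : IsTrail j d' r) :
    visits (vertexSeq i (d ++ d')) d.length d'.length = outFlow (crossCount d') := by
  rw [← visits_vertexSeq h']
  refine visits_congr fun m hm => ?_
  rw [zero_add]
  exact h.vertexSeq_append_right m

/-- The product of the halved weights of all crossings. -/
def crossWeight (W : Sym2 V → ℝ) (κ : G.Dart → ℕ) : ℝ := ∏ e : G.Dart, (W e.edge / 2) ^ κ e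

theorem crossWeight_nonneg {W : Sym2 V → ℝ} (hW : ∀ e, 0 ≤ W e) (κ : G.Dart → ℕ) :
    0 ≤ crossWeight W κ :=
  Finset.prod_nonneg fun _ _ => pow_nonneg (div_nonneg (hW _) zero_le_two) _

theorem crossWeight_add (W : Sym2 V → ℝ) (κ κ' : G.Dart → ℕ) :
    crossWeight W (κ + κ') = crossWeight W κ * crossWeight W κ' := by
  simp only [crossWeight, Pi.add_apply, pow_add, Finset.prod_mul_distrib]

theorem weightProd_vertexSeq (W : Sym2 V → ℝ) {i j : V} {d : List G.Dart} (h : IsTrail i d j) :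
    weightProd W (vertexSeq i d) d.length = crossWeight W (crossCount d) := by
  induction d generalizing i with
  | nil => simp [weightProd, crossWeight, crossCount_nil]
  | cons e d ih =>
    have h1 : crossWeight W (Pi.single e 1) = W e.edge / 2 := by
      rw [crossWeight, Finset.prod_eq_single e]
      · simp
      · intro f _ hf
        simp [hf]
      · simp
    have h2 : s(vertexSeq i (e :: d) 0, vertexSeq i (e :: d) (0 + 1)) = e.edge := by
      change s(i, vertexSeq e.snd d 0) = _
      rw [vertexSeq_zero, ← h.1]
      rfl
    rw [crossCount_cons, crossWeight_add, h1, ← ih h.2, weightProd, List.length_cons,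
      Finset.prod_range_succ', h2]
    rfl

theorem prod_pow_fst (κ : G.Dart → ℕ) (l : V → ℝ) :
    ∏ e : G.Dart, l e.fst ^ κ e = ∏ v, l v ^ outFlow κ v := by
  rw [← Finset.prod_fiberwise Finset.univ (fun e : G.Dart => e.fst)]
  refine Finset.prod_congr rfl fun v _ => ?_
  rw [outFlow, ← Finset.prod_pow_eq_pow_sum]
  exact Finset.prod_congr rfl fun e he => by rw [(Finset.mem_filter.1 he).2]

theorem IsTreeTowards.prod_fst {j : V} {T : Finset G.Dart} (hT : IsTreeTowards j T) (l : V → ℝ) :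
    ∏ e ∈ T, l e.fst = ∏ v ∈ Finset.univ.erase j, l v := by
  refine Finset.prod_bij (fun e _ => e.fst) (fun e he => by simpa using hT.no_exit e he)
    (fun e he f hf h => hT.eq_of_fst_eq he hf h) (fun v hv => ?_) fun _ _ => rfl
  obtain ⟨e, ⟨he, hv⟩, -⟩ := hT.exit v (Finset.ne_of_mem_erase hv)
  exact ⟨e, he, hv⟩

/-- The factorials of the outflows cancel between the number of walks and the occupation density.
The exponents outFlow − 1 at the vertices other than j leave ∏ 1/l_v, which is distributed over the
tree edges by their tails. -/
theorem card_treeWalks_mul_density (W : Sym2 V → ℝ) {T : Finset G.Dart} {i j : V}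
    (hT : IsTreeTowards j T) {κ : G.Dart → ℕ} (hκ : Kirchhoff κ i j) (hpos : ∀ e ∈ T, 0 < κ e)
    {l : V → ℝ} (hl : ∀ v, 0 < l v) :
    (treeWalks T i j κ).card * (crossWeight W κ * occupationDensity (outFlow κ) j l) =
      pathFactor W κ l T := by
  have hcard : ((treeWalks T i j κ).card : ℝ) * ∏ e, ((κ e).factorial : ℝ) =
      (∏ e ∈ T, (κ e : ℝ)) * ((∏ v ∈ Finset.univ.erase j, ((outFlow κ v - 1).factorial : ℝ)) *
        ((outFlow κ j).factorial : ℝ)) := by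
    exact_mod_cast card_treeWalks_mul hT hκ
  have h1 : ∏ e, ((κ e).factorial : ℝ) ≠ 0 := Finset.prod_ne_zero_iff.2 fun e _ => by positivity
  have h2 : ∏ v ∈ Finset.univ.erase j, ((outFlow κ v - 1).factorial : ℝ) ≠ 0 :=
    Finset.prod_ne_zero_iff.2 fun e _ => by positivity
  have h3 : ∏ v ∈ Finset.univ.erase j, l v ≠ 0 :=
    Finset.prod_ne_zero_iff.2 fun v _ => (hl v).ne'
  have h4 : ((outFlow κ j).factorial : ℝ) ≠ 0 := by positivity
  have hpow : ∏ v ∈ Finset.univ.erase j, l v ^ outFlow κ v =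
      (∏ v ∈ Finset.univ.erase j, l v ^ (outFlow κ v - 1)) * ∏ v ∈ Finset.univ.erase j, l v := by
    rw [← Finset.prod_mul_distrib]
    refine Finset.prod_congr rfl fun v hv => ?_
    rw [← pow_succ, Nat.sub_add_cancel
      (outFlow_pos_of_forall_mem hT hpos (Finset.ne_of_mem_erase hv))]
  have hpath : pathFactor W κ l T = crossWeight W κ *
      ((∏ v ∈ Finset.univ.erase j, l v ^ outFlow κ v) * l j ^ outFlow κ j) /
        (∏ e, ((κ e).factorial : ℝ)) * ((∏ e ∈ T, (κ e : ℝ)) / ∏ v ∈ Finset.univ.erase j, l v) := by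
    rw [pathFactor, Finset.prod_div_distrib, hT.prod_fst,
      Finset.prod_erase_mul _ _ (Finset.mem_univ j), ← prod_pow_fst, crossWeight]
    congr 1
    rw [← Finset.prod_mul_distrib, ← Finset.prod_div_distrib]
    refine Finset.prod_congr rfl fun e _ => ?_
    rw [← mul_pow, mul_one_div]
    congr 2
    ring
  rw [hpath, hpow, occupationDensity, Finset.prod_div_distrib]
  field_simp
  linear_combination (crossWeight W κ * (∏ v ∈ Finset.univ.erase j, l v ^ (outFlow κ v - 1)) *
    l j ^ outFlow κ j) * hcard

theorem pathFactor_eq_zero (W : Sym2 V → ℝ) {T : Finset G.Dart} {κ : G.Dart → ℕ}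
    (h : ¬ ∀ e ∈ T, 0 < κ e) (l : V → ℝ) : pathFactor W κ l T = 0 := by
  push Not at h
  obtain ⟨e, he, h0⟩ := h
  rw [pathFactor, Finset.prod_eq_zero (s := T) he (by rw [Nat.le_zero.1 h0]; simp), mul_zero]

instance (i : V) (σ : ℝ) : SFinite (hyperplaneMeasure i σ) := by
  unfold hyperplaneMeasure
  infer_instance

variable {Ω : Type*} [MeasurableSpace Ω] {W : Sym2 V → ℝ} {P : Measure Ω} {X : ℕ → Ω → V}
  {τ : ℕ → Ω → ℝ≥0∞}

/-- Both occupation integrals become hyperplane integrals by `lintegral_occupation_fill`, the inner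
one at fixed first local times. The result sees the walks only through their crossing numbers. -/
theorem IsJumpChain.lintegral_walkPiece [IsProbabilityMeasure P] (h : IsJumpChain W P X τ)
    (hW : ∀ e, 0 ≤ W e) (hW0 : ∀ e, e ∉ G.edgeSet → W e = 0) {i₀ : V}
    (hX0 : ∀ᵐ ω ∂P, X 0 ω = i₀) {j r : V} {d d' : List G.Dart} (hd : IsTrail i₀ d j)
    (hd' : IsTrail j d' r) (hc : ∀ v, v ≠ j → 0 < outFlow (crossCount d) v)
    (hc' : ∀ v, v ≠ r → 0 < outFlow (crossCount d') v) {σ σ' : ℝ} (hσ' : 0 ≤ σ')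
    {g : (V → ℝ) × (V → ℝ) → ℝ≥0∞} (hg : Measurable g)
    (hsupp : ∀ p, p ∉ simplex V σ ×ˢ simplex V σ' → g p = 0) :
    ∫⁻ ω in piece X τ (vertexSeq i₀ (d ++ d')) d.length (d.length + d'.length) σ σ',
        g (pieceLocal (vertexSeq i₀ (d ++ d')) τ d.length (d.length + d'.length) σ σ' ω) ∂P =
      ∫⁻ p, g p * ENNReal.ofReal (expFactor G W r (fun v => p.1 v + p.2 v)) *
        ENNReal.ofReal (crossWeight W (crossCount d) *
          occupationDensity (outFlow (crossCount d)) j p.1) *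
        ENNReal.ofReal (crossWeight W (crossCount d') *
          occupationDensity (outFlow (crossCount d')) r p.2)
        ∂((hyperplaneMeasure i₀ σ).prod (hyperplaneMeasure i₀ σ')) := by
  set x := vertexSeq i₀ (d ++ d') with hx
  set c := outFlow (crossCount d) with hcd
  set c' := outFlow (crossCount d') with hcd'
  have hxj : x d.length = j := by rw [hx, hd.vertexSeq_append_le le_rfl, hd.vertexSeq_length]
  have hxr : x (d.length + d'.length) = r := by
    rw [hx, hd.vertexSeq_append_right, hd'.vertexSeq_length]
  have hX0' : ∀ᵐ ω ∂P, X 0 ω = x 0 := by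
    rw [hx, vertexSeq_zero]
    exact hX0
  have hw : weightProd W x (d.length + d'.length) =
      crossWeight W (crossCount d) * crossWeight W (crossCount d') := by
    rw [← crossWeight_add, show crossCount d + crossCount d' = crossCount (d ++ d') from
        funext fun e => (crossCount_append ..).symm, ← weightProd_vertexSeq W (hd.append hd'),
      List.length_append]
  rw [h.lintegral_piece hW hW0 x hX0' d.length d'.length hσ' hg, hxj, hxr, hw,
    visits_append_left hd, visits_append_right hd hd', ← hcd, ← hcd']
  set q : (V → ℝ) × (V → ℝ) → ℝ≥0∞ := fun p => g p *
    ENNReal.ofReal (expFactor G W r (p.1 + p.2)) with hq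
  have hqm : Measurable q := hg.mul ((measurable_expFactor G W r).comp
    (measurable_fst.add measurable_snd)).ennreal_ofReal
  have hq0 : ∀ p, p ∉ simplex V σ ×ˢ simplex V σ' → q p = 0 := fun p hp => by
    simp only [hq, hsupp p hp, zero_mul]
  have hdm := (measurable_occupationDensity c j).ennreal_ofReal
  have hdm' := (measurable_occupationDensity c' r).ennreal_ofReal
  have hqdm : Measurable fun p : (V → ℝ) × (V → ℝ) =>
      q p * ENNReal.ofReal (occupationDensity c' r p.2) := hqm.mul (hdm'.comp measurable_snd)
  set H : (V → ℝ) → ℝ≥0∞ := fun a => ∫⁻ b, q (a, b) * ENNReal.ofReal (occupationDensity c' r b)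
    ∂hyperplaneMeasure i₀ σ' with hH
  have hHm : Measurable H := hqdm.lintegral_prod_right'
  have hinner : ∀ a, ∫⁻ l', (if ∑ v, l' v ≤ σ' then q (a, fill r σ' l') else 0) ∂occupation c' =
      H a := fun a =>
    lintegral_occupation_fill hc' i₀ σ' (hqm.comp (measurable_const.prodMk measurable_id))
      fun b hb => hq0 _ fun h => hb h.2
  have houter : ∫⁻ l, (if ∑ v, l v ≤ σ then H (fill j σ l) else 0) ∂occupation c =
      ∫⁻ a, H a * ENNReal.ofReal (occupationDensity c j a) ∂hyperplaneMeasure i₀ σ := by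
    refine lintegral_occupation_fill hc i₀ σ hHm fun a ha => ?_
    simp only [hH, hq0 (a, _) fun h => ha h.1, zero_mul, lintegral_zero]
  change _ * ∫⁻ l, (if ∑ v, l v ≤ σ then ∫⁻ l', (if ∑ v, l' v ≤ σ' then
    q (fill j σ l, fill r σ' l') else 0) ∂occupation c' else 0) ∂occupation c = _
  simp_rw [hinner]
  have hfm : Measurable fun p : (V → ℝ) × (V → ℝ) =>
      q p * ENNReal.ofReal (occupationDensity c' r p.2) *
        ENNReal.ofReal (occupationDensity c j p.1) := hqdm.mul (hdm.comp measurable_fst)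
  have hfub : ∫⁻ a, H a * ENNReal.ofReal (occupationDensity c j a) ∂hyperplaneMeasure i₀ σ =
      ∫⁻ p, q p * ENNReal.ofReal (occupationDensity c' r p.2) *
        ENNReal.ofReal (occupationDensity c j p.1)
        ∂((hyperplaneMeasure i₀ σ).prod (hyperplaneMeasure i₀ σ')) := by
    rw [lintegral_prod _ hfm.aemeasurable]
    refine lintegral_congr fun a => ?_
    exact (lintegral_mul_const _ (hqdm.comp (measurable_const.prodMk measurable_id))).symm
  rw [houter, hfub, ← lintegral_const_mul _ hfm]
  refine lintegral_congr fun p => ?_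
  rw [ENNReal.ofReal_mul (crossWeight_nonneg hW _), ENNReal.ofReal_mul (crossWeight_nonneg hW _),
    ENNReal.ofReal_mul (crossWeight_nonneg hW _)]
  change _ = q p * _ * _
  ring

theorem treeWalks_eq_empty_of_not_kirchhoff {T : Finset G.Dart} {i j : V}
    (hT : IsTreeTowards j T) {κ : G.Dart → ℕ} (h : ¬ Kirchhoff κ i j) : treeWalks T i j κ = ∅ :=
  Finset.eq_empty_of_forall_notMem fun d hd => by
    obtain ⟨h1, h2, -⟩ := (mem_treeWalks hT).1 hd
    exact h (h2 ▸ h1.kirchhoff)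

open Classical in
/-- The factor `𝒫(k, l, T)` for crossing numbers that satisfy Kirchhoff's rule, and zero for all
others. -/
def currentWeight (W : Sym2 V → ℝ) (i j : V) (T : Finset G.Dart) (κ : G.Dart → ℕ) (l : V → ℝ) :
    ℝ≥0∞ :=
  if Kirchhoff κ i j then ENNReal.ofReal (pathFactor W κ l T) else 0

theorem measurable_currentWeight (W : Sym2 V → ℝ) (i j : V) (T : Finset G.Dart) (κ : G.Dart → ℕ) :
    Measurable (currentWeight W i j T κ) := by
  unfold currentWeight
  split_ifs
  · unfold pathFactor
    fun_prop
  · fun_prop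

theorem card_treeWalks_mul_ofReal (W : Sym2 V → ℝ) {T : Finset G.Dart} {i j : V}
    (hT : IsTreeTowards j T) {κ : G.Dart → ℕ} {l : V → ℝ} (hl : ∀ v, 0 < l v) :
    ((treeWalks T i j κ).card : ℝ≥0∞) *
        ENNReal.ofReal (crossWeight W κ * occupationDensity (outFlow κ) j l) =
      currentWeight W i j T κ l := by
  unfold currentWeight
  split_ifs with hκ
  · by_cases hpos : ∀ e ∈ T, 0 < κ e
    · rw [← card_treeWalks_mul_density W hT hκ hpos hl, ENNReal.ofReal_mul (Nat.cast_nonneg _),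
        ENNReal.ofReal_natCast]
    · rw [pathFactor_eq_zero W hpos, treeWalks, if_neg hpos]
      simp
  · rw [treeWalks_eq_empty_of_not_kirchhoff hT hκ]
    simp

/-- All terms of the sum are equal, so it is a product of two numbers of walks with one integral;
each number completes the factor of its period to `currentWeight`. -/
theorem IsJumpChain.sum_lintegral_walkPiece [IsProbabilityMeasure P] (h : IsJumpChain W P X τ)
    (hW : ∀ e, 0 ≤ W e) (hW0 : ∀ e, e ∉ G.edgeSet → W e = 0) {i₀ : V}
    (hX0 : ∀ᵐ ω ∂P, X 0 ω = i₀) {j r : V} {T T' : Finset G.Dart} (hT : IsTreeTowards j T)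
    (hT' : IsTreeTowards r T') (κ κ' : G.Dart → ℕ) {σ σ' : ℝ} (hσ' : 0 ≤ σ')
    {g : (V → ℝ) × (V → ℝ) → ℝ≥0∞} (hg : Measurable g)
    (hsupp : ∀ p, p ∉ simplex V σ ×ˢ simplex V σ' → g p = 0) :
    ∑ q ∈ treeWalks T i₀ j κ ×ˢ treeWalks T' j r κ',
      ∫⁻ ω in piece X τ (vertexSeq i₀ (q.1 ++ q.2)) q.1.length (q.1.length + q.2.length) σ σ',
        g (pieceLocal (vertexSeq i₀ (q.1 ++ q.2)) τ q.1.length (q.1.length + q.2.length) σ σ' ω)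
          ∂P =
      ∫⁻ p, g p * ENNReal.ofReal (expFactor G W r (fun v => p.1 v + p.2 v)) *
        currentWeight W i₀ j T κ p.1 * currentWeight W j r T' κ' p.2
        ∂((hyperplaneMeasure i₀ σ).prod (hyperplaneMeasure i₀ σ')) := by
  have hterm : ∀ q ∈ treeWalks T i₀ j κ ×ˢ treeWalks T' j r κ', ∫⁻ ω in piece X τ
      (vertexSeq i₀ (q.1 ++ q.2)) q.1.length (q.1.length + q.2.length) σ σ',
        g (pieceLocal (vertexSeq i₀ (q.1 ++ q.2)) τ q.1.length (q.1.length + q.2.length) σ σ' ω)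
          ∂P = ∫⁻ p, g p * ENNReal.ofReal (expFactor G W r (fun v => p.1 v + p.2 v)) *
        ENNReal.ofReal (crossWeight W κ * occupationDensity (outFlow κ) j p.1) *
        ENNReal.ofReal (crossWeight W κ' * occupationDensity (outFlow κ') r p.2)
        ∂((hyperplaneMeasure i₀ σ).prod (hyperplaneMeasure i₀ σ')) := by
    intro q hq
    obtain ⟨hq1, hq2⟩ := Finset.mem_product.1 hq
    have hpos : ∀ {T : Finset G.Dart} {i j : V} {κ : G.Dart → ℕ} {d : List G.Dart},
        IsTreeTowards j T → d ∈ treeWalks T i j κ → ∀ v, v ≠ j → 0 < outFlow (crossCount d) v := by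
      intro T i j κ d hT hd v hv
      obtain ⟨e, ⟨he, rfl⟩, -⟩ := hT.exit v hv
      rw [← Finset.mem_coe, ← ((mem_treeWalks hT).1 hd).2.2] at he
      exact outFlow_crossCount_pos_iff.2 ⟨e, he.2.mem, rfl⟩
    obtain ⟨h1, h2, -⟩ := (mem_treeWalks hT).1 hq1
    obtain ⟨h1', h2', -⟩ := (mem_treeWalks hT').1 hq2
    rw [h.lintegral_walkPiece hW hW0 hX0 h1 h1' (hpos hT hq1) (hpos hT' hq2) hσ' hg hsupp, h2, h2']
  rw [Finset.sum_congr rfl hterm, Finset.sum_const, Finset.card_product, nsmul_eq_mul,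
    Nat.cast_mul]
  have hmm : ∀ (κ : G.Dart → ℕ) (j : V), Measurable fun l : V → ℝ =>
      ENNReal.ofReal (crossWeight W κ * occupationDensity (outFlow κ) j l) := fun κ j =>
    ((measurable_occupationDensity _ _).const_mul _).ennreal_ofReal
  have hm : Measurable fun p : (V → ℝ) × (V → ℝ) =>
      g p * ENNReal.ofReal (expFactor G W r (fun v => p.1 v + p.2 v)) *
        ENNReal.ofReal (crossWeight W κ * occupationDensity (outFlow κ) j p.1) *
        ENNReal.ofReal (crossWeight W κ' * occupationDensity (outFlow κ') r p.2) :=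
    ((hg.mul ((measurable_expFactor G W r).comp
      (measurable_fst.add measurable_snd)).ennreal_ofReal).mul
        ((hmm κ j).comp measurable_fst)).mul ((hmm κ' r).comp measurable_snd)
  rw [← lintegral_const_mul _ hm]
  refine lintegral_congr fun p => ?_
  by_cases hp : p ∈ simplex V σ ×ˢ simplex V σ'
  · rw [← card_treeWalks_mul_ofReal W hT hp.1.1, ← card_treeWalks_mul_ofReal W hT' hp.2.1]
    ring
  · rw [hsupp p hp]
    simp

end WalkFormula

/-! ### The oriented random current model in terms of the factor 𝒫 -/

section RandomCurrents

variable {V : Type*} [Fintype V] [DecidableEq V] {G : SimpleGraph V} [DecidableRel G.Adj]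
  {W : Sym2 V → ℝ}

/-- The product of the Poisson laws before conditioning in the oriented random current model. -/
def poissonCurrent (W : Sym2 V → ℝ) (l : V → ℝ) : Measure (G.Dart → ℕ) :=
  Measure.pi fun e : G.Dart => poissonMeasure (W e.edge * l e.fst / 2).toNNReal

instance (l : V → ℝ) : IsProbabilityMeasure (poissonCurrent W l : Measure (G.Dart → ℕ)) := by
  unfold poissonCurrent
  infer_instance

theorem poissonCurrent_singleton (hW : ∀ e, 0 ≤ W e) {l : V → ℝ} (hl : ∀ v, 0 < l v)
    (m : G.Dart → ℕ) : poissonCurrent W l {m} = ENNReal.ofReal (∏ e : G.Dart,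
      (Real.exp (-(W e.edge * l e.fst / 2)) * (W e.edge * l e.fst / 2) ^ m e /
        (m e).factorial)) := by
  have h0 : ∀ e : G.Dart, 0 ≤ W e.edge * l e.fst / 2 := fun e =>
    div_nonneg (mul_nonneg (hW _) (hl _).le) zero_le_two
  rw [← Set.univ_pi_singleton, poissonCurrent, Measure.pi_pi,
    ENNReal.ofReal_prod_of_nonneg fun e _ => by have := h0 e; positivity]
  refine Finset.prod_congr rfl fun e _ => ?_
  rw [poissonMeasure_singleton, Real.coe_toNNReal _ (h0 e)]

/-- The normalization between the Poisson weights and the path factors. -/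
def currentConst (W : Sym2 V → ℝ) (l : V → ℝ) (T : Finset G.Dart) : ℝ :=
  (∏ e : G.Dart, Real.exp (-(W e.edge * l e.fst / 2))) / ∏ e ∈ T, (W e.edge / 2)

theorem currentConst_pos (hWpos : ∀ e ∈ G.edgeSet, 0 < W e) (l : V → ℝ) (T : Finset G.Dart) :
    0 < currentConst W l T :=
  div_pos (Finset.prod_pos fun _ _ => Real.exp_pos _)
    (Finset.prod_pos fun e _ => half_pos (hWpos _ e.edge_mem))

theorem pathFactor_nonneg (hW : ∀ e, 0 ≤ W e) {l : V → ℝ} (hl : ∀ v, 0 < l v) (κ : G.Dart → ℕ)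
    (T : Finset G.Dart) : 0 ≤ pathFactor W κ l T := by
  refine mul_nonneg (Finset.prod_nonneg fun e _ => ?_) (Finset.prod_nonneg fun e _ => ?_)
  · have := hW e.edge
    have := (hl e.fst).le
    positivity
  · have := (hl e.fst).le
    positivity

/-- On a tree edge the count m + 1 gives (m + 1)/(m + 1)! = 1/m!, and the surplus factor (W l/2) ·
(1/l) = W/2 does not depend on m, so it goes into `currentConst`. -/
theorem poissonWeight_addTree (hWpos : ∀ e ∈ G.edgeSet, 0 < W e) {l : V → ℝ} (hl : ∀ v, 0 < l v)
    (T : Finset G.Dart) (m : G.Dart → ℕ) :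
    ∏ e : G.Dart, (Real.exp (-(W e.edge * l e.fst / 2)) * (W e.edge * l e.fst / 2) ^ m e /
        (m e).factorial) = currentConst W l T * pathFactor W (addTree T m) l T := by
  have h1 : ∏ e ∈ T, (W e.edge / 2) ≠ 0 :=
    Finset.prod_ne_zero_iff.2 fun e _ => (half_pos (hWpos _ e.edge_mem)).ne'
  have h2 : ∀ f : G.Dart → ℝ, ∏ e ∈ T, f e = ∏ e, if e ∈ T then f e else 1 := fun f => by
    rw [Finset.prod_ite_mem, Finset.univ_inter]
  rw [currentConst, div_mul_eq_mul_div, eq_div_iff h1, pathFactor, h2, h2,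
    ← Finset.prod_mul_distrib, ← Finset.prod_mul_distrib, ← Finset.prod_mul_distrib]
  refine Finset.prod_congr rfl fun e _ => ?_
  have h3 := (hl e.fst).ne'
  have h4 : ((m e).factorial : ℝ) ≠ 0 := by positivity
  have h5 : (m e : ℝ) + 1 ≠ 0 := by positivity
  by_cases he : e ∈ T
  · simp only [addTree, he, if_true, Nat.factorial_succ, pow_succ]
    push_cast
    field_simp
  · simp only [addTree, he, if_false, add_zero, mul_one]
    ring

theorem exists_addTree_eq {T : Finset G.Dart} {κ : G.Dart → ℕ} (h : ∀ e ∈ T, 0 < κ e) :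
    ∃ m, addTree T m = κ := by
  refine ⟨fun e => κ e - if e ∈ T then 1 else 0, funext fun e => ?_⟩
  by_cases he : e ∈ T
  · simp only [addTree, he, if_true]
    have := h e he
    omega
  · simp [addTree, he]

theorem addTree_injective (T : Finset G.Dart) : Function.Injective (addTree T) := fun _ _ h =>
  funext fun e => Nat.add_right_cancel (congrFun h e)

theorem poissonCurrent_preimage (hW : ∀ e, 0 ≤ W e) (hWpos : ∀ e ∈ G.edgeSet, 0 < W e)
    {l : V → ℝ} (hl : ∀ v, 0 < l v) (i j : V) (T : Finset G.Dart) (κ : G.Dart → ℕ) :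
    poissonCurrent W l ({m | (fun e => (addTree T m e : ℤ)) ∈ currents G i j} ∩
        addTree T ⁻¹' {κ}) =
      ENNReal.ofReal (currentConst W l T) * currentWeight W i j T κ l := by
  unfold currentWeight
  split_ifs with hκ
  · by_cases hpos : ∀ e ∈ T, 0 < κ e
    · obtain ⟨m, rfl⟩ := exists_addTree_eq hpos
      have hset : {m | (fun e => (addTree T m e : ℤ)) ∈ currents G i j} ∩
          addTree T ⁻¹' {addTree T m} = {m} := by
        ext m'
        constructor
        · exact fun h => addTree_injective T h.2
        · rintro rfl
          exact ⟨mem_currents_iff.2 hκ, rfl⟩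
      rw [hset, poissonCurrent_singleton hW hl, poissonWeight_addTree hWpos hl T m,
        ENNReal.ofReal_mul (currentConst_pos hWpos l T).le]
    · rw [pathFactor_eq_zero W hpos, ENNReal.ofReal_zero, mul_zero]
      convert measure_empty (μ := (poissonCurrent W l : Measure (G.Dart → ℕ)))
      refine Set.eq_empty_of_forall_notMem fun m hm => hpos fun e he => ?_
      rw [← show addTree T m = κ from hm.2]
      simp [addTree, he]
  · rw [mul_zero]
    convert measure_empty (μ := (poissonCurrent W l : Measure (G.Dart → ℕ)))
    refine Set.eq_empty_of_forall_notMem fun m hm => hκ ?_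
    rw [← show addTree T m = κ from hm.2]
    exact mem_currents_iff.1 hm.1

theorem poissonCurrent_currents (hW : ∀ e, 0 ≤ W e) (hWpos : ∀ e ∈ G.edgeSet, 0 < W e)
    {l : V → ℝ} (hl : ∀ v, 0 < l v) (i j : V) (T : Finset G.Dart) :
    poissonCurrent W l {m | (fun e => (addTree T m e : ℤ)) ∈ currents G i j} =
      ENNReal.ofReal (currentConst W l T) * ∑' κ, currentWeight W i j T κ l := by
  rw [← ENNReal.tsum_mul_left]
  simp_rw [← poissonCurrent_preimage hW hWpos hl i j T]
  rw [← measure_iUnion]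
  · congr 1
    ext m
    simp
  · intro κ κ' hne
    rw [Function.onFun, Set.disjoint_left]
    rintro m ⟨-, h⟩ ⟨-, h'⟩
    exact hne (h.symm.trans h')
  · exact fun κ => MeasurableSet.of_discrete

theorem orientedCurrent_singleton (hW : ∀ e, 0 ≤ W e) (hWpos : ∀ e ∈ G.edgeSet, 0 < W e)
    {l : V → ℝ} (hl : ∀ v, 0 < l v) (i j : V) (T : Finset G.Dart) (κ : G.Dart → ℕ) :
    orientedCurrent W i j l T {κ} =
      currentWeight W i j T κ l / ∑' κ', currentWeight W i j T κ' l := by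
  have hC := currentConst_pos hWpos l T
  have hm : Measurable (addTree T) := Measurable.of_discrete
  change ((ProbabilityTheory.cond (poissonCurrent W l) _).map (addTree T)) {κ} = _
  rw [Measure.map_apply hm MeasurableSet.of_discrete, cond_apply MeasurableSet.of_discrete,
    poissonCurrent_preimage hW hWpos hl, poissonCurrent_currents hW hWpos hl,
    ENNReal.mul_inv (Or.inl (ENNReal.ofReal_pos.2 hC).ne') (Or.inl ENNReal.ofReal_ne_top),
    mul_mul_mul_comm, ENNReal.inv_mul_cancel (ENNReal.ofReal_pos.2 hC).ne' ENNReal.ofReal_ne_top,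
    one_mul, mul_comm]
  rfl

/-- Up to a positive constant the sum is a probability. -/
theorem tsum_currentWeight_ne_top (hW : ∀ e, 0 ≤ W e) (hWpos : ∀ e ∈ G.edgeSet, 0 < W e)
    {l : V → ℝ} (hl : ∀ v, 0 < l v) (i j : V) (T : Finset G.Dart) :
    ∑' κ, currentWeight W i j T κ l ≠ ∞ := by
  intro h
  have h1 := poissonCurrent_currents hW hWpos hl i j T
  rw [h, ENNReal.mul_top (ENNReal.ofReal_pos.2 (currentConst_pos hWpos l T)).ne'] at h1
  exact measure_ne_top _ _ h1

/-- A vanishing sum is harmless: every single weight is then zero as well. -/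
theorem currentWeight_div_mul_tsum (hW : ∀ e, 0 ≤ W e) (hWpos : ∀ e ∈ G.edgeSet, 0 < W e)
    {l : V → ℝ} (hl : ∀ v, 0 < l v) (i j : V) (T : Finset G.Dart) (κ : G.Dart → ℕ) :
    currentWeight W i j T κ l / (∑' κ', currentWeight W i j T κ' l) *
      ∑' κ', currentWeight W i j T κ' l = currentWeight W i j T κ l := by
  by_cases h0 : ∑' κ', currentWeight W i j T κ' l = 0
  · rw [h0, mul_zero, ENNReal.tsum_eq_zero.1 h0 κ]
  · exact ENNReal.div_mul_cancel h0 (tsum_currentWeight_ne_top hW hWpos hl i j T)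

end RandomCurrents

/-! ### The events in terms of the walks followed by Z -/

section Events

variable {V : Type*} [Fintype V] [DecidableEq V] {G : SimpleGraph V} {Ω : Type*}
  {X : ℕ → Ω → V} {τ : ℕ → Ω → ℝ≥0∞} {Y : ℝ → Ω → V} {i₀ : V} {σ σ' : ℝ}

/-- The event that the time-changed process follows the walk `q.1` up to time `σ` and the walk
`q.2` from then on up to time `σ + σ'`. -/
def walkPiece (X : ℕ → Ω → V) (τ : ℕ → Ω → ℝ≥0∞) (i₀ : V) (σ σ' : ℝ)
    (q : List G.Dart × List G.Dart) : Set Ω :=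
  piece X τ (vertexSeq i₀ (q.1 ++ q.2)) q.1.length (q.1.length + q.2.length) σ σ'

/-- The local times during `[0, σ]` and `[σ, σ + σ']` in terms of the holding times along the
walks `q.1` and `q.2`. -/
def walkLocal (τ : ℕ → Ω → ℝ≥0∞) (i₀ : V) (σ σ' : ℝ) (q : List G.Dart × List G.Dart) (ω : Ω) :
    (V → ℝ) × (V → ℝ) :=
  pieceLocal (vertexSeq i₀ (q.1 ++ q.2)) τ q.1.length (q.1.length + q.2.length) σ σ' ω

theorem isStepPath_Z {ω : Ω} (hg : IsGood G (fun t => Y t ω) (fun n => X n ω) (fun n => τ n ω))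
    {q : List G.Dart × List G.Dart} (hω : ω ∈ walkPiece X τ i₀ σ σ' q) :
    IsStepPath (Z Y ω) (vertexSeq i₀ (q.1 ++ q.2))
      (clockTime (vertexSeq i₀ (q.1 ++ q.2)) fun m => (τ m ω).toReal)
      (q.1.length + q.2.length) (σ + σ') :=
  hg.isStepPath_timeChange hω.1 hω.2

theorem pathData_Z {ω : Ω} (hg : IsGood G (fun t => Y t ω) (fun n => X n ω) (fun n => τ n ω))
    {q : List G.Dart × List G.Dart} {j r : V} (hd : IsTrail i₀ q.1 j) (hd' : IsTrail j q.2 r)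
    (hσ' : 0 ≤ σ') (hω : ω ∈ walkPiece X τ i₀ σ σ' q) :
    PathData G (Z Y ω) σ (σ + σ') i₀ j r q.1 q.2 :=
  (isStepPath_Z hg hω).pathData hd hd' hω.2.le_left (le_add_of_nonneg_right hσ')
    fun h => hω.2.lt_left (Nat.lt_add_of_pos_right h)

theorem localTimes_eq {ω : Ω} (hg : IsGood G (fun t => Y t ω) (fun n => X n ω) (fun n => τ n ω))
    {q : List G.Dart × List G.Dart} (hσ' : 0 ≤ σ') (hω : ω ∈ walkPiece X τ i₀ σ σ' q) :
    (l Y σ ω, l' Y σ σ' ω) = walkLocal τ i₀ σ σ' q ω := by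
  have h := isStepPath_Z hg hω
  have hr := h.restrict (Nat.le_add_right _ _) hω.2.le_left (le_add_of_nonneg_right hσ')
    hω.2.lt_left
  have h1 := h.timeSpent_eq_fill
  have h2 := hr.timeSpent_eq_fill
  rw [localSum_clockTime fun _ _ => ENNReal.toReal_nonneg] at h1 h2
  have hl : l Y σ ω = fill (vertexSeq i₀ (q.1 ++ q.2) q.1.length) σ
      (chainLocal (vertexSeq i₀ (q.1 ++ q.2)) τ q.1.length ω) := h2
  have hl2 : l Y (σ + σ') ω = fill (vertexSeq i₀ (q.1 ++ q.2) (q.1.length + q.2.length)) (σ + σ')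
      (chainLocal (vertexSeq i₀ (q.1 ++ q.2)) τ (q.1.length + q.2.length) ω) := h1
  refine Prod.ext hl ?_
  change l Y (σ + σ') ω - l Y σ ω = _
  rw [hl, hl2]
  rfl

theorem exists_walkPiece {ω : Ω} (hg : IsGood G (fun t => Y t ω) (fun n => X n ω) (fun n => τ n ω))
    (h0 : X 0 ω = i₀) (hσ : 0 ≤ σ) (hσ' : 0 ≤ σ') :
    ∃ (j r : V) (q : List G.Dart × List G.Dart), IsTrail i₀ q.1 j ∧ IsTrail j q.2 r ∧
      ω ∈ walkPiece X τ i₀ σ σ' q := by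
  obtain ⟨N, n, hc⟩ := hg.exists_jumpCounts hσ hσ'
  have hadj : ∀ m < n, G.Adj (X m ω) (X (m + 1) ω) := fun m hm =>
    hg.adj m ((sum_range_mono _ hm).trans_lt hc.fin)
  obtain ⟨M, rfl⟩ := Nat.exists_eq_add_of_le hc.le
  obtain ⟨d, hdl, hd, hds⟩ := exists_isTrail_of_adj N (fun m => X m ω) fun m hm =>
    hadj m (by omega)
  obtain ⟨d', hdl', hd', hds'⟩ := exists_isTrail_of_adj M (fun m => X (N + m) ω) fun m hm =>
    hadj (N + m) (by omega)
  simp only [h0] at hd hds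
  have hx : ∀ m ≤ N + M, X m ω = vertexSeq i₀ (d ++ d') m := by
    intro m hm
    rcases le_total m N with h | h
    · rw [hd.vertexSeq_append_le (hdl.symm ▸ h), hds m h]
    · obtain ⟨a, rfl⟩ := Nat.exists_eq_add_of_le h
      have h1 := hd.vertexSeq_append_right (d' := d') a
      rw [hdl] at h1
      rw [h1]
      exact (hds' a (by omega)).symm
  refine ⟨_, _, (d, d'), hd, hd', ?_⟩
  rw [walkPiece, hdl, hdl']
  exact ⟨hx, hc.congr hx⟩

/-- The jump counts fix the lengths of both walks, and the visited vertices then fix their edges. -/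
theorem walkPiece_unique {ω : Ω} {q q' : List G.Dart × List G.Dart} {j r j' r' : V}
    (hd : IsTrail i₀ q.1 j) (hd' : IsTrail j q.2 r) (he : IsTrail i₀ q'.1 j')
    (he' : IsTrail j' q'.2 r') (hω : ω ∈ walkPiece X τ i₀ σ σ' q)
    (hω' : ω ∈ walkPiece X τ i₀ σ σ' q') : q = q' := by
  obtain ⟨hN, hn⟩ := (hω.2.congr fun m hm => (hω.1 m hm).symm).unique
    (hω'.2.congr fun m hm => (hω'.1 m hm).symm)
  have happ : q.1 ++ q.2 = q'.1 ++ q'.2 := by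
    refine (hd.append hd').eq_of_vertexSeq (he.append he') (by simpa using hn) fun m hm => ?_
    rw [List.length_append] at hm
    rw [← hω.1 m hm, ← hω'.1 m (hn ▸ hm)]
  exact Prod.ext_iff.2 (List.append_inj happ hN)

variable [DecidableRel G.Adj]

/-- A good path follows exactly one pair of walks, from which endpoints, crossings and last exits
are read off by `pathData_Z`. The undirected last exit trees determine the oriented ones by
`eq_of_image_edge_eq`. -/
theorem mem_events_iff {ω : Ω}
    (hg : IsGood G (fun t => Y t ω) (fun n => X n ω) (fun n => τ n ω)) (h0 : X 0 ω = i₀)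
    (hσ : 0 ≤ σ) (hσ' : 0 ≤ σ') {j r : V} {T T' : Finset G.Dart} (hT : IsTreeTowards j T)
    (hT' : IsTreeTowards r T') (κ κ' : G.Dart → ℕ) :
    ω ∈ eventK Y σ σ' κ κ' ∩ eventE Y σ σ' j r T T' ↔
      ∃ q ∈ treeWalks T i₀ j κ ×ˢ treeWalks T' j r κ', ω ∈ walkPiece X τ i₀ σ σ' q := by
  constructor
  · rintro ⟨⟨hk, hk'⟩, hj, hr, hE, hE'⟩
    obtain ⟨j₁, r₁, q, hd, hd', hω⟩ := exists_walkPiece hg h0 hσ hσ'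
    have hp := pathData_Z hg hd hd' hσ' hω
    obtain rfl : j₁ = j := hp.left.symm.trans hj
    obtain rfl : r₁ = r := hp.right.symm.trans hr
    refine ⟨q, Finset.mem_product.2 ⟨(mem_treeWalks hT).2 ⟨hd, funext fun e => ?_, ?_⟩,
      (mem_treeWalks hT').2 ⟨hd', funext fun e => ?_, ?_⟩⟩, hω⟩
    · have := congrFun hk e
      simp only [k, hp.cross_left] at this
      exact_mod_cast this
    · rw [lastExitTree, hp.exit_left] at hE
      exact hT.eq_of_image_edge_eq (fun e he => he.1) (fun e he f hf h => he.2.unique hf.2 h) hE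
    · have := congrFun hk' e
      simp only [k', k, hp.cross_left, hp.cross_right] at this
      push_cast at this
      rw [add_sub_cancel_left] at this
      exact_mod_cast this
    · rw [lastExitTree, hp.exit_right] at hE'
      exact hT'.eq_of_image_edge_eq (fun e he => he.1) (fun e he f hf h => he.2.unique hf.2 h) hE'
  · rintro ⟨q, hq, hω⟩
    obtain ⟨hq1, hq2⟩ := Finset.mem_product.1 hq
    obtain ⟨hd, rfl, hS⟩ := (mem_treeWalks hT).1 hq1
    obtain ⟨hd', rfl, hS'⟩ := (mem_treeWalks hT').1 hq2
    have hp := pathData_Z hg hd hd' hσ' hω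
    refine ⟨⟨funext fun e => ?_, funext fun e => ?_⟩, hp.left, hp.right, ?_, ?_⟩
    · simp only [k, hp.cross_left]
    · simp only [k', k, hp.cross_left, hp.cross_right]
      push_cast
      ring
    · rw [lastExitTree, hp.exit_left, hS]
    · rw [lastExitTree, hp.exit_right, hS']

end Events

/-! ### Joint density and conditional law of the crossing numbers -/

section JointLaw

variable {V : Type*} [Fintype V] [DecidableEq V] {G : SimpleGraph V} [DecidableRel G.Adj]
  {W : Sym2 V → ℝ} {Ω : Type*} [MeasurableSpace Ω] {P : Measure Ω} [IsProbabilityMeasure P]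
  {i₀ : V} {Y : ℝ → Ω → V} {σ σ' : ℝ}

theorem IsVRJP.lintegral_events (hY : IsVRJP W P i₀ Y) (hW : ∀ e, 0 ≤ W e)
    (hW0 : ∀ e, e ∉ G.edgeSet → W e = 0) (hσ : 0 ≤ σ) (hσ' : 0 ≤ σ')
    {A : Set ((V → ℝ) × (V → ℝ))} (hAm : MeasurableSet A) (hA : A ⊆ simplex V σ ×ˢ simplex V σ')
    {j r : V} {T T' : Finset G.Dart} (hT : IsTreeTowards j T) (hT' : IsTreeTowards r T')
    (κ κ' : G.Dart → ℕ) {g : (V → ℝ) × (V → ℝ) → ℝ≥0∞} (hg : Measurable g) :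
    NullMeasurableSet (eventK Y σ σ' κ κ' ∩ eventL Y σ σ' A ∩ eventE Y σ σ' j r T T') P ∧
    ∫⁻ ω in eventK Y σ σ' κ κ' ∩ eventL Y σ σ' A ∩ eventE Y σ σ' j r T T',
        g (l Y σ ω, l' Y σ σ' ω) ∂P =
      ∫⁻ p in A, g p * ENNReal.ofReal (expFactor G W r (fun v => p.1 v + p.2 v)) *
        currentWeight W i₀ j T κ p.1 * currentWeight W j r T' κ' p.2
        ∂((hyperplaneMeasure i₀ σ).prod (hyperplaneMeasure i₀ σ')) := by
  obtain ⟨X, τ, hchain, hcover⟩ := hY.exists_isJumpChain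
  have hgood := hchain.ae_isGood (G := G) hW hW0 hY.start hcover
  set F := treeWalks T i₀ j κ ×ˢ treeWalks T' j r κ' with hF
  have hlm : ∀ q : List G.Dart × List G.Dart, Measurable (walkLocal τ i₀ σ σ' q) := fun q =>
    ((measurable_fill _ _).comp (measurable_chainLocal hchain.measurable_hold _ _)).prodMk
      (((measurable_fill _ _).comp (measurable_chainLocal hchain.measurable_hold _ _)).sub
        ((measurable_fill _ _).comp (measurable_chainLocal hchain.measurable_hold _ _)))
  set B : List G.Dart × List G.Dart → Set Ω := fun q =>
    walkPiece X τ i₀ σ σ' q ∩ walkLocal τ i₀ σ σ' q ⁻¹' A with hB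
  have hPm : ∀ q : List G.Dart × List G.Dart, MeasurableSet (walkPiece X τ i₀ σ σ' q) := fun q =>
    measurableSet_piece hchain.measurable_vertex hchain.measurable_hold _
      (Nat.le_add_right _ _) σ σ'
  have hBm : ∀ q, MeasurableSet (B q) := fun q => (hPm q).inter (hlm q hAm)
  -- The events depend on whole paths and are compared with measurable sets only up to null sets, so
  -- null-measurability is what is obtained.
  have hae : (eventK Y σ σ' κ κ' ∩ eventL Y σ σ' A ∩ eventE Y σ σ' j r T T' : Set Ω) =ᵐ[P]
      ⋃ q ∈ F, B q := by
    filter_upwards [hgood] with ω hω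
    refine propext ?_
    change ω ∈ eventK Y σ σ' κ κ' ∩ eventL Y σ σ' A ∩ eventE Y σ σ' j r T T' ↔ ω ∈ ⋃ q ∈ F, B q
    rw [Set.inter_right_comm, Set.mem_inter_iff, mem_events_iff hω.1 hω.2 hσ hσ' hT hT' κ κ']
    simp only [Set.mem_iUnion, exists_prop]
    constructor
    · rintro ⟨⟨q, hq, hωq⟩, hL⟩
      refine ⟨q, hq, hωq, ?_⟩
      rw [Set.mem_preimage, ← localTimes_eq hω.1 hσ' hωq]
      exact hL
    · rintro ⟨q, hq, hωq, hL⟩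
      refine ⟨⟨q, hq, hωq⟩, ?_⟩
      rw [Set.mem_preimage, ← localTimes_eq hω.1 hσ' hωq] at hL
      exact hL
  refine ⟨(NullMeasurableSet.congr (Finset.measurableSet_biUnion F fun q _ =>
    hBm q).nullMeasurableSet hae.symm), ?_⟩
  have hdisj : Set.PairwiseDisjoint (F : Set (List G.Dart × List G.Dart)) B := by
    intro q hq q' hq' hne
    rw [Function.onFun, Set.disjoint_left]
    rintro ω ⟨hω, -⟩ ⟨hω', -⟩
    obtain ⟨hq1, hq2⟩ := Finset.mem_product.1 hq
    obtain ⟨hq1', hq2'⟩ := Finset.mem_product.1 hq'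
    exact hne (walkPiece_unique ((mem_treeWalks hT).1 hq1).1 ((mem_treeWalks hT').1 hq2).1
      ((mem_treeWalks hT).1 hq1').1 ((mem_treeWalks hT').1 hq2').1 hω hω')
  rw [Measure.restrict_congr_set hae, lintegral_biUnion_finset hdisj fun q _ => hBm q]
  have hsum := hchain.sum_lintegral_walkPiece hW hW0 (hgood.mono fun ω h => h.2) hT hT' κ κ' hσ'
    (g := A.indicator g) (hg.indicator hAm) fun p hp => Set.indicator_of_notMem (fun h => hp (hA h)) _
  rw [← lintegral_indicator hAm]
  refine Eq.trans (Finset.sum_congr rfl fun q _ => ?_) (hsum.trans (lintegral_congr fun p => ?_))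
  · rw [show B q = walkLocal τ i₀ σ σ' q ⁻¹' A ∩ walkPiece X τ i₀ σ σ' q from Set.inter_comm _ _,
      ← Measure.restrict_restrict (hlm q hAm), ← lintegral_indicator (hlm q hAm)]
    refine lintegral_congr_ae ((ae_restrict_iff' (hPm q)).2 ?_)
    filter_upwards [hgood] with ω hω hωq
    classical
    rw [Set.indicator_apply, localTimes_eq hω.1 hσ' hωq]
    rfl
  · by_cases hp : p ∈ A
    · rw [Set.indicator_of_mem hp, Set.indicator_of_mem hp]
    · rw [Set.indicator_of_notMem hp, Set.indicator_of_notMem hp]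
      simp

theorem IsVRJP.iUnion_events_ae_eq (hY : IsVRJP W P i₀ Y) (hW : ∀ e, 0 ≤ W e)
    (hW0 : ∀ e, e ∉ G.edgeSet → W e = 0) (hσ : 0 ≤ σ) (hσ' : 0 ≤ σ')
    (A : Set ((V → ℝ) × (V → ℝ))) (j r : V) (T T' : Finset G.Dart) :
    (eventL Y σ σ' A ∩ eventE Y σ σ' j r T T' : Set Ω) =ᵐ[P]
      ⋃ q : (G.Dart → ℕ) × (G.Dart → ℕ),
        eventK Y σ σ' q.1 q.2 ∩ eventL Y σ σ' A ∩ eventE Y σ σ' j r T T' := by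
  obtain ⟨X, τ, hchain, hcover⟩ := hY.exists_isJumpChain
  filter_upwards [hchain.ae_isGood (G := G) hW hW0 hY.start hcover] with ω hω
  refine propext ?_
  change ω ∈ eventL Y σ σ' A ∩ eventE Y σ σ' j r T T' ↔ ω ∈ ⋃ q : (G.Dart → ℕ) × (G.Dart → ℕ),
    eventK Y σ σ' q.1 q.2 ∩ eventL Y σ σ' A ∩ eventE Y σ σ' j r T T'
  rw [Set.mem_iUnion]
  constructor
  · intro h
    obtain ⟨j₁, r₁, q, hd, hd', hωq⟩ := exists_walkPiece (G := G) hω.1 hω.2 hσ hσ'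
    have hp := pathData_Z hω.1 hd hd' hσ' hωq
    refine ⟨(crossCount q.1, crossCount q.2), ⟨⟨funext fun e => ?_, funext fun e => ?_⟩, h.1⟩, h.2⟩
    · simp only [k, hp.cross_left]
    · simp only [k', k, hp.cross_left, hp.cross_right]
      push_cast
      ring
  · rintro ⟨q, ⟨-, h1⟩, h2⟩
    exact ⟨h1, h2⟩

theorem eventK_disjoint {κ₁ κ₁' κ₂ κ₂' : G.Dart → ℕ} {ω : Ω} (h : ω ∈ eventK Y σ σ' κ₁ κ₁')
    (h' : ω ∈ eventK Y σ σ' κ₂ κ₂') : κ₁ = κ₂ ∧ κ₁' = κ₂' := by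
  constructor <;> funext e
  · exact_mod_cast congrFun (h.1.symm.trans h'.1) e
  · exact_mod_cast congrFun (h.2.symm.trans h'.2) e

theorem weight_nonneg (hWpos : ∀ e ∈ G.edgeSet, 0 < W e) (hW0 : ∀ e, e ∉ G.edgeSet → W e = 0)
    (e : Sym2 V) : 0 ≤ W e := by
  by_cases he : e ∈ G.edgeSet
  · exact (hWpos e he).le
  · exact (hW0 e he).ge

theorem IsVRJP.measure_events (hY : IsVRJP W P i₀ Y) (hW : ∀ e, 0 ≤ W e)
    (hW0 : ∀ e, e ∉ G.edgeSet → W e = 0) (hσ : 0 ≤ σ) (hσ' : 0 ≤ σ')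
    {A : Set ((V → ℝ) × (V → ℝ))} (hAm : MeasurableSet A) (hA : A ⊆ simplex V σ ×ˢ simplex V σ')
    {j r : V} {T T' : Finset G.Dart} (hT : IsTreeTowards j T) (hT' : IsTreeTowards r T')
    (κ κ' : G.Dart → ℕ) :
    P (eventK Y σ σ' κ κ' ∩ eventL Y σ σ' A ∩ eventE Y σ σ' j r T T') =
      ∫⁻ p in A, ENNReal.ofReal (expFactor G W r (fun v => p.1 v + p.2 v)) *
        currentWeight W i₀ j T κ p.1 * currentWeight W j r T' κ' p.2
        ∂((hyperplaneMeasure i₀ σ).prod (hyperplaneMeasure i₀ σ')) := by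
  have h := (hY.lintegral_events hW hW0 hσ hσ' hAm hA hT hT' κ κ' (g := fun _ => 1)
    measurable_const).2
  simpa only [setLIntegral_one, one_mul] using h

/-- Summing the joint formula over all crossing numbers yields the density of the local times alone;
the sum factors because κ and κ' enter through separate weights. -/
theorem IsVRJP.lintegral_tsum_events (hY : IsVRJP W P i₀ Y) (hW : ∀ e, 0 ≤ W e)
    (hW0 : ∀ e, e ∉ G.edgeSet → W e = 0) (hσ : 0 ≤ σ) (hσ' : 0 ≤ σ')
    {A : Set ((V → ℝ) × (V → ℝ))} (hAm : MeasurableSet A) (hA : A ⊆ simplex V σ ×ˢ simplex V σ')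
    {j r : V} {T T' : Finset G.Dart} (hT : IsTreeTowards j T) (hT' : IsTreeTowards r T')
    {g : (V → ℝ) × (V → ℝ) → ℝ≥0∞} (hg : Measurable g) :
    NullMeasurableSet (eventL Y σ σ' A ∩ eventE Y σ σ' j r T T') P ∧
    ∫⁻ ω in eventL Y σ σ' A ∩ eventE Y σ σ' j r T T', g (l Y σ ω, l' Y σ σ' ω) ∂P =
      ∫⁻ p in A, g p * ENNReal.ofReal (expFactor G W r (fun v => p.1 v + p.2 v)) *
        (∑' κ, currentWeight W i₀ j T κ p.1) * (∑' κ', currentWeight W j r T' κ' p.2)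
        ∂((hyperplaneMeasure i₀ σ).prod (hyperplaneMeasure i₀ σ')) := by
  have hae := hY.iUnion_events_ae_eq (G := G) hW hW0 hσ hσ' A j r T T'
  have hev := fun q : (G.Dart → ℕ) × (G.Dart → ℕ) =>
    hY.lintegral_events hW hW0 hσ hσ' hAm hA hT hT' q.1 q.2 hg
  refine ⟨(NullMeasurableSet.iUnion fun q => (hev q).1).congr hae.symm, ?_⟩
  have hdisj : Pairwise (Function.onFun (AEDisjoint P) fun q : (G.Dart → ℕ) × (G.Dart → ℕ) =>
      eventK Y σ σ' q.1 q.2 ∩ eventL Y σ σ' A ∩ eventE Y σ σ' j r T T') := by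
    intro q q' hne
    refine Disjoint.aedisjoint (Set.disjoint_left.2 ?_)
    rintro ω ⟨⟨h, -⟩, -⟩ ⟨⟨h', -⟩, -⟩
    exact hne (Prod.ext_iff.2 (eventK_disjoint h h'))
  have hem : Measurable fun p : (V → ℝ) × (V → ℝ) =>
      g p * ENNReal.ofReal (expFactor G W r (fun v => p.1 v + p.2 v)) :=
    hg.mul ((measurable_expFactor G W r).comp (measurable_fst.add measurable_snd)).ennreal_ofReal
  have hm : ∀ q : (G.Dart → ℕ) × (G.Dart → ℕ), Measurable fun p : (V → ℝ) × (V → ℝ) =>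
      g p * ENNReal.ofReal (expFactor G W r (fun v => p.1 v + p.2 v)) *
        currentWeight W i₀ j T q.1 p.1 * currentWeight W j r T' q.2 p.2 := fun q =>
    (hem.mul ((measurable_currentWeight W i₀ j T q.1).comp measurable_fst)).mul
      ((measurable_currentWeight W j r T' q.2).comp measurable_snd)
  rw [Measure.restrict_congr_set hae, lintegral_iUnion₀ (fun q => (hev q).1) hdisj]
  simp_rw [fun q => (hev q).2]
  rw [← lintegral_tsum fun q => (hm q).aemeasurable]
  refine lintegral_congr fun p => ?_
  rw [ENNReal.tsum_prod (f := fun κ κ' => g p *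
    ENNReal.ofReal (expFactor G W r (fun v => p.1 v + p.2 v)) *
      currentWeight W i₀ j T κ p.1 * currentWeight W j r T' κ' p.2)]
  simp_rw [ENNReal.tsum_mul_left, ENNReal.tsum_mul_right, ENNReal.tsum_mul_left]

/-- The conditional probability of (κ, κ') is the joint density divided by its sum over all crossing
numbers, and by `orientedCurrent_singleton` this quotient is the product of the two current laws. -/
theorem IsVRJP.measure_events_eq_lintegral (hY : IsVRJP W P i₀ Y)
    (hWpos : ∀ e ∈ G.edgeSet, 0 < W e) (hW0 : ∀ e, e ∉ G.edgeSet → W e = 0) (hσ : 0 ≤ σ)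
    (hσ' : 0 ≤ σ') {A : Set ((V → ℝ) × (V → ℝ))} (hAm : MeasurableSet A)
    (hA : A ⊆ simplex V σ ×ˢ simplex V σ') {j r : V} {T T' : Finset G.Dart}
    (hT : IsTreeTowards j T) (hT' : IsTreeTowards r T') (κ κ' : G.Dart → ℕ) :
    P (eventK Y σ σ' κ κ' ∩ eventL Y σ σ' A ∩ eventE Y σ σ' j r T T') =
      ∫⁻ ω in eventL Y σ σ' A ∩ eventE Y σ σ' j r T T',
        orientedCurrent W i₀ j (l Y σ ω) T {κ} *
          orientedCurrent W j r (l' Y σ σ' ω) T' {κ'} ∂P := by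
  have hW := weight_nonneg hWpos hW0
  set g : (V → ℝ) × (V → ℝ) → ℝ≥0∞ := fun p =>
    currentWeight W i₀ j T κ p.1 / (∑' m, currentWeight W i₀ j T m p.1) *
      (currentWeight W j r T' κ' p.2 / ∑' m, currentWeight W j r T' m p.2) with hg
  have hgm : Measurable g := by
    have hS : ∀ (i j : V) (T : Finset G.Dart),
        Measurable fun l : V → ℝ => ∑' m, currentWeight W i j T m l := fun i j T =>
      Measurable.tsum fun m => measurable_currentWeight W i j T m
    exact (((measurable_currentWeight W i₀ j T κ).div (hS i₀ j T)).comp measurable_fst).mul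
      (((measurable_currentWeight W j r T' κ').div (hS j r T')).comp measurable_snd)
  obtain ⟨hnull, hint⟩ := hY.lintegral_tsum_events hW hW0 hσ hσ' hAm hA hT hT' hgm
  have hcongr : ∫⁻ ω in eventL Y σ σ' A ∩ eventE Y σ σ' j r T T',
      orientedCurrent W i₀ j (l Y σ ω) T {κ} * orientedCurrent W j r (l' Y σ σ' ω) T' {κ'} ∂P =
      ∫⁻ ω in eventL Y σ σ' A ∩ eventE Y σ σ' j r T T', g (l Y σ ω, l' Y σ σ' ω) ∂P := by
    refine lintegral_congr_ae ((ae_restrict_iff'₀ hnull).2 (Eventually.of_forall fun ω hω => ?_))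
    have hω' := hA hω.1
    change orientedCurrent W i₀ j (l Y σ ω) T {κ} * orientedCurrent W j r (l' Y σ σ' ω) T' {κ'} = _
    rw [orientedCurrent_singleton hW hWpos hω'.1.1, orientedCurrent_singleton hW hWpos hω'.2.1]
  rw [hcongr, hint, hY.measure_events hW hW0 hσ hσ' hAm hA hT hT']
  refine setLIntegral_congr_fun hAm fun p hp => ?_
  have h1 := currentWeight_div_mul_tsum hW hWpos (hA hp).1.1 i₀ j T κ
  have h2 := currentWeight_div_mul_tsum hW hWpos (hA hp).2.1 j r T' κ'
  -- Each weight is written as its normalized value times the sum; the sums form the density of the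
  -- local times found in `hint`.
  conv_lhs => rw [← h1, ← h2]
  simp only [hg]
  ring

end JointLaw

end VRJP

end

/-! ### The theorem -/

theorem mainTheorem3 {V : Type*} [Fintype V] [DecidableEq V]
    (G : SimpleGraph V) [DecidableRel G.Adj]
    (W : Sym2 V → ℝ) (hWpos : ∀ e ∈ G.edgeSet, 0 < W e) (hWzero : ∀ e, e ∉ G.edgeSet → W e = 0)
    {Ω : Type*} [MeasurableSpace Ω] (P : Measure Ω) [IsProbabilityMeasure P]
    (i₀ : V) (Y : ℝ → Ω → V) (hY : VRJP.IsVRJP W P i₀ Y)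
    (σ σ' : ℝ) (hσ : 0 < σ) (hσ' : 0 < σ')
    (A : Set ((V → ℝ) × (V → ℝ))) (hAmeas : MeasurableSet A)
    (hA : A ⊆ VRJP.simplex V σ ×ˢ VRJP.simplex V σ')
    (i₁ i₁' : V) (T T' : Finset G.Dart)
    (hT : VRJP.IsTreeTowards i₁ T) (hT' : VRJP.IsTreeTowards i₁' T') :
    -- the joint density
    (∀ k k' : G.Dart → ℕ, (∀ e, 0 < k e) → (∀ e, 0 < k' e) →
      (fun e => (k e : ℤ)) ∈ VRJP.currents G i₀ i₁ →
      (fun e => (k' e : ℤ)) ∈ VRJP.currents G i₁ i₁' →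
      P (VRJP.eventK Y σ σ' k k' ∩ VRJP.eventL Y σ σ' A ∩ VRJP.eventE Y σ σ' i₁ i₁' T T') =
        ∫⁻ p in A, ENNReal.ofReal
          (VRJP.expFactor G W i₁' (fun i => p.1 i + p.2 i) *
            VRJP.pathFactor W k p.1 T * VRJP.pathFactor W k' p.2 T')
          ∂((VRJP.hyperplaneMeasure i₀ σ).prod (VRJP.hyperplaneMeasure i₀ σ'))) ∧
    -- given the local times, the endpoints and the last exit trees, the crossing numbers
    -- are independent oriented random currents
    (∀ k k' : G.Dart → ℕ,
      P (VRJP.eventK Y σ σ' k k' ∩ VRJP.eventL Y σ σ' A ∩ VRJP.eventE Y σ σ' i₁ i₁' T T') =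
        ∫⁻ ω in VRJP.eventL Y σ σ' A ∩ VRJP.eventE Y σ σ' i₁ i₁' T T',
          VRJP.orientedCurrent W i₀ i₁ (VRJP.l Y σ ω) T {k} *
            VRJP.orientedCurrent W i₁ i₁' (VRJP.l' Y σ σ' ω) T' {k'} ∂P) := by
  have hW := VRJP.weight_nonneg hWpos hWzero
  refine ⟨fun k k' _ _ hk hk' => ?_, fun k k' =>
    hY.measure_events_eq_lintegral hWpos hWzero hσ.le hσ'.le hAmeas hA hT hT' k k'⟩
  rw [hY.measure_events hW hWzero hσ.le hσ'.le hAmeas hA hT hT']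
  refine setLIntegral_congr_fun hAmeas fun p hp => ?_
  rw [ENNReal.ofReal_mul (mul_nonneg (VRJP.expFactor_nonneg G W _ _)
      (VRJP.pathFactor_nonneg hW (hA hp).1.1 _ _)),
    ENNReal.ofReal_mul (VRJP.expFactor_nonneg G W _ _), VRJP.currentWeight, VRJP.currentWeight,
    if_pos (VRJP.mem_currents_iff.1 hk), if_pos (VRJP.mem_currents_iff.1 hk')]
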